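/- Let $n\in\mathbb N$ and let $p_H:\mathbb R^n\to[0,\infty)$ be a probability density with $\int \|x\|^2 p_H(x)\,dx<\infty$. Write $\phi_{\Sigma,m}$ for the density of $\mathcal N(m,\Sigma)$ and $p_Z=\phi_{I_n,0}$. Let $(p_t)_{t\ge 0}$ be the marginal densities of the variance-preserving process $dX_t=-\tfrac12X_t\,dt+dW_t$, $X_0\sim p_H$, that is, $p_0=p_H$ and $$p_t(x)=\int_{\mathbb R^n}p_H(y)\,\phi_{(1-e^{-t})I_n,0}\bigl(x-e^{-t/2}y\bigr)\,dy\qquad(t>0),$$ and let $\varphi_{s\to t}$ denote the solution map from time $s$ to time $t$ of the probability flow ODE $$\frac{dx}{dr}=v_r(x):=-\tfrac12x-\tfrac12\nabla\log p_r(x).$$ Assume that $p_H$ satisfies at least one of the following: - (A1) $p_H$ has compact support; - (A2) $p_H=\tfrac1Z e^{-V}$ with $Z>0$, $V\in C^2(\mathbb R^n)$ and $\nabla^2V(x)\succeq0$ for all $x$; - (A3) $p_H(x)=\int\phi_{\Sigma,0}(x-y)\,d\mu(y)$ for a symmetric positive definite matrix $\Sigma$ and a probability measure $\mu$ on $\mathbb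 R^n$ with compact support; - (A4) $p_H=\sum_{k=1}^K\alpha_k\phi_{\Sigma,m_k}$ with $\alpha_k>0$, $\sum_k\alpha_k=1$, $m_k\in\mathbb R^n$ and a fixed symmetric positive definite matrix $\Sigma$. Then for every $\varepsilon>0$ there exist $\delta>0$ and $T>\delta$ such that $\varphi_\varepsilon:=\varphi_{\delta\to T}$ is well defined (from every initial point at time $\delta$ the ODE has a solution on $[\delta,T]$, and its value at time $T$ is unique), is a bi-Lipschitz $C^1$-diffeomorphism of $\mathbb R^n$, and satisfies (i) (latent side) $$D_{\mathrm{KL}}\bigl((\varphi_\varepsilon)_\#p_\delta\,\|\,p_Z\bigr)<\varepsilon,\qquad \|(\varphi_\varepsilon)_\#p_\delta-p_Z\|_{L^p(\mathbb R^n)}<\varepsilon,\qquad W_p\bigl((\varphi_\varepsilon)_\#p_\delta,p_Z\bigr)<\varepsilon\qquad(p=1,2);$$ (ii) (target side) $$\|p_H-(\varphi_\varepsilon^{-1})_\#p_Z\|_{L^1}<\varepsilon.$$ If moreover $p_H$ satisfies (A3) or (A4), then for every $\varepsilon>0$ there exists $T>0$ such that $\varphi_\varepsilon:=\varphi_{0\to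 T}$ is well defined in the same sense, is a bi-Lipschitz $C^1$-diffeomorphism of $\mathbb R^n$, and satisfies $$D_{\mathrm{KL}}\bigl(p_H\,\|\,(\varphi_\varepsilon^{-1})_\#p_Z\bigr)<\varepsilon.$$ -/

import Mathlib

open MeasureTheory Set
open scoped ENNReal NNReal

namespace VPFlow

/-- `ℝⁿ` with the Euclidean norm. -/
abbrev E (n : ℕ) := EuclideanSpace ℝ (Fin n)

variable {n : ℕ}

/-- `p` is a probability density on `ℝⁿ` with respect to Lebesgue measure. -/
structure IsPdf (p : E n → ℝ) : Prop where
  nonneg : ∀ x, 0 ≤ p x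
  integrable : Integrable p volume
  integral_eq_one : ∫ x, p x = 1

/-- The measure with Lebesgue density `p`. -/
noncomputable def densityMeasure (p : E n → ℝ) : Measure (E n) :=
  volume.withDensity (fun x => ENNReal.ofReal (p x))

/-- The isotropic Gaussian density `φ_{v, m}` with mean `m` and covariance `v • I` (`v > 0`). -/
noncomputable def gaussIso (v : ℝ) (m x : E n) : ℝ :=
  (2 * Real.pi * v) ^ (-(n : ℝ) / 2) * Real.exp (-(‖x - m‖ ^ 2) / (2 * v))

/-- The Gaussian density `φ_{Σ, m}` with mean `m` and positive definite covariance matrix `S`. -/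
noncomputable def gaussMat (S : Matrix (Fin n) (Fin n) ℝ) (m x : E n) : ℝ :=
  (Real.sqrt ((2 * Real.pi) ^ n * S.det))⁻¹ *
    Real.exp (-((x - m).ofLp ⬝ᵥ (S⁻¹.mulVec (x - m).ofLp)) / 2)

/-- The standard Gaussian density `p_Z`. -/
noncomputable def stdGaussDensity (x : E n) : ℝ := gaussIso 1 0 x

/-- The standard Gaussian law. -/
noncomputable def stdGaussMeasure (n : ℕ) : Measure (E n) :=
  densityMeasure (stdGaussDensity (n := n))

/-! ### The variance-preserving process `dX = -X/2 dt + dW`, `X₀ ∼ p_H` -/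

/-- `a(t) = exp (-t/2)`. -/
noncomputable def aCoef (t : ℝ) : ℝ := Real.exp (-t / 2)

/-- `σ²(t) = 1 - exp (-t)`. -/
noncomputable def sigmaSq (t : ℝ) : ℝ := 1 - Real.exp (-t)

/-- The marginal density `p_t` of the process: conditionally on `X₀ = y`, the variable `X_t` has law
`N (a(t) y, σ²(t) I)`, so `p_t (x) = ∫ p_H (y) φ_{σ²(t), 0} (x - a(t) y) dy` for `t > 0`;
at `t = 0` it is `p_H`. Only times `t ≥ 0` are used. -/
noncomputable def vpDensity (pH : E n → ℝ) (t : ℝ) (x : E n) : ℝ :=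
  if t = 0 then pH x else ∫ y, pH y * gaussIso (sigmaSq t) 0 (x - aCoef t • y)

/-- The score `s_t = ∇ log p_t`. -/
noncomputable def vpScore (pH : E n → ℝ) (t : ℝ) (x : E n) : E n :=
  gradient (fun y => Real.log (vpDensity pH t y)) x

/-- The velocity field `v_t (x) = -x/2 - s_t(x)/2` of the probability flow ODE. -/
noncomputable def vpVelocity (pH : E n → ℝ) (t : ℝ) (x : E n) : E n :=
  -((1 / 2 : ℝ) • x) - (1 / 2 : ℝ) • vpScore pH t x

/-- `φ = φ_{s → t}` is the solution map of `x' = v_r (x)` from time `s` to time `t`: from every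
initial point a solution on `[s, t]` exists, and every solution on `[s, t]` starting at `x` at
time `s` is at `φ x` at time `t`. -/
def IsSolutionMap (v : ℝ → E n → E n) (s t : ℝ) (φ : E n → E n) : Prop :=
  ∀ x, (∃ γ : ℝ → E n, γ s = x ∧ IsIntegralCurveOn γ v (Icc s t)) ∧
    ∀ γ : ℝ → E n, γ s = x → IsIntegralCurveOn γ v (Icc s t) → γ t = φ x

/-- `φ` is a bi-Lipschitz `C¹`-diffeomorphism of `ℝⁿ` onto itself. -/
structure IsBiLipschitzDiffeo (φ : E n ≃ E n) : Prop where
  contDiff : ContDiff ℝ 1 φ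
  contDiff_symm : ContDiff ℝ 1 φ.symm
  lipschitz : ∃ K : ℝ≥0, LipschitzWith K φ
  lipschitz_symm : ∃ K : ℝ≥0, LipschitzWith K φ.symm

/-! ### Distances between laws -/

open scoped Classical in
/-- The `L^q` norm of the difference of the Lebesgue densities of `μ` and `ν`
(`∞` if one of them has no density). -/
noncomputable def densityLpDist (q : ℝ≥0∞) (μ ν : Measure (E n)) : ℝ≥0∞ :=
  if μ ≪ volume ∧ ν ≪ volume then
    eLpNorm (fun x => (μ.rnDeriv volume x).toReal - (ν.rnDeriv volume x).toReal) q volume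
  else ∞

/-- The Wasserstein distance `W_q` with respect to the Euclidean distance: the infimum over all
couplings `π` of `μ` and `ν` of `(∫ ‖x - y‖ ^ q dπ) ^ (1 / q)`. -/
noncomputable def wasserstein (q : ℝ) (μ ν : Measure (E n)) : ℝ≥0∞ :=
  (⨅ π ∈ {π : Measure (E n × E n) | π.map Prod.fst = μ ∧ π.map Prod.snd = ν},
    ∫⁻ z, edist z.1 z.2 ^ q ∂π) ^ (1 / q)

/-! ### The four classes of target densities -/

/-- Log-concave: `p = e^{-V} / Z` with `Z > 0`, `V ∈ C²(ℝⁿ)` and `∇²V ⪰ 0`. -/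
def IsLogConcaveDensity (p : E n → ℝ) : Prop :=
  ∃ (Z : ℝ) (V : E n → ℝ), 0 < Z ∧ ContDiff ℝ 2 V ∧
    (∀ x v, 0 ≤ fderiv ℝ (fderiv ℝ V) x v v) ∧ ∀ x, p x = 1 / Z * Real.exp (-V x)

/-- Gaussian convolution: `p = φ_{Σ,0} * μ` with `Σ` symmetric positive definite and `μ` a
compactly supported probability measure. -/
def IsGaussianConvolution (p : E n → ℝ) : Prop :=
  ∃ (S : Matrix (Fin n) (Fin n) ℝ) (μ : Measure (E n)), S.PosDef ∧ IsProbabilityMeasure μ ∧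
    IsCompact μ.support ∧ ∀ x, p x = ∫ y, gaussMat S 0 (x - y) ∂μ

/-- Finite Gaussian mixture: `p = ∑ₖ αₖ φ_{Σ, mₖ}` with `αₖ > 0`, `∑ₖ αₖ = 1` and one fixed
symmetric positive definite `Σ`. -/
def IsGaussianMixture (p : E n → ℝ) : Prop :=
  ∃ (S : Matrix (Fin n) (Fin n) ℝ) (K : ℕ) (α : Fin K → ℝ) (m : Fin K → E n), S.PosDef ∧
    (∀ k, 0 < α k) ∧ ∑ k, α k = 1 ∧ ∀ x, p x = ∑ k, α k * gaussMat S (m k) x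

end VPFlow

open VPFlow

/-! Everything rests on writing each marginal `p_t` as a Gaussian mixture `c(t) ∫ g_t(x - a(t) y)
dμ(y)`, with one mixing measure `μ` and a kernel `g_t` diagonal in one orthonormal basis
(`MixtureRep`). The posterior of `y` given `x` is then an exponential family. The score is affine in
the posterior mean (Tweedie's formula), and the Jacobian of the score is a fixed matrix plus a
rescaled posterior covariance. If the posterior variance is bounded uniformly in `x` and in `t ∈ [s,
T]`, the velocity is `C¹` in space with bounded derivative, so the flow is global, bi-Lipschitz and
`C¹` with a `C¹` inverse (`IsC1Field.exists_flow`).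

The variance bound is where the four classes enter. For (A1), `μ` is the law `p_H` and the posterior
lives in a fixed ball. For (A2), `μ` is again `p_H`; the posterior has density `exp (-U)` with `U`
strongly convex, and comparing this density with its dilation about the mode bounds the second
moment. For (A3), `μ` is the compactly supported mixing measure itself and the kernel variances are
`a(t)² d i + σ²(t)` along an eigenbasis of `Σ`. These stay positive at `t = 0`, which is why the
flow may start at time `0` in this class. (A4) is (A3) with a finite sum of Dirac masses.

The continuity equation along characteristics (`hasDerivAt_vpDensity_along`) and Liouville's formula
give `|det φ'(x)| p_T(φ x) = p_δ(x)`, that is `φ_# p_δ = p_T`. The latent side is thus convergence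
of `p_T` to the standard Gaussian law. With `X_T = a Y + σ Z`, the coupling of `X_T` with `Z`
handles the Wasserstein distances. Data processing from the joint law of `(Y, X_T)`, compared with
the product of the marginal laws of `Y` and `Z`, bounds the relative entropy by an explicit
expectation. Scheffé's lemma gives `L¹`, and a uniform bound on the densities then gives `L²`.

For the target side, pulling back by `φ` is an `L¹` isometry of densities, so the error is at most
`‖p_H - p_δ‖ + ‖p_T - p_Z‖`; the first term is small because smoothing is an `L¹` contraction that
converges on continuous compactly supported functions. When the flow starts at time `0`, `p_H` is
exactly the pullback of `p_T`, and data processing under `φ⁻¹` gives the last claim. -/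

/-! ### Flows of globally Lipschitz time-dependent vector fields -/

namespace ODEFlow

open Metric Function Filter Topology

/-! ### Global solutions on a compact time interval and their stability. -/

section Existence

variable {F : Type*} [NormedAddCommGroup F] [NormedSpace ℝ F]

/-- The radial retraction of a normed space onto the closed ball of radius `R`. -/
noncomputable def radialRetraction (R : ℝ) (x : F) : F := (R / max R ‖x‖) • x

theorem norm_radialRetraction_le {R : ℝ} (hR : 0 < R) (x : F) : ‖radialRetraction R x‖ ≤ R := by
  have hm : 0 < max R ‖x‖ := lt_max_of_lt_left hR
  rw [radialRetraction, norm_smul, Real.norm_of_nonneg (by positivity), div_mul_eq_mul_div,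
    div_le_iff₀ hm]
  exact mul_le_mul_of_nonneg_left (le_max_right _ _) hR.le

theorem norm_radialRetraction_le_norm {R : ℝ} (hR : 0 < R) (x : F) :
    ‖radialRetraction R x‖ ≤ ‖x‖ := by
  have hm : 0 < max R ‖x‖ := lt_max_of_lt_left hR
  rw [radialRetraction, norm_smul, Real.norm_of_nonneg (by positivity)]
  exact mul_le_of_le_one_left (norm_nonneg _) ((div_le_one hm).2 (le_max_left _ _))

theorem radialRetraction_of_norm_le {R : ℝ} (hR : 0 < R) {x : F} (hx : ‖x‖ ≤ R) :
    radialRetraction R x = x := by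
  rw [radialRetraction, max_eq_left hx, div_self hR.ne', one_smul]

/-- Moving the vector with the factor frozen, and moving the factor with the vector frozen, each
cost at most `‖x - y‖`. The argument uses no inner product, so it also applies to spaces of
operators, where the variational equation is solved. -/
theorem lipschitzWith_radialRetraction {R : ℝ} (hR : 0 < R) :
    LipschitzWith 2 (radialRetraction R : F → F) := by
  refine LipschitzWith.of_dist_le_mul fun x y => ?_
  have hx : 0 < max R ‖x‖ := lt_max_of_lt_left hR
  have hy : 0 < max R ‖y‖ := lt_max_of_lt_left hR
  have hsplit : radialRetraction R x - radialRetraction R y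
      = (R / max R ‖x‖) • (x - y) + (R / max R ‖x‖ - R / max R ‖y‖) • y := by
    simp only [radialRetraction, smul_sub, sub_smul]; abel
  have h1 : ‖(R / max R ‖x‖) • (x - y)‖ ≤ ‖x - y‖ := by
    rw [norm_smul, Real.norm_of_nonneg (by positivity)]
    exact mul_le_of_le_one_left (norm_nonneg _) ((div_le_one hx).2 (le_max_left _ _))
  have h2 : ‖(R / max R ‖x‖ - R / max R ‖y‖) • y‖ ≤ ‖x - y‖ := by
    have e : R / max R ‖x‖ - R / max R ‖y‖
        = (R / max R ‖x‖) * ((max R ‖y‖ - max R ‖x‖) / max R ‖y‖) := by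
      field_simp
    have hmax : |max R ‖y‖ - max R ‖x‖| ≤ ‖x - y‖ := by
      refine (abs_max_sub_max_le_max _ _ _ _).trans ?_
      simp only [sub_self, abs_zero]
      rw [norm_sub_rev]
      exact max_le (norm_nonneg _) (abs_norm_sub_norm_le y x)
    rw [norm_smul, e, norm_mul, Real.norm_of_nonneg (by positivity : 0 ≤ R / max R ‖x‖),
      norm_div _ (max R ‖y‖), Real.norm_of_nonneg hy.le, Real.norm_eq_abs]
    calc R / max R ‖x‖ * (|max R ‖y‖ - max R ‖x‖| / max R ‖y‖) * ‖y‖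
        = (R / max R ‖x‖) * |max R ‖y‖ - max R ‖x‖| * (‖y‖ / max R ‖y‖) := by ring
      _ ≤ 1 * ‖x - y‖ * 1 := by
          gcongr
          · exact (div_le_one hx).2 (le_max_left _ _)
          · exact (div_le_one hy).2 (le_max_right _ _)
      _ = ‖x - y‖ := by ring
  rw [dist_eq_norm, dist_eq_norm, hsplit]
  calc _ ≤ _ := norm_add_le _ _
    _ ≤ ‖x - y‖ + ‖x - y‖ := add_le_add h1 h2
    _ = _ := by push_cast; ring

theorem hasDerivWithinAt_Ici_of_Icc {f : ℝ → F} {f' : F} {s T t : ℝ}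
    (h : HasDerivWithinAt f f' (Icc s T) t) (ht : t ∈ Ico s T) :
    HasDerivWithinAt f f' (Ici t) t :=
  h.mono_of_mem_nhdsWithin (Icc_mem_nhdsGE_of_mem ht)

/-- Precomposing the field with a radial retraction makes it bounded, so a single application of
Picard–Lindelöf covers all of `[s, T]`. The linear growth of `v` survives the truncation, and
Grönwall keeps the solution inside the ball where the truncation is invisible. -/
theorem exists_isIntegralCurveOn_Icc [CompleteSpace F] {v : ℝ → F → F} {s T : ℝ}
    (hsT : s ≤ T) {K : ℝ≥0}
    (hlip : ∀ t ∈ Icc s T, LipschitzWith K (v t))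
    (hcont : ∀ x, ContinuousOn (fun t => v t x) (Icc s T)) (x₀ : F) :
    ∃ γ : ℝ → F, γ s = x₀ ∧ IsIntegralCurveOn γ v (Icc s T) := by
  obtain ⟨C, hC⟩ := (isCompact_Icc.image_of_continuousOn (hcont 0)).isBounded.exists_norm_le
  have hC' : ∀ t ∈ Icc s T, ‖v t 0‖ ≤ C := fun t ht => hC _ (mem_image_of_mem _ ht)
  have hC0 : 0 ≤ C := (norm_nonneg _).trans (hC' s ⟨le_rfl, hsT⟩)
  have hgrow : ∀ t ∈ Icc s T, ∀ x, ‖v t x‖ ≤ K * ‖x‖ + C := fun t ht x => by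
    have h := (hlip t ht).dist_le_mul x 0
    rw [dist_eq_norm, dist_eq_norm, sub_zero] at h
    have h' := norm_le_norm_add_norm_sub (v t 0) (v t x)
    rw [norm_sub_rev] at h'
    linarith [hC' t ht]
  -- `R` is the a priori bound at the final time; the added `1` makes it positive even when that
  -- bound is `0`.
  set R : ℝ := gronwallBound ‖x₀‖ K C (T - s) + 1 with hRdef
  have hmono := gronwallBound_mono (norm_nonneg x₀) hC0 K.coe_nonneg
  have hR : 0 < R := by
    have := hmono (sub_nonneg.2 hsT)
    rw [gronwallBound_x0] at this
    linarith [norm_nonneg x₀]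
  set w : ℝ → F → F := fun t x => v t (radialRetraction R x) with hw
  set L : ℝ≥0 := ⟨K * R + C, by positivity⟩ with hL
  have hPL : IsPicardLindelof w (⟨s, le_rfl, hsT⟩ : Icc s T) x₀
      (L * ⟨T - s, sub_nonneg.2 hsT⟩) 0 L (K * 2) := by
    refine ⟨fun t ht => ?_, fun x _ => hcont _, fun t ht x _ => ?_, ?_⟩
    · exact ((hlip t ht).comp (lipschitzWith_radialRetraction hR)).lipschitzOnWith
    · refine (hgrow t ht _).trans ?_
      change _ ≤ K * R + C
      gcongr
      exact norm_radialRetraction_le hR x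
    · simp only [sub_self, NNReal.coe_zero, sub_zero]
      rw [max_eq_left (sub_nonneg.2 hsT)]
      rfl
  obtain ⟨γ, hγ0, hγ⟩ := hPL.exists_eq_forall_mem_Icc_hasDerivWithinAt₀
  refine ⟨γ, hγ0, fun t ht => ?_⟩
  have hbound := norm_le_gronwallBound_of_norm_deriv_right_le (f := γ)
    (f' := fun t => w t (γ t)) (δ := ‖x₀‖) (K := K) (ε := C) (a := s) (b := T)
    (fun t ht => (hγ t ht).continuousWithinAt)
    (fun t ht => hasDerivWithinAt_Ici_of_Icc (hγ t (Ico_subset_Icc_self ht)) ht)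
    (by simpa using (congrArg norm hγ0).le)
    (fun t ht => (hgrow t (Ico_subset_Icc_self ht) _).trans (by
      gcongr; exact norm_radialRetraction_le_norm hR _)) t ht
  have hle : ‖γ t‖ ≤ R := by
    have := hmono (sub_le_sub_right ht.2 s)
    linarith
  have h := hγ t ht
  simp only [hw, radialRetraction_of_norm_le hR hle] at h
  exact h

theorem IsIntegralCurveOn.dist_le {v : ℝ → F → F} {s T : ℝ} {K : ℝ≥0}
    (hlip : ∀ t ∈ Icc s T, LipschitzWith K (v t)) {γ γ' : ℝ → F}
    (hγ : IsIntegralCurveOn γ v (Icc s T)) (hγ' : IsIntegralCurveOn γ' v (Icc s T))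
    {t : ℝ} (ht : t ∈ Icc s T) :
    dist (γ t) (γ' t) ≤ dist (γ s) (γ' s) * Real.exp (K * (t - s)) :=
  dist_le_of_trajectories_ODE_of_mem (s := fun _ => univ)
    (fun t ht => (hlip t (Ico_subset_Icc_self ht)).lipschitzOnWith)
    hγ.continuousOn (fun t ht => hasDerivWithinAt_Ici_of_Icc (hγ t (Ico_subset_Icc_self ht)) ht)
    (fun _ _ => trivial)
    hγ'.continuousOn (fun t ht => hasDerivWithinAt_Ici_of_Icc (hγ' t (Ico_subset_Icc_self ht)) ht)
    (fun _ _ => trivial) le_rfl t ht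

theorem IsIntegralCurveOn.reverse {v : ℝ → F → F} {s T : ℝ} {γ : ℝ → F}
    (hγ : IsIntegralCurveOn γ v (Icc s T)) :
    IsIntegralCurveOn (fun t => γ (s + T - t)) (fun t x => -v (s + T - t) x) (Icc s T) := by
  intro t ht
  have hmaps : MapsTo (fun t : ℝ => s + T - t) (Icc s T) (Icc s T) :=
    fun t ht => ⟨by linarith [ht.2], by linarith [ht.1]⟩
  have h := (hγ (s + T - t) (hmaps ht)).scomp t
    (((hasDerivAt_id t).const_sub (s + T)).hasDerivWithinAt) hmaps
  simpa [Function.comp_def] using h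

end Existence

/-- A time-dependent vector field on `[s, T]` which is `C¹` in space, with a spatial derivative that
is jointly continuous and bounded by `K`. -/
structure IsC1Field {F : Type*} [NormedAddCommGroup F] [NormedSpace ℝ F] (v : ℝ → F → F)
    (Dv : ℝ → F → F →L[ℝ] F) (s T : ℝ) (K : ℝ≥0) : Prop where
  continuousOn_time : ∀ x, ContinuousOn (fun t => v t x) (Icc s T)
  hasFDerivAt : ∀ t ∈ Icc s T, ∀ x, HasFDerivAt (v t) (Dv t x) x
  continuousOn_deriv : ContinuousOn (uncurry Dv) (Icc s T ×ˢ univ)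
  norm_deriv_le : ∀ t ∈ Icc s T, ∀ x, ‖Dv t x‖ ≤ K

/-! ### The flow of a `C¹` field: differentiability, inverse, Jacobian. -/

section Flow

variable {F : Type*} [NormedAddCommGroup F] [NormedSpace ℝ F]
  {v : ℝ → F → F} {Dv : ℝ → F → F →L[ℝ] F} {s T : ℝ} {K : ℝ≥0}

theorem IsC1Field.lipschitzWith (h : IsC1Field v Dv s T K) {t : ℝ} (ht : t ∈ Icc s T) :
    LipschitzWith K (v t) :=
  lipschitzWith_of_nnnorm_fderiv_le (𝕜 := ℝ)
    (fun x => (h.hasFDerivAt t ht x).differentiableAt)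
    (fun x => by rw [(h.hasFDerivAt t ht x).fderiv]; exact h.norm_deriv_le t ht x)

theorem IsC1Field.reverse (h : IsC1Field v Dv s T K) :
    IsC1Field (fun t x => -v (s + T - t) x) (fun t x => -Dv (s + T - t) x) s T K := by
  have hmaps : MapsTo (fun t : ℝ => s + T - t) (Icc s T) (Icc s T) :=
    fun t ht => ⟨by linarith [ht.2], by linarith [ht.1]⟩
  refine ⟨fun x => ?_, fun t ht x => ?_, ?_, fun t ht x => ?_⟩
  · exact ((h.continuousOn_time x).comp (by fun_prop) hmaps).neg
  · exact (h.hasFDerivAt _ (hmaps ht) x).neg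
  · refine ContinuousOn.neg ?_
    exact h.continuousOn_deriv.comp (f := fun p : ℝ × F => (s + T - p.1, p.2))
      (by fun_prop) (fun p hp => ⟨hmaps hp.1, trivial⟩)
  · rw [norm_neg]; exact h.norm_deriv_le _ (hmaps ht) x

theorem IsC1Field.exists_curve [FiniteDimensional ℝ F]
    (h : IsC1Field v Dv s T K) (hsT : s ≤ T) (x : F) :
    ∃ γ : ℝ → F, γ s = x ∧ IsIntegralCurveOn γ v (Icc s T) :=
  have := FiniteDimensional.complete ℝ F
  exists_isIntegralCurveOn_Icc hsT (fun _ ht => h.lipschitzWith ht) h.continuousOn_time x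

theorem IsC1Field.continuousOn_deriv_curve (h : IsC1Field v Dv s T K) {γ : ℝ → F}
    (hγ : IsIntegralCurveOn γ v (Icc s T)) : ContinuousOn (fun t => Dv t (γ t)) (Icc s T) :=
  h.continuousOn_deriv.comp (f := fun t => (t, γ t)) (continuousOn_id.prodMk hγ.continuousOn)
    (fun _ ht => ⟨ht, trivial⟩)

/-- The variational equation along a curve. -/
theorem IsC1Field.exists_jacobian [FiniteDimensional ℝ F]
    (h : IsC1Field v Dv s T K) (hsT : s ≤ T) {γ : ℝ → F}
    (hγ : IsIntegralCurveOn γ v (Icc s T)) :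
    ∃ J : ℝ → F →L[ℝ] F, J s = ContinuousLinearMap.id ℝ F ∧
      IsIntegralCurveOn J (fun t M => (Dv t (γ t)).comp M) (Icc s T) := by
  have := FiniteDimensional.complete ℝ F
  refine exists_isIntegralCurveOn_Icc hsT (K := K) (fun t ht => ?_) (fun M => ?_) _
  · refine LipschitzWith.of_dist_le_mul fun M N => ?_
    rw [dist_eq_norm, dist_eq_norm, ← ContinuousLinearMap.comp_sub]
    exact (ContinuousLinearMap.opNorm_comp_le _ _).trans
      (mul_le_mul_of_nonneg_right (h.norm_deriv_le t ht _) (norm_nonneg _))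
  · exact (h.continuousOn_deriv_curve hγ).clm_comp continuousOn_const

/-- Uniform continuity of `Dv` on a compact tube around the curve, of radius at most `1`. It takes
the place of a bound on second derivatives in the two Grönwall arguments below. -/
theorem IsC1Field.exists_uniform_near [FiniteDimensional ℝ F]
    (h : IsC1Field v Dv s T K) {γ : ℝ → F}
    (hγ : IsIntegralCurveOn γ v (Icc s T)) {η : ℝ} (hη : 0 < η) :
    ∃ ρ > 0, ∀ t ∈ Icc s T, ∀ z, ‖z - γ t‖ ≤ ρ → ‖Dv t z - Dv t (γ t)‖ ≤ η := by
  have := FiniteDimensional.proper ℝ F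
  have hc : ContinuousOn (fun p : ℝ × F => Dv p.1 (γ p.1 + p.2)) (Icc s T ×ˢ closedBall 0 1) := by
    refine h.continuousOn_deriv.comp (f := fun p : ℝ × F => (p.1, γ p.1 + p.2)) ?_
      (fun p hp => ⟨hp.1, trivial⟩)
    exact continuousOn_fst.prodMk
      ((hγ.continuousOn.comp continuousOn_fst fun p hp => hp.1).add continuousOn_snd)
  have hu := (isCompact_Icc.prod (isCompact_closedBall (0 : F) 1)).uniformContinuousOn_of_continuous
    hc
  rw [Metric.uniformContinuousOn_iff] at hu
  obtain ⟨δ, hδ, hu⟩ := hu η hη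
  refine ⟨min (δ / 2) 1, by positivity, fun t ht z hz => ?_⟩
  have hz1 : ‖z - γ t‖ ≤ 1 := hz.trans (min_le_right _ _)
  have hz2 : ‖z - γ t‖ < δ := (hz.trans (min_le_left _ _)).trans_lt (by linarith)
  have := hu (t, z - γ t) ⟨ht, by simpa using hz1⟩ (t, 0) ⟨ht, by simp⟩
    (by simpa [Prod.dist_eq, dist_eq_norm] using hz2)
  simpa [dist_eq_norm] using this.le

theorem IsC1Field.norm_jacobian_le (h : IsC1Field v Dv s T K) {γ : ℝ → F}
    {J : ℝ → F →L[ℝ] F} (hJ0 : J s = ContinuousLinearMap.id ℝ F)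
    (hJ : IsIntegralCurveOn J (fun t M => (Dv t (γ t)).comp M) (Icc s T)) {t : ℝ}
    (ht : t ∈ Icc s T) : ‖J t‖ ≤ Real.exp (K * (t - s)) := by
  have := norm_le_gronwallBound_of_norm_deriv_right_le (f := J) (δ := 1) (K := K) (ε := 0)
    hJ.continuousOn (fun t ht => hasDerivWithinAt_Ici_of_Icc (hJ t (Ico_subset_Icc_self ht)) ht)
    (by rw [hJ0]; exact ContinuousLinearMap.norm_id_le)
    (fun t ht => by
      rw [add_zero]
      exact (ContinuousLinearMap.opNorm_comp_le _ _).trans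
        (mul_le_mul_of_nonneg_right (h.norm_deriv_le t (Ico_subset_Icc_self ht) _)
          (norm_nonneg _))) t ht
  rwa [gronwallBound_ε0, one_mul] at this

/-- With zero initial value the bound is continuous in the forcing and vanishes at forcing `0`. This
turns a desired final error into an admissible modulus `η`. -/
theorem exists_pos_gronwallBound_le (K : ℝ) (L : ℝ) {c : ℝ} (hc : 0 < c) :
    ∃ η > 0, gronwallBound 0 K η L ≤ c := by
  have h := (gronwallBound_continuous_ε 0 K L).tendsto 0
  rw [gronwallBound_ε0_δ0] at h
  obtain ⟨η, h1, h2⟩ := ((h.eventually (gt_mem_nhds hc)).filter_mono nhdsWithin_le_nhds |>.and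
    (self_mem_nhdsWithin (a := (0 : ℝ)) (s := Ioi 0))).exists
  exact ⟨η, h2, h1.le⟩

theorem gronwallBound_zero_mul (K ε c x : ℝ) :
    gronwallBound 0 K (ε * c) x = gronwallBound 0 K ε x * c := by
  by_cases hK : K = 0
  · subst hK; simp [gronwallBound_K0]; ring
  · simp [gronwallBound_of_K_ne_0 hK]; ring

/-- The time-`T` map is differentiable in the initial point. -/
theorem IsC1Field.hasFDerivAt_flow [FiniteDimensional ℝ F]
    (h : IsC1Field v Dv s T K) (hsT : s ≤ T) {c : F → ℝ → F}
    (hc0 : ∀ x, c x s = x) (hc : ∀ x, IsIntegralCurveOn (c x) v (Icc s T)) (x : F)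
    {J : ℝ → F →L[ℝ] F} (hJ0 : J s = ContinuousLinearMap.id ℝ F)
    (hJ : IsIntegralCurveOn J (fun t M => (Dv t (c x t)).comp M) (Icc s T)) :
    HasFDerivAt (fun y => c y T) (J T) x := by
  have hmemT : T ∈ Icc s T := ⟨hsT, le_rfl⟩
  rw [hasFDerivAt_iff_isLittleO, Asymptotics.isLittleO_iff]
  intro ε hε
  set A : ℝ := Real.exp (K * (T - s)) with hA
  have hA0 : 0 < A := Real.exp_pos _
  obtain ⟨η, hη, hηle⟩ := exists_pos_gronwallBound_le K (T - s) (div_pos hε hA0)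
  obtain ⟨ρ, hρ, hnear⟩ := h.exists_uniform_near (hc x) hη
  have hev : ∀ᶠ y in 𝓝 x, ‖y - x‖ ≤ ρ / A := by
    filter_upwards [Metric.closedBall_mem_nhds x (div_pos hρ hA0)] with y hy
    simpa [dist_eq_norm] using hy
  filter_upwards [hev] with y hy
  have hdist : ∀ t ∈ Icc s T, ‖c y t - c x t‖ ≤ A * ‖y - x‖ := fun t ht => by
    have := IsIntegralCurveOn.dist_le (fun t ht => h.lipschitzWith ht) (hc y) (hc x) ht
    rw [hc0, hc0, dist_eq_norm, dist_eq_norm, mul_comm] at this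
    refine this.trans (mul_le_mul_of_nonneg_right ?_ (norm_nonneg _))
    exact Real.exp_le_exp.2 (mul_le_mul_of_nonneg_left (by linarith [ht.2]) K.coe_nonneg)
  have hdistρ : ∀ t ∈ Icc s T, ‖c y t - c x t‖ ≤ ρ := fun t ht => by
    refine (hdist t ht).trans ?_
    rw [le_div_iff₀ hA0] at hy
    linarith
  -- Grönwall for the first-order remainder: it starts at `0`, its linear part is driven by `Dv`
  -- along the reference curve, and the forcing is the Taylor error of `v t`, at most `η ‖c y t - c
  -- x t‖ ≤ η A ‖y - x‖`.
  have key := norm_le_gronwallBound_of_norm_deriv_right_le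
    (f := fun t => c y t - c x t - J t (y - x))
    (f' := fun t => v t (c y t) - v t (c x t) - ((Dv t (c x t)).comp (J t)) (y - x))
    (δ := 0) (K := K) (ε := η * (A * ‖y - x‖)) (a := s) (b := T) ?_ ?_ ?_ ?_ T hmemT
  · rw [gronwallBound_zero_mul] at key
    refine key.trans ?_
    calc gronwallBound 0 K η (T - s) * (A * ‖y - x‖) ≤ ε / A * (A * ‖y - x‖) := by gcongr
      _ = ε * ‖y - x‖ := by field_simp
  · exact ((hc y).continuousOn.sub (hc x).continuousOn).sub
      (hJ.continuousOn.clm_apply continuousOn_const)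
  · intro t ht
    have ht' := Ico_subset_Icc_self ht
    refine hasDerivWithinAt_Ici_of_Icc ?_ ht
    have hJt := (hJ t ht').clm_apply (hasDerivWithinAt_const t (Icc s T) (y - x))
    simp only [map_zero, add_zero] at hJt
    exact ((hc y t ht').sub (hc x t ht')).sub hJt
  · simp [hc0, hJ0]
  · intro t ht
    have ht' := Ico_subset_Icc_self ht
    have hmv := (convex_closedBall (c x t) ρ).norm_image_sub_le_of_norm_hasFDerivWithin_le'
      (f := v t) (f' := Dv t) (φ := Dv t (c x t)) (C := η) (x := c x t) (y := c y t)
      (fun z _ => (h.hasFDerivAt t ht' z).hasFDerivWithinAt)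
      (fun z hz => hnear t ht' z (by simpa [dist_eq_norm] using hz))
      (by simp [hρ.le]) (by simpa [dist_eq_norm] using hdistρ t ht')
    have hsplit : v t (c y t) - v t (c x t) - ((Dv t (c x t)).comp (J t)) (y - x)
        = (v t (c y t) - v t (c x t) - Dv t (c x t) (c y t - c x t))
          + Dv t (c x t) (c y t - c x t - J t (y - x)) := by
      simp only [ContinuousLinearMap.comp_apply, map_sub]; abel
    rw [hsplit]
    refine (norm_add_le _ _).trans ?_
    rw [add_comm]
    refine add_le_add ?_ (hmv.trans (mul_le_mul_of_nonneg_left (hdist t ht') hη.le))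
    exact (ContinuousLinearMap.le_opNorm _ _).trans
      (mul_le_mul_of_nonneg_right (h.norm_deriv_le t ht' _) (norm_nonneg _))

/-- The solution of the variational equation depends continuously on the initial point. -/
theorem IsC1Field.continuous_jacobian [FiniteDimensional ℝ F]
    (h : IsC1Field v Dv s T K) (hsT : s ≤ T) {c : F → ℝ → F}
    (hc0 : ∀ x, c x s = x) (hc : ∀ x, IsIntegralCurveOn (c x) v (Icc s T))
    {J : F → ℝ → F →L[ℝ] F} (hJ0 : ∀ x, J x s = ContinuousLinearMap.id ℝ F)
    (hJ : ∀ x, IsIntegralCurveOn (J x) (fun t M => (Dv t (c x t)).comp M) (Icc s T)) :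
    Continuous fun x => J x T := by
  have hmemT : T ∈ Icc s T := ⟨hsT, le_rfl⟩
  rw [continuous_iff_continuousAt]
  intro x
  rw [ContinuousAt, Metric.tendsto_nhds]
  intro ε hε
  set A : ℝ := Real.exp (K * (T - s)) with hA
  have hA0 : 0 < A := Real.exp_pos _
  obtain ⟨η, hη, hηle⟩ := exists_pos_gronwallBound_le K (T - s) (div_pos (half_pos hε) hA0)
  obtain ⟨ρ, hρ, hnear⟩ := h.exists_uniform_near (hc x) hη
  filter_upwards [Metric.closedBall_mem_nhds x (div_pos hρ hA0)] with y hy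
  have hy : ‖y - x‖ ≤ ρ / A := by simpa [dist_eq_norm] using hy
  have hexp : ∀ t ∈ Icc s T, Real.exp (K * (t - s)) ≤ A := fun t ht =>
    Real.exp_le_exp.2 (mul_le_mul_of_nonneg_left (by linarith [ht.2]) K.coe_nonneg)
  have hdistρ : ∀ t ∈ Icc s T, ‖c y t - c x t‖ ≤ ρ := fun t ht => by
    have := IsIntegralCurveOn.dist_le (fun t ht => h.lipschitzWith ht) (hc y) (hc x) ht
    rw [hc0, hc0, dist_eq_norm, dist_eq_norm, mul_comm] at this
    refine this.trans ((mul_le_mul (hexp t ht) hy (norm_nonneg _) hA0.le).trans ?_)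
    rw [mul_div_cancel₀ _ hA0.ne']
  have key := norm_le_gronwallBound_of_norm_deriv_right_le
    (f := fun t => J y t - J x t)
    (f' := fun t => (Dv t (c y t)).comp (J y t) - (Dv t (c x t)).comp (J x t))
    (δ := 0) (K := K) (ε := η * A) (a := s) (b := T)
    ((hJ y).continuousOn.sub (hJ x).continuousOn) ?_ (by simp [hJ0]) ?_ T hmemT
  · rw [gronwallBound_zero_mul] at key
    rw [dist_eq_norm]
    refine key.trans_lt ?_
    calc gronwallBound 0 K η (T - s) * A ≤ ε / 2 / A * A := by gcongr
      _ = ε / 2 := by field_simp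
      _ < ε := by linarith
  · intro t ht
    have ht' := Ico_subset_Icc_self ht
    exact hasDerivWithinAt_Ici_of_Icc ((hJ y t ht').sub (hJ x t ht')) ht
  · intro t ht
    have ht' := Ico_subset_Icc_self ht
    have hsplit : (Dv t (c y t)).comp (J y t) - (Dv t (c x t)).comp (J x t)
        = (Dv t (c y t)).comp (J y t - J x t) + (Dv t (c y t) - Dv t (c x t)).comp (J x t) := by
      rw [ContinuousLinearMap.comp_sub, ContinuousLinearMap.sub_comp]; abel
    rw [hsplit]
    refine (norm_add_le _ _).trans (add_le_add ?_ ?_)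
    · exact (ContinuousLinearMap.opNorm_comp_le _ _).trans
        (mul_le_mul_of_nonneg_right (h.norm_deriv_le t ht' _) (norm_nonneg _))
    · exact (ContinuousLinearMap.opNorm_comp_le _ _).trans
        (mul_le_mul (hnear t ht' _ (hdistρ t ht'))
          ((h.norm_jacobian_le (hJ0 x) (hJ x) ht').trans (hexp t ht')) (norm_nonneg _) hη.le)

theorem IsC1Field.contDiff_flow [FiniteDimensional ℝ F]
    (h : IsC1Field v Dv s T K) (hsT : s ≤ T) {c : F → ℝ → F}
    (hc0 : ∀ x, c x s = x) (hc : ∀ x, IsIntegralCurveOn (c x) v (Icc s T)) :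
    ContDiff ℝ 1 fun x => c x T := by
  choose J hJ0 hJ using fun x => h.exists_jacobian hsT (hc x)
  exact contDiff_one_iff_hasFDerivAt.2 ⟨fun x => J x T, h.continuous_jacobian hsT hc0 hc hJ0 hJ,
    fun x => h.hasFDerivAt_flow hsT hc0 hc x (hJ0 x) (hJ x)⟩

theorem IsC1Field.lipschitzWith_flow (h : IsC1Field v Dv s T K) (hsT : s ≤ T) {c : F → ℝ → F}
    (hc0 : ∀ x, c x s = x) (hc : ∀ x, IsIntegralCurveOn (c x) v (Icc s T)) :
    ∃ L : ℝ≥0, LipschitzWith L fun x => c x T := by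
  refine ⟨⟨Real.exp (K * (T - s)), (Real.exp_pos _).le⟩, LipschitzWith.of_dist_le_mul fun x y => ?_⟩
  have := IsIntegralCurveOn.dist_le (fun t ht => h.lipschitzWith ht) (hc x) (hc y)
    (t := T) ⟨hsT, le_rfl⟩
  rw [hc0, hc0, mul_comm] at this
  exact this

/-- The flow of a `C¹` field with bounded derivative, from time `s` to time `T`. -/
theorem IsC1Field.exists_flow [FiniteDimensional ℝ F]
    (h : IsC1Field v Dv s T K) (hsT : s ≤ T) :
    ∃ φ : F ≃ F,
      (∀ x, (∃ γ : ℝ → F, γ s = x ∧ IsIntegralCurveOn γ v (Icc s T)) ∧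
        ∀ γ : ℝ → F, γ s = x → IsIntegralCurveOn γ v (Icc s T) → γ T = φ x) ∧
      ContDiff ℝ 1 φ ∧ ContDiff ℝ 1 φ.symm ∧ (∃ L : ℝ≥0, LipschitzWith L φ) ∧
      (∃ L : ℝ≥0, LipschitzWith L φ.symm) ∧
      ∀ x, ∃ (γ : ℝ → F) (J : ℝ → F →L[ℝ] F), γ s = x ∧ γ T = φ x ∧
        IsIntegralCurveOn γ v (Icc s T) ∧ J s = ContinuousLinearMap.id ℝ F ∧
        IsIntegralCurveOn J (fun t M => (Dv t (γ t)).comp M) (Icc s T) ∧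
        HasFDerivAt φ (J T) x := by
  have hmemT : T ∈ Icc s T := ⟨hsT, le_rfl⟩
  have uniq : ∀ {w : ℝ → F → F} {Dw}, IsC1Field w Dw s T K → ∀ {γ γ' : ℝ → F},
      IsIntegralCurveOn γ w (Icc s T) → IsIntegralCurveOn γ' w (Icc s T) → γ s = γ' s →
      γ T = γ' T := by
    intro w Dw hw γ γ' h1 h2 h0
    have := IsIntegralCurveOn.dist_le (fun t ht => hw.lipschitzWith ht) h1 h2 hmemT
    rw [h0, dist_self, zero_mul] at this
    exact dist_le_zero.1 this
  choose c hc0 hc using fun x => h.exists_curve hsT x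
  choose d hd0 hd using fun x => h.reverse.exists_curve hsT x
  -- The inverse is the flow of the time-reversed field; both inverse laws are uniqueness for a
  -- curve and its reversal.
  let φ : F ≃ F :=
    { toFun := fun x => c x T
      invFun := fun x => d x T
      left_inv := fun x => by
        have h1 := IsIntegralCurveOn.reverse (hc x)
        have := uniq h.reverse (hd (c x T)) h1 (by simp [hd0])
        simpa [hc0] using this
      right_inv := fun x => by
        have h1 := IsIntegralCurveOn.reverse (hd x)
        simp only [neg_neg] at h1
        have h2 : IsIntegralCurveOn (fun t => d x (s + T - t)) v (Icc s T) := by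
          intro t ht
          simpa using h1 t ht
        have := uniq h (hc (d x T)) h2 (by simp [hc0])
        simpa [hd0] using this }
  refine ⟨φ, fun x => ⟨⟨c x, hc0 x, hc x⟩, fun γ h0 hγ => ?_⟩, h.contDiff_flow hsT hc0 hc,
    h.reverse.contDiff_flow hsT hd0 hd, h.lipschitzWith_flow hsT hc0 hc,
    h.reverse.lipschitzWith_flow hsT hd0 hd, fun x => ?_⟩
  · exact uniq h hγ (hc x) (h0.trans (hc0 x).symm)
  · obtain ⟨J, hJ0, hJ⟩ := h.exists_jacobian hsT (hc x)
    exact ⟨c x, J, hc0 x, rfl, hc x, hJ0, hJ, h.hasFDerivAt_flow hsT hc0 hc x hJ0 hJ⟩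

end Flow

end ODEFlow

/-! ### Liouville's formula and transport of densities -/

namespace ODEFlow

open Metric Function Filter Topology

section Liouville

variable {F : Type*} [NormedAddCommGroup F] [NormedSpace ℝ F] [FiniteDimensional ℝ F]

/-- In a basis the determinant is the Leibniz polynomial in the matrix entries, which depend
linearly on the operator. -/
theorem differentiable_clm_det : Differentiable ℝ fun L : F →L[ℝ] F => L.det := by
  have hdet : (fun L : F →L[ℝ] F => L.det) = fun L =>
      ∑ σ : Equiv.Perm (Fin (Module.finrank ℝ F)), (Equiv.Perm.sign σ : ℤ) •
        ∏ i, (Module.finBasis ℝ F).equivFunL (L (Module.finBasis ℝ F i)) (σ i) := by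
    funext L
    rw [ContinuousLinearMap.det, ← LinearMap.det_toMatrix (Module.finBasis ℝ F), Matrix.det_apply]
    refine Finset.sum_congr rfl fun σ _ => ?_
    simp only [LinearMap.toMatrix_apply]
    rfl
  rw [hdet]
  have hcoord : ∀ i j, Differentiable ℝ fun L : F →L[ℝ] F =>
      (Module.finBasis ℝ F).equivFunL (L (Module.finBasis ℝ F i)) j := by
    intro i j
    have h1 : Differentiable ℝ fun L : F →L[ℝ] F =>
        (Module.finBasis ℝ F).equivFunL (L (Module.finBasis ℝ F i)) :=
      (Module.finBasis ℝ F).equivFunL.differentiable.comp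
        (ContinuousLinearMap.apply ℝ F (Module.finBasis ℝ F i)).differentiable
    exact differentiable_pi.1 h1 j
  refine Differentiable.fun_sum fun σ _ => ?_
  simp only [zsmul_eq_mul]
  refine Differentiable.const_mul ?_ _
  have := fun L =>
      (HasFDerivAt.finsetProd (u := Finset.univ) fun i _ => (hcoord i (σ i) L).hasFDerivAt).differentiableAt
  exact this

/-- `det (1 + h M)` is a polynomial in `h` with constant term `1` and linear coefficient `tr M`; the
rest carries a factor `h ^ 2`. -/
theorem hasDerivAt_det_id_add_smul (A : F →L[ℝ] F) :
    HasDerivAt (fun h : ℝ => (ContinuousLinearMap.id ℝ F + h • A).det)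
      (LinearMap.trace ℝ F A) 0 := by
  set b := Module.finBasis ℝ F
  set M := LinearMap.toMatrix b b (A : F →ₗ[ℝ] F)
  have hdet : (fun h : ℝ => (ContinuousLinearMap.id ℝ F + h • A).det) = fun h : ℝ =>
      1 + M.trace * h
        + (Matrix.det (1 + (Polynomial.X : Polynomial ℝ) • M.map Polynomial.C)).divX.divX.eval h
          * h ^ 2 := by
    funext h
    rw [← Matrix.det_one_add_smul, ContinuousLinearMap.det, ← LinearMap.det_toMatrix b]
    congr 1
    simp [M]
  rw [hdet, LinearMap.trace_eq_matrix_trace ℝ b]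
  have h1 := ((hasDerivAt_id (0 : ℝ)).const_mul M.trace).const_add 1
  have h2 := (Polynomial.hasDerivAt
    (Matrix.det (1 + (Polynomial.X : Polynomial ℝ) • M.map Polynomial.C)).divX.divX (0 : ℝ)).mul
    (hasDerivAt_pow 2 (0 : ℝ))
  convert! h1.add h2 using 1
  simp [M]

/-- The factorisation `M + h A M = (1 + h A) M` moves the computation to the identity, so `M` need
not be invertible. -/
theorem fderiv_clm_det_comp (A M : F →L[ℝ] F) :
    fderiv ℝ (fun L : F →L[ℝ] F => L.det) M (A.comp M) = LinearMap.trace ℝ F A * M.det := by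
  have h1 : HasDerivAt (fun h : ℝ => M + h • A.comp M) (A.comp M) 0 := by
    simpa using ((hasDerivAt_id (0 : ℝ)).smul_const (A.comp M)).const_add M
  have h2 : HasDerivAt (fun h : ℝ => (M + h • A.comp M).det)
      (fderiv ℝ (fun L : F →L[ℝ] F => L.det) M (A.comp M)) 0 := by
    have := (differentiable_clm_det (F := F) (M + (0 : ℝ) • A.comp M)).hasFDerivAt.comp_hasDerivAt
      (0 : ℝ) h1
    simpa [Function.comp_def] using this
  have h3 : (fun h : ℝ => (M + h • A.comp M).det)
      = fun h : ℝ => (ContinuousLinearMap.id ℝ F + h • A).det * M.det := by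
    funext h
    have : M + h • A.comp M = (ContinuousLinearMap.id ℝ F + h • A).comp M := by
      ext; simp
    rw [this]
    simp only [ContinuousLinearMap.det, ContinuousLinearMap.toLinearMap_comp, LinearMap.det_comp]
  rw [h3] at h2
  exact h2.unique ((hasDerivAt_det_id_add_smul A).mul_const _)

/-- **Liouville's formula**. -/
theorem hasDerivWithinAt_clm_det {J : ℝ → F →L[ℝ] F} {A : F →L[ℝ] F} {S : Set ℝ} {t : ℝ}
    (h : HasDerivWithinAt J (A.comp (J t)) S t) :
    HasDerivWithinAt (fun r => (J r).det) (LinearMap.trace ℝ F A * (J t).det) S t := by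
  have := (differentiable_clm_det (F := F) (J t)).hasFDerivAt.comp_hasDerivWithinAt t h
  rwa [fderiv_clm_det_comp] at this

/-- A density satisfying the continuity equation along a curve is transported by the Jacobian
determinant of the flow. -/
theorem mul_det_eq_of_hasDerivAt_along {Dv : ℝ → F → F →L[ℝ] F} {s T : ℝ} (hsT : s < T)
    {q : ℝ → F → ℝ} {γ : ℝ → F} {J : ℝ → F →L[ℝ] F}
    (hJ0 : J s = ContinuousLinearMap.id ℝ F)
    (hJ : IsIntegralCurveOn J (fun t M => (Dv t (γ t)).comp M) (Icc s T))
    (hq : ContinuousOn (fun t => q t (γ t)) (Icc s T))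
    (hq' : ∀ t ∈ Ioo s T, HasDerivAt (fun t => q t (γ t))
      (-(q t (γ t) * LinearMap.trace ℝ F (Dv t (γ t)))) t) :
    q T (γ T) * (J T).det = q s (γ s) := by
  have hcont : ContinuousOn (fun t => q t (γ t) * (J t).det) (Icc s T) :=
    hq.mul (differentiable_clm_det.continuous.comp_continuousOn hJ.continuousOn)
  have hd : ∀ t ∈ Ioo s T, HasDerivAt (fun t => q t (γ t) * (J t).det) 0 t := fun t ht => by
    have h1 := (hasDerivWithinAt_clm_det (hJ t (Ioo_subset_Icc_self ht))).hasDerivAt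
      (Icc_mem_nhds ht.1 ht.2)
    convert! (hq' t ht).mul h1 using 1
    ring
  -- The trace terms cancel, so the product is constant by the mean value theorem. The continuity
  -- equation is needed only at interior times; this permits `s = 0`, where no time derivative of
  -- the density is available.
  obtain ⟨c, -, hc⟩ := exists_hasDerivAt_eq_slope (fun t => q t (γ t) * (J t).det) (fun _ => 0)
    hsT hcont hd
  have hdet1 : (J s).det = 1 := by rw [hJ0]; exact LinearMap.det_id
  rw [eq_comm, div_eq_zero_iff] at hc
  rcases hc with hc | hc
  · rw [hdet1, mul_one] at hc
    linarith
  · linarith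

end Liouville

/-! ### Push-forward of densities by a differentiable bijection. -/

section ChangeOfVariables

variable {F : Type*} [NormedAddCommGroup F] [NormedSpace ℝ F] [FiniteDimensional ℝ F]
  [MeasurableSpace F] [BorelSpace F] (μ : Measure F) [μ.IsAddHaarMeasure]

theorem lintegral_eq_lintegral_det_mul_comp {φ : F ≃ F} {φ' : F → F →L[ℝ] F}
    (hφ : ∀ x, HasFDerivAt φ (φ' x) x) (g : F → ℝ≥0∞) :
    ∫⁻ x, g x ∂μ = ∫⁻ x, ENNReal.ofReal |(φ' x).det| * g (φ x) ∂μ := by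
  have := lintegral_image_eq_lintegral_abs_det_fderiv_mul μ MeasurableSet.univ
    (fun x _ => (hφ x).hasFDerivWithinAt) φ.injective.injOn g
  simpa [image_univ, φ.surjective.range_eq] using this

/-- If `g (φ x) |det φ' x| = f x` then `φ` pushes the density `f` to the density `g`. -/
theorem map_withDensity_eq_of_mul_det {φ : F ≃ F} {φ' : F → F →L[ℝ] F}
    (hφ : ∀ x, HasFDerivAt φ (φ' x) x) {f g : F → ℝ≥0∞}
    (hfg : ∀ x, ENNReal.ofReal |(φ' x).det| * g (φ x) = f x) :
    (μ.withDensity f).map φ = μ.withDensity g := by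
  have hmeas : Measurable φ :=
    (continuous_iff_continuousAt.2 fun x => (hφ x).continuousAt).measurable
  ext A hA
  rw [Measure.map_apply hmeas hA, withDensity_apply _ (hmeas hA), withDensity_apply _ hA,
    ← lintegral_indicator hA, lintegral_eq_lintegral_det_mul_comp μ hφ,
    ← lintegral_indicator (hmeas hA)]
  refine lintegral_congr fun x => ?_
  by_cases hx : φ x ∈ A
  · rw [indicator_of_mem hx, indicator_of_mem (show x ∈ φ ⁻¹' A from hx), hfg]
  · rw [indicator_of_notMem hx, indicator_of_notMem (show x ∉ φ ⁻¹' A from hx), mul_zero]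

end ChangeOfVariables

end ODEFlow

/-! ### Smoothness of Laplace transforms of exponential families -/

namespace ExpFamily

open Metric Function Filter Topology

variable {Y Θ G : Type} [MeasurableSpace Y] [NormedAddCommGroup Θ] [NormedSpace ℝ Θ]
  [NormedAddCommGroup G] [NormedSpace ℝ G]

/-- `∫ exp (T y θ) f y dμ(y)`, the (weighted) Laplace transform of the exponential family with
statistic `T`. -/
noncomputable def laplace (μ : Measure Y) (T : Y → Θ →L[ℝ] ℝ) (f : Y → G) (θ : Θ) : G :=
  ∫ y, Real.exp (T y θ) • f y ∂μ

/-- Parameters at which the exponential family has a small exponential moment to spare. -/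
def laplaceDomain (μ : Measure Y) (T : Y → Θ →L[ℝ] ℝ) : Set Θ :=
  {θ | ∃ r > 0, Integrable (fun y => Real.exp (T y θ + r * ‖T y‖)) μ}

variable {μ : Measure Y} {T : Y → Θ →L[ℝ] ℝ}

theorem apply_le_of_norm_sub_le {θ θ' : Θ} {r : ℝ} (h : ‖θ' - θ‖ ≤ r) (L : Θ →L[ℝ] ℝ) :
    L θ' ≤ L θ + r * ‖L‖ := by
  have h1 : L θ' - L θ ≤ ‖L‖ * ‖θ' - θ‖ := by
    rw [← map_sub]
    exact (le_abs_self _).trans (L.le_opNorm _)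
  have h2 := mul_le_mul_of_nonneg_left h (norm_nonneg L)
  linarith

theorem aestronglyMeasurable_exp (hT : AEStronglyMeasurable T μ) (θ : Θ) (r : ℝ) :
    AEStronglyMeasurable (fun y => Real.exp (T y θ + r * ‖T y‖)) μ :=
  Real.continuous_exp.comp_aestronglyMeasurable
    (((ContinuousLinearMap.apply ℝ ℝ θ).continuous.comp_aestronglyMeasurable hT).add
      (hT.norm.const_mul r))

/-- Half of the spare exponential moment pays for moving the parameter, the other half remains as
the new reserve. -/
theorem isOpen_laplaceDomain (hT : AEStronglyMeasurable T μ) : IsOpen (laplaceDomain μ T) := by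
  rw [Metric.isOpen_iff]
  rintro θ ⟨r, hr, hint⟩
  refine ⟨r / 2, half_pos hr, fun θ' hθ' => ⟨r / 2, half_pos hr, ?_⟩⟩
  refine hint.mono' (aestronglyMeasurable_exp hT _ _) (Eventually.of_forall fun y => ?_)
  rw [Real.norm_of_nonneg (Real.exp_pos _).le, Real.exp_le_exp]
  have := apply_le_of_norm_sub_le (θ := θ) (θ' := θ') (r := r / 2)
    (by rw [← dist_eq_norm]; exact (mem_ball.1 hθ').le) (T y)
  linarith

theorem exists_one_add_pow_le_exp (m : ℕ) {r : ℝ} (hr : 0 < r) :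
    ∃ C, 0 ≤ C ∧ ∀ u : ℝ, 0 ≤ u → (1 + u) ^ m ≤ C * Real.exp (r * u) := by
  refine ⟨m.factorial / r ^ m * Real.exp r, by positivity, fun u hu => ?_⟩
  have h := Real.pow_div_factorial_le_exp (r * (1 + u)) (by positivity) m
  rw [div_le_iff₀ (by positivity), mul_pow, mul_add, mul_one, Real.exp_add] at h
  calc (1 + u) ^ m = (r ^ m * (1 + u) ^ m) / r ^ m := by field_simp
    _ ≤ (Real.exp r * Real.exp (r * u) * m.factorial) / r ^ m := by gcongr
    _ = _ := by ring

/-- Functions of at most polynomial growth in the statistic. -/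
structure HasPolyGrowth (μ : Measure Y) (T : Y → Θ →L[ℝ] ℝ) (f : Y → G) : Prop where
  aestronglyMeasurable : AEStronglyMeasurable f μ
  bound : ∃ (C : ℝ) (m : ℕ), ∀ y, ‖f y‖ ≤ C * (1 + ‖T y‖) ^ m

/-- Differentiating the Laplace transform multiplies the weight by `T y`; polynomial growth is
stable under this, which lets smoothness be proved by induction. -/
theorem HasPolyGrowth.smulRight {f : Y → G} (hf : HasPolyGrowth μ T f)
    (hT : AEStronglyMeasurable T μ) : HasPolyGrowth μ T fun y => (T y).smulRight (f y) := by
  obtain ⟨C, m, hC⟩ := hf.bound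
  refine ⟨(ContinuousLinearMap.smulRightL ℝ Θ G).aestronglyMeasurable_comp₂ hT
    hf.aestronglyMeasurable, C, m + 1, fun y => ?_⟩
  rw [ContinuousLinearMap.norm_smulRight_apply, pow_succ, ← mul_assoc, mul_comm]
  exact mul_le_mul (hC y) (by linarith [norm_nonneg (T y)]) (norm_nonneg _)
    ((norm_nonneg _).trans (hC y))

/-- The reserve `r` is split in two: `r / 2` absorbs the displacement of the parameter, `r / 2`
absorbs the polynomial weight. -/
theorem HasPolyGrowth.exists_dominated {f : Y → G} (hf : HasPolyGrowth μ T f) {θ : Θ}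
    (hθ : θ ∈ laplaceDomain μ T) :
    ∃ (r : ℝ) (B : Y → ℝ), 0 < r ∧ Integrable B μ ∧
      ∀ y, ∀ θ' ∈ ball θ r, ‖Real.exp (T y θ') • f y‖ ≤ B y := by
  obtain ⟨r, hr, hint⟩ := hθ
  obtain ⟨C, m, hC⟩ := hf.bound
  obtain ⟨D, hD, hDle⟩ := exists_one_add_pow_le_exp m (half_pos hr)
  refine ⟨r / 2, fun y => |C| * D * Real.exp (T y θ + r * ‖T y‖), half_pos hr,
    hint.const_mul _, fun y θ' hθ' => ?_⟩
  have h1 := apply_le_of_norm_sub_le (θ := θ) (θ' := θ') (r := r / 2)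
    (by rw [← dist_eq_norm]; exact (mem_ball.1 hθ').le) (T y)
  rw [norm_smul, Real.norm_of_nonneg (Real.exp_pos _).le]
  calc Real.exp (T y θ') * ‖f y‖
      ≤ Real.exp (T y θ + r / 2 * ‖T y‖) * (|C| * (D * Real.exp (r / 2 * ‖T y‖))) := by
        refine mul_le_mul (Real.exp_le_exp.2 h1) ?_ (norm_nonneg _) (Real.exp_pos _).le
        refine (hC y).trans (mul_le_mul (le_abs_self C) (hDle _ (norm_nonneg _)) (by positivity)
          (abs_nonneg _))
    _ = |C| * D * (Real.exp (T y θ + r / 2 * ‖T y‖) * Real.exp (r / 2 * ‖T y‖)) := by ring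
    _ = _ := by rw [← Real.exp_add]; ring_nf

theorem HasPolyGrowth.aestronglyMeasurable_smul {f : Y → G} (hf : HasPolyGrowth μ T f)
    (hT : AEStronglyMeasurable T μ) (θ : Θ) :
    AEStronglyMeasurable (fun y => Real.exp (T y θ) • f y) μ := by
  have := (aestronglyMeasurable_exp hT θ 0).smul hf.aestronglyMeasurable
  simp only [zero_mul, add_zero] at this
  exact this

theorem HasPolyGrowth.integrable {f : Y → G} (hf : HasPolyGrowth μ T f)
    (hT : AEStronglyMeasurable T μ) {θ : Θ} (hθ : θ ∈ laplaceDomain μ T) :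
    Integrable (fun y => Real.exp (T y θ) • f y) μ := by
  obtain ⟨r, B, hr, hB, hle⟩ := hf.exists_dominated hθ
  exact hB.mono' (hf.aestronglyMeasurable_smul hT θ)
    (Eventually.of_forall fun y => hle y θ (mem_ball_self hr))

theorem HasPolyGrowth.hasFDerivAt_laplace {f : Y → G} (hf : HasPolyGrowth μ T f)
    (hT : AEStronglyMeasurable T μ) {θ : Θ} (hθ : θ ∈ laplaceDomain μ T) :
    HasFDerivAt (laplace μ T f) (laplace μ T (fun y => (T y).smulRight (f y)) θ) θ := by
  have hf' := hf.smulRight hT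
  obtain ⟨r, B, hr, hB, hle⟩ := hf'.exists_dominated hθ
  refine hasFDerivAt_integral_of_dominated_of_fderiv_le (s := ball θ r) (bound := B)
    (ball_mem_nhds θ hr)
    (Eventually.of_forall fun θ' => hf.aestronglyMeasurable_smul hT θ') (hf.integrable hT hθ)
    (hf'.aestronglyMeasurable_smul hT θ) (Eventually.of_forall hle) hB
    (Eventually.of_forall fun y θ' _ => ?_)
  have h := ((T y).hasFDerivAt (x := θ')).exp.smul_const (f y)
  convert! h using 1
  ext u
  simp [smul_smul]

/-- The derivative is again a Laplace transform, with weight valued in `Θ →L[ℝ] G`; hence the target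
space is quantified inside the induction. -/
theorem HasPolyGrowth.contDiffOn_laplace_nat (hT : AEStronglyMeasurable T μ) (k : ℕ) :
    ∀ {G : Type} [NormedAddCommGroup G] [NormedSpace ℝ G] {f : Y → G}, HasPolyGrowth μ T f →
      ContDiffOn ℝ k (laplace μ T f) (laplaceDomain μ T) := by
  induction k with
  | zero =>
    intro G _ _ f hf
    exact contDiffOn_zero.2 fun θ hθ =>
      (hf.hasFDerivAt_laplace hT hθ).continuousAt.continuousWithinAt
  | succ k ih =>
    intro G _ _ f hf
    push_cast
    rw [contDiffOn_succ_iff_fderiv_of_isOpen (isOpen_laplaceDomain hT)]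
    refine ⟨fun θ hθ =>
      (hf.hasFDerivAt_laplace hT hθ).differentiableAt.differentiableWithinAt, by simp, ?_⟩
    exact (ih (hf.smulRight hT)).congr fun θ hθ => (hf.hasFDerivAt_laplace hT hθ).fderiv

end ExpFamily

/-! ### The Gaussian exponential family in an orthonormal basis -/

namespace VPFlow

open Metric Function Filter Topology ExpFamily InnerProductSpace

variable {n : ℕ}

local notation "⟪" x ", " y "⟫" => inner ℝ x y

/-- The parameter space of the family `exp (⟪y, ξ⟫ - ∑ i, s i * ⟪b i, y⟫ ^ 2)`. -/
abbrev Param (n : ℕ) := E n × (Fin n → ℝ)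

variable (b : OrthonormalBasis (Fin n) ℝ (E n))

/-- The statistic `(ξ, s) ↦ ⟪y, ξ⟫ - ∑ i, s i * ⟪b i, y⟫ ^ 2`. -/
noncomputable def quadStat (y : E n) : Param n →L[ℝ] ℝ :=
  (innerSL ℝ y).comp (ContinuousLinearMap.fst ℝ (E n) (Fin n → ℝ)) -
    ∑ i, ⟪b i, y⟫ ^ 2 • (ContinuousLinearMap.proj (R := ℝ) (φ := fun _ : Fin n => ℝ) i).comp
      (ContinuousLinearMap.snd ℝ (E n) (Fin n → ℝ))

theorem quadStat_apply (y : E n) (θ : Param n) :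
    quadStat b y θ = ⟪y, θ.1⟫ - ∑ i, θ.2 i * ⟪b i, y⟫ ^ 2 := by
  simp [quadStat, mul_comm]

theorem continuous_quadStat : Continuous (quadStat b) := by
  unfold quadStat
  refine Continuous.sub ?_ ?_
  · exact ((innerSL ℝ).continuous).clm_comp continuous_const
  · refine continuous_finsetSum _ fun i _ => ?_
    have hc : Continuous fun y : E n => ⟪b i, y⟫ ^ 2 := by fun_prop
    exact hc.smul continuous_const

/-- Evaluate the statistic at `(y, 0)`. Growth polynomial in `y` thereby becomes growth polynomial
in the statistic. -/
theorem norm_le_norm_quadStat (y : E n) : ‖y‖ ≤ ‖quadStat b y‖ := by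
  rcases eq_or_ne y 0 with rfl | hy
  · simp
  have h := (quadStat b y).le_opNorm (y, 0)
  rw [quadStat_apply] at h
  simp only [real_inner_self_eq_norm_sq, Pi.zero_apply, zero_mul, Finset.sum_const_zero, sub_zero,
    norm_pow, norm_norm, Prod.norm_mk, norm_zero, norm_nonneg, sup_of_le_left] at h
  rw [sq] at h
  exact le_of_mul_le_mul_right h (norm_pos_iff.2 hy)

theorem sum_inner_sq_eq (y : E n) : ∑ i, ⟪b i, y⟫ ^ 2 = ‖y‖ ^ 2 := by
  simpa using b.sum_sq_norm_inner_right y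

theorem norm_quadStat_le (y : E n) : ‖quadStat b y‖ ≤ ‖y‖ + ‖y‖ ^ 2 := by
  refine ContinuousLinearMap.opNorm_le_bound _ (by positivity) fun θ => ?_
  rw [quadStat_apply, Real.norm_eq_abs]
  have h1 : |⟪y, θ.1⟫| ≤ ‖y‖ * ‖θ‖ :=
    (abs_real_inner_le_norm _ _).trans
      (mul_le_mul_of_nonneg_left (norm_fst_le θ) (norm_nonneg _))
  have h2 : |∑ i, θ.2 i * ⟪b i, y⟫ ^ 2| ≤ ‖y‖ ^ 2 * ‖θ‖ := by
    refine (Finset.abs_sum_le_sum_abs _ _).trans ?_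
    rw [← sum_inner_sq_eq b y, Finset.sum_mul]
    refine Finset.sum_le_sum fun i _ => ?_
    rw [abs_mul, abs_of_nonneg (sq_nonneg ⟪b i, y⟫), mul_comm]
    refine mul_le_mul_of_nonneg_left ?_ (sq_nonneg _)
    exact (norm_le_pi_norm θ.2 i).trans (norm_snd_le θ)
  calc _ ≤ _ := abs_sub _ _
    _ ≤ _ := add_le_add h1 h2
    _ = _ := by ring

theorem exists_pos_le_of_forall_pos {ι : Type*} [Finite ι] {s : ι → ℝ} (hs : ∀ i, 0 < s i) :
    ∃ c > 0, ∀ i, c ≤ s i := by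
  rcases isEmpty_or_nonempty ι with h | h
  · exact ⟨1, one_pos, fun i => h.elim i⟩
  · obtain ⟨i, hi⟩ := Finite.exists_min s
    exact ⟨s i, hs i, hi⟩

/-- With `c` a lower bound for the quadratic weights and reserve `c / 2`, the exponent is at most
`-(c / 2) ‖y‖² + (‖ξ‖ + c / 2) ‖y‖`, where `ξ = θ.1`. It is bounded above by completing the square,
so no moment assumption on `μ` is needed. -/
theorem mem_laplaceDomain_quadStat {μ : Measure (E n)} [IsFiniteMeasure μ] {θ : Param n}
    (hθ : ∀ i, 0 < θ.2 i) : θ ∈ laplaceDomain μ (quadStat b) := by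
  obtain ⟨c, hc, hcle⟩ := exists_pos_le_of_forall_pos hθ
  refine ⟨c / 2, half_pos hc, ?_⟩
  refine (integrable_const (Real.exp ((‖θ.1‖ + c / 2) ^ 2 / (2 * c)))).mono'
    (aestronglyMeasurable_exp (continuous_quadStat b).aestronglyMeasurable _ _)
    (Eventually.of_forall fun y => ?_)
  rw [Real.norm_of_nonneg (Real.exp_pos _).le, Real.exp_le_exp, quadStat_apply]
  have h1 : ⟪y, θ.1⟫ ≤ ‖y‖ * ‖θ.1‖ := real_inner_le_norm _ _
  have h2 : c * ‖y‖ ^ 2 ≤ ∑ i, θ.2 i * ⟪b i, y⟫ ^ 2 := by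
    rw [← sum_inner_sq_eq b y, Finset.mul_sum]
    exact Finset.sum_le_sum fun i _ => mul_le_mul_of_nonneg_right (hcle i) (sq_nonneg _)
  have h3 := mul_le_mul_of_nonneg_left (norm_quadStat_le b y) (half_pos hc).le
  rw [le_div_iff₀ (by positivity)]
  nlinarith [sq_nonneg (c * ‖y‖ - (‖θ.1‖ + c / 2))]

variable (μ : Measure (E n))

theorem hasPolyGrowth_const : HasPolyGrowth μ (quadStat b) fun _ => (1 : ℝ) :=
  ⟨aestronglyMeasurable_const, 1, 0, by simp⟩

theorem hasPolyGrowth_sub_const (w : E n) : HasPolyGrowth μ (quadStat b) fun y => y - w := by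
  refine ⟨by fun_prop, 1 + ‖w‖, 1, fun y => ?_⟩
  have := norm_le_norm_quadStat b y
  calc ‖y - w‖ ≤ ‖y‖ + ‖w‖ := norm_sub_le _ _
    _ ≤ _ := by nlinarith [norm_nonneg w, norm_nonneg (quadStat b y)]

theorem hasPolyGrowth_id : HasPolyGrowth μ (quadStat b) fun y => y := by
  simpa using hasPolyGrowth_sub_const b μ 0

theorem hasPolyGrowth_norm_sub_sq (w : E n) :
    HasPolyGrowth μ (quadStat b) fun y => ‖y - w‖ ^ 2 := by
  refine ⟨by fun_prop, (1 + ‖w‖) ^ 2, 2, fun y => ?_⟩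
  have := norm_le_norm_quadStat b y
  rw [norm_pow, norm_norm, ← mul_pow]
  refine pow_le_pow_left₀ (norm_nonneg _) ?_ 2
  calc ‖y - w‖ ≤ ‖y‖ + ‖w‖ := norm_sub_le _ _
    _ ≤ _ := by nlinarith [norm_nonneg w, norm_nonneg (quadStat b y)]

/-- The partition function of the exponential family. -/
noncomputable def partitionFn (θ : Param n) : ℝ := laplace μ (quadStat b) (fun _ => (1 : ℝ)) θ

/-- The mean of the exponential family (the posterior mean). -/
noncomputable def famMean (θ : Param n) : E n :=
  (partitionFn b μ θ)⁻¹ • laplace μ (quadStat b) (fun y => y) θ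

/-- The unnormalised second moment about `w`. -/
noncomputable def famSq (w : E n) (θ : Param n) : ℝ :=
  laplace μ (quadStat b) (fun y => ‖y - w‖ ^ 2) θ

variable {μ} {θ : Param n}

theorem aestronglyMeasurable_quadStat : AEStronglyMeasurable (quadStat b) μ :=
  (continuous_quadStat b).aestronglyMeasurable

section

variable [IsFiniteMeasure μ]

theorem integrable_exp_quadStat (hθ : ∀ i, 0 < θ.2 i) :
    Integrable (fun y => Real.exp (quadStat b y θ)) μ := by
  simpa using (hasPolyGrowth_const b μ).integrable (aestronglyMeasurable_quadStat b)
    (mem_laplaceDomain_quadStat b hθ)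

theorem partitionFn_pos [NeZero μ] (hθ : ∀ i, 0 < θ.2 i) : 0 < partitionFn b μ θ := by
  have := integral_exp_pos (integrable_exp_quadStat b (μ := μ) hθ)
  simpa [partitionFn, laplace] using this

theorem hasFDerivAt_partitionFn (hθ : ∀ i, 0 < θ.2 i) :
    HasFDerivAt (partitionFn b μ)
      (laplace μ (quadStat b) (fun y => (quadStat b y).smulRight (1 : ℝ)) θ) θ :=
  (hasPolyGrowth_const b μ).hasFDerivAt_laplace (aestronglyMeasurable_quadStat b)
    (mem_laplaceDomain_quadStat b hθ)

theorem integral_exp_smul_id [NeZero μ] (hθ : ∀ i, 0 < θ.2 i) :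
    ∫ y, Real.exp (quadStat b y θ) • y ∂μ = partitionFn b μ θ • famMean b μ θ := by
  rw [famMean, smul_inv_smul₀ (partitionFn_pos b hθ).ne']
  rfl

theorem integral_exp_smul_sub_const [NeZero μ] (hθ : ∀ i, 0 < θ.2 i) (w : E n) :
    ∫ y, Real.exp (quadStat b y θ) • (y - w) ∂μ = partitionFn b μ θ • (famMean b μ θ - w) := by
  simp only [smul_sub]
  rw [integral_sub, integral_exp_smul_id b hθ, integral_smul_const]
  · simp [partitionFn, laplace]
  · exact (hasPolyGrowth_id b μ).integrable (aestronglyMeasurable_quadStat b)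
      (mem_laplaceDomain_quadStat b hθ)
  · exact (integrable_exp_quadStat b hθ).smul_const w

/-- The `ξ`-direction produces the posterior mean and hence the score; the `s`-direction produces
second moments, needed for the time derivative of the density. -/
theorem fderiv_partitionFn_apply [NeZero μ] (hθ : ∀ i, 0 < θ.2 i) (h : E n) (s : Fin n → ℝ) :
    laplace μ (quadStat b) (fun y => (quadStat b y).smulRight (1 : ℝ)) θ (h, s)
      = partitionFn b μ θ * ⟪famMean b μ θ, h⟫
        - ∫ y, Real.exp (quadStat b y θ) * ∑ i, s i * ⟪b i, y⟫ ^ 2 ∂μ := by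
  have hint := ((hasPolyGrowth_const b μ).smulRight (aestronglyMeasurable_quadStat b)).integrable
    (aestronglyMeasurable_quadStat b) (mem_laplaceDomain_quadStat b hθ)
  have h1 : Integrable (fun y => ⟪Real.exp (quadStat b y θ) • y, h⟫) μ :=
    ((hasPolyGrowth_id b μ).integrable (aestronglyMeasurable_quadStat b)
      (mem_laplaceDomain_quadStat b hθ)).inner_const h
  have h2 := hint.apply_continuousLinearMap (h, s)
  rw [laplace, ContinuousLinearMap.integral_apply hint]
  have h3 : ∀ y, (Real.exp (quadStat b y θ) • (quadStat b y).smulRight (1 : ℝ)) (h, s)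
      = ⟪Real.exp (quadStat b y θ) • y, h⟫
        - Real.exp (quadStat b y θ) * ∑ i, s i * ⟪b i, y⟫ ^ 2 := by
    intro y
    simp [quadStat_apply, real_inner_smul_left, mul_sub]
  simp only [h3] at h2 ⊢
  have h4 : Integrable (fun y => Real.exp (quadStat b y θ) * ∑ i, s i * ⟪b i, y⟫ ^ 2) μ := by
    exact (h1.sub h2).congr (Eventually.of_forall fun y => by simp)
  rw [integral_sub h1 h4]
  congr 1
  have := integral_inner (𝕜 := ℝ) ((hasPolyGrowth_id b μ).integrable
    (aestronglyMeasurable_quadStat b) (mem_laplaceDomain_quadStat b hθ)) h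
  rw [integral_exp_smul_id b hθ, real_inner_smul_right, real_inner_comm (famMean b μ θ) h] at this
  rw [← this]
  exact integral_congr_ae (Eventually.of_forall fun y =>
    real_inner_comm h (Real.exp (quadStat b y θ) • y))

theorem integrable_exp_mul_norm_sub_sq (hθ : ∀ i, 0 < θ.2 i) (w : E n) :
    Integrable (fun y => Real.exp (quadStat b y θ) * ‖y - w‖ ^ 2) μ := by
  simpa using (hasPolyGrowth_norm_sub_sq b μ w).integrable (aestronglyMeasurable_quadStat b)
    (mem_laplaceDomain_quadStat b hθ)

/-- The mean minimises the second moment. -/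
theorem famSq_famMean_le [NeZero μ] (hθ : ∀ i, 0 < θ.2 i) (z : E n) :
    famSq b μ (famMean b μ θ) θ ≤ famSq b μ z θ := by
  set w := famMean b μ θ
  have h0 := integral_exp_smul_sub_const b (μ := μ) hθ w
  rw [sub_self, smul_zero] at h0
  have hint := (hasPolyGrowth_sub_const b μ w).integrable (aestronglyMeasurable_quadStat b)
    (mem_laplaceDomain_quadStat b hθ)
  have hcross : ∫ y, ⟪w - z, Real.exp (quadStat b y θ) • (y - w)⟫ ∂μ = 0 := by
    rw [integral_inner hint, h0, inner_zero_right]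
  have hci : Integrable (fun y => ⟪w - z, Real.exp (quadStat b y θ) • (y - w)⟫) μ :=
    hint.const_inner _
  have hle : famSq b μ w θ + 2 * ∫ y, ⟪w - z, Real.exp (quadStat b y θ) • (y - w)⟫ ∂μ
      ≤ famSq b μ z θ := by
    simp only [famSq, laplace, smul_eq_mul]
    rw [← integral_const_mul, ← integral_add (integrable_exp_mul_norm_sub_sq b hθ w)
      (hci.const_mul 2)]
    refine integral_mono ((integrable_exp_mul_norm_sub_sq b hθ w).add (hci.const_mul 2))
      (integrable_exp_mul_norm_sub_sq b hθ z) fun y => ?_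
    have e : ‖y - z‖ ^ 2 = ‖y - w‖ ^ 2 + 2 * ⟪w - z, y - w⟫ + ‖w - z‖ ^ 2 := by
      have : y - z = (y - w) + (w - z) := by abel
      rw [this, norm_add_sq_real, real_inner_comm]
    simp only [real_inner_smul_right, e]
    nlinarith [Real.exp_pos (quadStat b y θ), sq_nonneg ‖w - z‖,
      mul_nonneg (Real.exp_pos (quadStat b y θ)).le (sq_nonneg ‖w - z‖)]
  rw [hcross] at hle
  linarith

/-- Write the mean near `θ` as `w + N / M`, where `w` is the mean at `θ`, `M` the partition function
and `N` the transform of `y - w`. Since `N` vanishes at `θ`, the derivative of `1 / M` drops out and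
a centred, covariance-type expression remains. -/
theorem hasFDerivAt_famMean [NeZero μ] (hθ : ∀ i, 0 < θ.2 i) :
    HasFDerivAt (famMean b μ) ((partitionFn b μ θ)⁻¹ • laplace μ (quadStat b)
      (fun y => (quadStat b y).smulRight (y - famMean b μ θ)) θ) θ := by
  set w := famMean b μ θ with hw
  have hopen : IsOpen {θ : Param n | ∀ i, 0 < θ.2 i} := by
    simp only [ofPred_forall]
    exact isOpen_iInter_of_finite fun i => isOpen_lt continuous_const (by fun_prop)
  have hN := (hasPolyGrowth_sub_const b μ w).hasFDerivAt_laplace (aestronglyMeasurable_quadStat b)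
    (mem_laplaceDomain_quadStat b hθ)
  have hN0 : laplace μ (quadStat b) (fun y => y - w) θ = 0 := by
    rw [laplace, integral_exp_smul_sub_const b hθ, ← hw, sub_self, smul_zero]
  have hM := (hasDerivAt_inv (partitionFn_pos b (μ := μ) hθ).ne').comp_hasFDerivAt θ
    (hasFDerivAt_partitionFn b (μ := μ) hθ)
  have hprod := (hM.smul hN).add_const w
  refine (hprod.congr_fderiv ?_).congr_of_eventuallyEq ?_
  · rw [hN0]
    refine ContinuousLinearMap.ext fun u => ?_
    simp
  · filter_upwards [hopen.mem_nhds hθ] with θ' hθ'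
    simp only [Pi.smul_apply', Function.comp_apply]
    rw [laplace, integral_exp_smul_sub_const b hθ', inv_smul_smul₀ (partitionFn_pos b hθ').ne']
    simp

theorem fderiv_famMean_apply [NeZero μ] (hθ : ∀ i, 0 < θ.2 i) (h : E n) :
    fderiv ℝ (famMean b μ) θ (h, 0) = (partitionFn b μ θ)⁻¹ •
      ∫ y, (Real.exp (quadStat b y θ) * ⟪y, h⟫) • (y - famMean b μ θ) ∂μ := by
  have hint := ((hasPolyGrowth_sub_const b μ (famMean b μ θ)).smulRight
    (aestronglyMeasurable_quadStat b)).integrable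
    (aestronglyMeasurable_quadStat b) (mem_laplaceDomain_quadStat b hθ)
  rw [(hasFDerivAt_famMean b hθ).fderiv, smul_apply, laplace,
    ContinuousLinearMap.integral_apply hint]
  simp [quadStat_apply, smul_smul]

theorem integrable_exp_inner_smul (hθ : ∀ i, 0 < θ.2 i) (h w : E n) :
    Integrable (fun y => (Real.exp (quadStat b y θ) * ⟪y, h⟫) • (y - w)) μ := by
  have hint := ((hasPolyGrowth_sub_const b μ w).smulRight
    (aestronglyMeasurable_quadStat b)).integrable
    (aestronglyMeasurable_quadStat b) (mem_laplaceDomain_quadStat b hθ)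
  simpa [quadStat_apply, smul_smul] using hint.apply_continuousLinearMap (h, 0)

/-- This derivative is the posterior covariance. Its norm is at most the second moment about the
mean, which is minimal among all centres, so a bound about any convenient `z` suffices. -/
theorem norm_fderiv_famMean_apply_le [NeZero μ] (hθ : ∀ i, 0 < θ.2 i) {C : ℝ} {z : E n}
    (hC : famSq b μ z θ ≤ C * partitionFn b μ θ) (h : E n) :
    ‖fderiv ℝ (famMean b μ) θ (h, 0)‖ ≤ C * ‖h‖ := by
  set w := famMean b μ θ with hw
  have hM := partitionFn_pos b (μ := μ) hθ
  have h0 := integral_exp_smul_sub_const b (μ := μ) hθ w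
  rw [sub_self, smul_zero] at h0
  have hint := (hasPolyGrowth_sub_const b μ w).integrable (aestronglyMeasurable_quadStat b)
    (mem_laplaceDomain_quadStat b hθ)
  have hcent : ∫ y, (Real.exp (quadStat b y θ) * ⟪y, h⟫) • (y - w) ∂μ
      = ∫ y, (Real.exp (quadStat b y θ) * ⟪y - w, h⟫) • (y - w) ∂μ := by
    have e : ∀ y, (Real.exp (quadStat b y θ) * ⟪y - w, h⟫) • (y - w)
        = (Real.exp (quadStat b y θ) * ⟪y, h⟫) • (y - w)
          - ⟪w, h⟫ • (Real.exp (quadStat b y θ) • (y - w)) := by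
      intro y
      rw [inner_sub_left, mul_sub, sub_smul, smul_smul, mul_comm ⟪w, h⟫]
    have hsm : Integrable (fun y => ⟪w, h⟫ • (Real.exp (quadStat b y θ) • (y - w))) μ :=
      hint.fun_smul _
    simp only [e]
    rw [integral_sub (integrable_exp_inner_smul b hθ h w) hsm, integral_smul, h0,
      smul_zero, sub_zero]
  rw [fderiv_famMean_apply b hθ, ← hw, hcent, norm_smul, Real.norm_of_nonneg (inv_pos.2 hM).le]
  have hbound : ‖∫ y, (Real.exp (quadStat b y θ) * ⟪y - w, h⟫) • (y - w) ∂μ‖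
      ≤ famSq b μ w θ * ‖h‖ := by
    rw [famSq, laplace, ← integral_mul_const]
    refine norm_integral_le_of_norm_le ?_ (Eventually.of_forall fun y => ?_)
    · simpa using (integrable_exp_mul_norm_sub_sq b hθ w).mul_const ‖h‖
    · rw [norm_smul, norm_mul, Real.norm_of_nonneg (Real.exp_pos _).le, smul_eq_mul]
      have := norm_inner_le_norm (𝕜 := ℝ) (y - w) h
      calc Real.exp (quadStat b y θ) * ‖⟪y - w, h⟫‖ * ‖y - w‖
          ≤ Real.exp (quadStat b y θ) * (‖y - w‖ * ‖h‖) * ‖y - w‖ := by gcongr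
        _ = _ := by ring
  calc (partitionFn b μ θ)⁻¹ * _
      ≤ (partitionFn b μ θ)⁻¹ * (C * partitionFn b μ θ * ‖h‖) := by
        refine mul_le_mul_of_nonneg_left (hbound.trans ?_) (inv_pos.2 hM).le
        exact mul_le_mul_of_nonneg_right ((famSq_famMean_le b hθ z).trans hC) (norm_nonneg _)
    _ = C * ‖h‖ := by field_simp

/-- The trace of the covariance; it enters the divergence of the velocity field. -/
theorem sum_inner_fderiv_famMean [NeZero μ] (hθ : ∀ i, 0 < θ.2 i) :
    ∑ i, ⟪b i, fderiv ℝ (famMean b μ) θ (b i, 0)⟫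
      = (partitionFn b μ θ)⁻¹ * famSq b μ 0 θ - ‖famMean b μ θ‖ ^ 2 := by
  set w := famMean b μ θ with hw
  have hM := partitionFn_pos b (μ := μ) hθ
  have hint := (hasPolyGrowth_id b μ).integrable (aestronglyMeasurable_quadStat b)
    (mem_laplaceDomain_quadStat b hθ)
  have e : ∀ i, ⟪b i, fderiv ℝ (famMean b μ) θ (b i, 0)⟫ = (partitionFn b μ θ)⁻¹ *
      ∫ y, ⟪b i, (Real.exp (quadStat b y θ) * ⟪y, b i⟫) • (y - w)⟫ ∂μ := fun i => by
    rw [fderiv_famMean_apply b hθ, ← hw, real_inner_smul_right,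
      integral_inner (integrable_exp_inner_smul b hθ (b i) w)]
  have hi : ∀ i ∈ Finset.univ, Integrable
      (fun y => ⟪b i, (Real.exp (quadStat b y θ) * ⟪y, b i⟫) • (y - w)⟫) μ :=
    fun i _ => (integrable_exp_inner_smul b hθ (b i) w).const_inner _
  simp only [e]
  rw [← Finset.mul_sum, ← integral_finsetSum _ hi]
  have e2 : ∀ y, ∑ i, ⟪b i, (Real.exp (quadStat b y θ) * ⟪y, b i⟫) • (y - w)⟫
      = Real.exp (quadStat b y θ) * ‖y - 0‖ ^ 2 - ⟪w, Real.exp (quadStat b y θ) • y⟫ := by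
    intro y
    have : ∑ i, ⟪y, b i⟫ * ⟪b i, y - w⟫ = ⟪y, y - w⟫ := b.sum_inner_mul_inner y (y - w)
    simp only [real_inner_smul_right, mul_assoc, ← Finset.mul_sum, this, sub_zero]
    rw [inner_sub_right, real_inner_self_eq_norm_sq, real_inner_comm w y]
    ring
  simp only [e2]
  rw [integral_sub (integrable_exp_mul_norm_sub_sq b hθ 0) (hint.const_inner w),
    integral_inner hint, integral_exp_smul_id b hθ, ← hw, real_inner_smul_right,
    real_inner_self_eq_norm_sq]
  simp only [famSq, laplace, smul_eq_mul]
  field_simp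

end

end VPFlow

/-! ### Gaussian mixture representations of the marginals, the score, and the velocity field -/

namespace VPFlow

open Metric Function Filter Topology ExpFamily InnerProductSpace ODEFlow

variable {n : ℕ}

local notation "⟪" x ", " y "⟫" => inner ℝ x y

variable (b : OrthonormalBasis (Fin n) ℝ (E n))

/-- The operator which is diagonal in the basis `b` with diagonal `l`. -/
noncomputable def diagOp (l : Fin n → ℝ) : E n →L[ℝ] E n :=
  ∑ i, l i • (innerSL ℝ (b i)).smulRight (b i)

theorem diagOp_apply (l : Fin n → ℝ) (x : E n) : diagOp b l x = ∑ i, (l i * ⟪b i, x⟫) • b i := by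
  simp [diagOp, smul_smul]

theorem inner_diagOp (l : Fin n → ℝ) (x y : E n) :
    ⟪y, diagOp b l x⟫ = ∑ i, l i * ⟪b i, x⟫ * ⟪b i, y⟫ := by
  rw [diagOp_apply, inner_sum]
  exact Finset.sum_congr rfl fun i _ => by
    rw [real_inner_smul_right, real_inner_comm (b i) y]

theorem inner_diagOp_comm (l : Fin n → ℝ) (x y : E n) : ⟪y, diagOp b l x⟫ = ⟪diagOp b l y, x⟫ := by
  rw [inner_diagOp, real_inner_comm x, inner_diagOp]
  exact Finset.sum_congr rfl fun i _ => by ring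

theorem diagOp_const (l : ℝ) (x : E n) : diagOp b (fun _ => l) x = l • x := by
  rw [diagOp_apply]
  simp only [mul_smul, ← Finset.smul_sum]
  rw [b.sum_repr' x]

theorem continuous_diagOp : Continuous (diagOp b) := by
  unfold diagOp
  exact continuous_finsetSum _ fun i _ => (continuous_apply i).smul continuous_const

/-- The unnormalised centred Gaussian kernel with precisions `l` in the basis `b`. -/
noncomputable def gaussKernel (l : Fin n → ℝ) (z : E n) : ℝ :=
  Real.exp (-(∑ i, l i * ⟪b i, z⟫ ^ 2) / 2)

/-- The natural parameter of the posterior of `y` given `x`. -/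
noncomputable def natParam (a : ℝ) (l : Fin n → ℝ) (x : E n) : Param n :=
  (a • diagOp b l x, fun i => a ^ 2 * l i / 2)

/-- Expanding the squares: the terms in `x` alone form the prefactor, while the cross terms and the
terms in `y` form the pairing of the statistic with the natural parameter. -/
theorem gaussKernel_sub_smul (a : ℝ) (l : Fin n → ℝ) (x y : E n) :
    gaussKernel b l (x - a • y)
      = gaussKernel b l x * Real.exp (quadStat b y (natParam b a l x)) := by
  rw [gaussKernel, gaussKernel, ← Real.exp_add, quadStat_apply]
  congr 1
  simp only [natParam, real_inner_smul_right, inner_diagOp, inner_sub_right, neg_div,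
    Finset.sum_div, Finset.mul_sum, ← Finset.sum_neg_distrib, ← Finset.sum_sub_distrib,
    ← Finset.sum_add_distrib]
  exact Finset.sum_congr rfl fun i _ => by ring

theorem integral_gaussKernel_sub_smul (μ : Measure (E n)) (a : ℝ) (l : Fin n → ℝ) (x : E n) :
    ∫ y, gaussKernel b l (x - a • y) ∂μ
      = gaussKernel b l x * partitionFn b μ (natParam b a l x) := by
  simp only [gaussKernel_sub_smul, integral_const_mul]
  simp [partitionFn, laplace]

theorem natParam_snd_pos {a : ℝ} (ha : 0 < a) {l : Fin n → ℝ} (hl : ∀ i, 0 < l i) (x : E n)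
    (i : Fin n) : 0 < (natParam b a l x).2 i := by
  have := hl i
  simp only [natParam]
  positivity

theorem hasFDerivAt_natParam (a : ℝ) (l : Fin n → ℝ) (x : E n) :
    HasFDerivAt (natParam b a l) ((a • diagOp b l).prod (0 : E n →L[ℝ] (Fin n → ℝ))) x :=
  ((a • diagOp b l).hasFDerivAt).prodMk (hasFDerivAt_const _ _)

theorem continuousOn_partitionFn {μ : Measure (E n)} [IsFiniteMeasure μ] :
    ContinuousOn (partitionFn b μ) {θ : Param n | ∀ i, 0 < θ.2 i} :=
  fun _ hθ => (hasFDerivAt_partitionFn b hθ).continuousAt.continuousWithinAt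

/-! ### Tweedie's formula and the Jacobian of the velocity. -/

section Score

variable {μ : Measure (E n)} [IsFiniteMeasure μ] [NeZero μ]

theorem gaussKernel_pos (l : Fin n → ℝ) (x : E n) : 0 < gaussKernel b l x := Real.exp_pos _

/-- The log density is a constant, a quadratic form and the log partition function at `natParam`.
The gradient of the last is the posterior mean, transported by the linear map `x ↦ a • diagOp b l
x`. -/
theorem hasGradientAt_log_mixture {a : ℝ} (ha : 0 < a) {l : Fin n → ℝ} (hl : ∀ i, 0 < l i)
    {c : ℝ} (hc : 0 < c) (x : E n) :
    HasGradientAt (fun x => Real.log (c * ∫ y, gaussKernel b l (x - a • y) ∂μ))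
      (a • diagOp b l (famMean b μ (natParam b a l x)) - diagOp b l x) x := by
  have hθ := fun x => natParam_snd_pos b ha hl x
  have hlog : (fun x => Real.log (c * ∫ y, gaussKernel b l (x - a • y) ∂μ)) = fun x =>
      Real.log c + -(∑ i, l i * ⟪b i, x⟫ ^ 2) / 2
        + Real.log (partitionFn b μ (natParam b a l x)) := by
    funext x
    rw [integral_gaussKernel_sub_smul, Real.log_mul hc.ne'
      (mul_pos (gaussKernel_pos b l x) (partitionFn_pos b (hθ x))).ne',
      Real.log_mul (gaussKernel_pos b l x).ne' (partitionFn_pos b (hθ x)).ne', gaussKernel,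
      Real.log_exp, add_assoc]
  have hquad : HasFDerivAt (fun x : E n => ∑ i, l i * ⟪b i, x⟫ ^ 2)
      (∑ i, l i • ((2 * ⟪b i, x⟫) • innerSL ℝ (b i))) x := by
    refine HasFDerivAt.fun_sum fun i _ => ?_
    have := ((innerSL ℝ (b i)).hasFDerivAt (x := x)).pow 2
    simpa using this.const_mul (l i)
  have hpart := (hasFDerivAt_partitionFn b (μ := μ) (hθ x)).comp x (hasFDerivAt_natParam b a l x)
  have hall := ((hquad.neg.mul_const (2 : ℝ)⁻¹).const_add (Real.log c)).add
    (hpart.log (partitionFn_pos b (hθ x)).ne')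
  rw [hasGradientAt_iff_hasFDerivAt, hlog]
  refine (hall.congr_fderiv ?_).congr_of_eventuallyEq (Eventually.of_forall fun x => ?_)
  · refine ContinuousLinearMap.ext fun h => ?_
    have h1 := fderiv_partitionFn_apply b (μ := μ) (hθ x) (a • diagOp b l h) 0
    have hM := (partitionFn_pos b (μ := μ) (hθ x)).ne'
    simp only [Pi.zero_apply, zero_mul, Finset.sum_const_zero, mul_zero, integral_zero,
      sub_zero] at h1
    have h2 : (laplace μ (quadStat b) (fun y => (quadStat b y).smulRight (1 : ℝ))
        (natParam b a l x)) (((a • diagOp b l).prod (0 : E n →L[ℝ] (Fin n → ℝ))) h)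
        = partitionFn b μ (natParam b a l x)
          * ⟪famMean b μ (natParam b a l x), a • diagOp b l h⟫ := h1
    simp only [add_apply, smul_apply, neg_apply, ContinuousLinearMap.comp_apply, h2,
      toDual_apply_apply, inner_sub_left, smul_eq_mul, real_inner_smul_left,
      real_inner_smul_right, sum_apply, innerSL_apply_apply, Function.comp_apply]
    rw [← inner_diagOp_comm, ← inner_diagOp_comm, inner_diagOp, inner_diagOp,
      inv_mul_cancel_left₀ hM, Finset.mul_sum, mul_neg, Finset.mul_sum, ← sub_eq_neg_add]
    congr 1
    exact Finset.sum_congr rfl fun i _ => by ring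
  · simp [div_eq_mul_inv]

/-- The velocity field of a Gaussian mixture. -/
noncomputable def famVelocity (μ : Measure (E n)) (a : ℝ) (l : Fin n → ℝ) (x : E n) : E n :=
  -((1 / 2 : ℝ) • x) -
    (1 / 2 : ℝ) • (a • diagOp b l (famMean b μ (natParam b a l x)) - diagOp b l x)

/-- The spatial derivative of `famVelocity`. -/
noncomputable def famVelocityDeriv (μ : Measure (E n)) (a : ℝ) (l : Fin n → ℝ) (x : E n) :
    E n →L[ℝ] E n :=
  -((1 / 2 : ℝ) • ContinuousLinearMap.id ℝ (E n)) -
    (1 / 2 : ℝ) • (a • (diagOp b l).comp ((fderiv ℝ (famMean b μ) (natParam b a l x)).comp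
      ((a • diagOp b l).prod (0 : E n →L[ℝ] (Fin n → ℝ)))) - diagOp b l)

theorem hasFDerivAt_famVelocity {a : ℝ} (ha : 0 < a) {l : Fin n → ℝ} (hl : ∀ i, 0 < l i)
    (x : E n) : HasFDerivAt (famVelocity b μ a l) (famVelocityDeriv b μ a l x) x := by
  have hm := ((hasFDerivAt_famMean b (μ := μ) (natParam_snd_pos b ha hl x)).differentiableAt
    |>.hasFDerivAt).comp x (hasFDerivAt_natParam b a l x)
  exact (((hasFDerivAt_id x).const_smul (1 / 2 : ℝ)).neg).sub
    (((((diagOp b l).hasFDerivAt.comp x hm).const_smul a).sub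
      (diagOp b l).hasFDerivAt).const_smul (1 / 2 : ℝ))

theorem isOpen_paramPos : IsOpen {θ : Param n | ∀ i, 0 < θ.2 i} := by
  simp only [ofPred_forall]
  exact isOpen_iInter_of_finite fun i => isOpen_lt continuous_const (by fun_prop)

theorem contDiffOn_famMean :
    ContDiffOn ℝ 1 (famMean b μ) {θ : Param n | ∀ i, 0 < θ.2 i} := by
  have hsub : {θ : Param n | ∀ i, 0 < θ.2 i} ⊆ laplaceDomain μ (quadStat b) :=
    fun θ hθ => mem_laplaceDomain_quadStat b hθ
  have h1 := (HasPolyGrowth.contDiffOn_laplace_nat (aestronglyMeasurable_quadStat b) 1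
    (hasPolyGrowth_const b μ)).mono hsub
  have h2 := (HasPolyGrowth.contDiffOn_laplace_nat (aestronglyMeasurable_quadStat b) 1
    (hasPolyGrowth_id b μ)).mono hsub
  exact (h1.inv fun θ hθ => (partitionFn_pos b hθ).ne').smul h2

theorem norm_famVelocityDeriv_le {a : ℝ} (ha : 0 < a) {l : Fin n → ℝ} (hl : ∀ i, 0 < l i)
    {C D A : ℝ} (hC0 : 0 ≤ C) (hD : ‖diagOp b l‖ ≤ D) (hA : a ≤ A) {x z : E n}
    (hC : famSq b μ z (natParam b a l x) ≤ C * partitionFn b μ (natParam b a l x)) :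
    ‖famVelocityDeriv b μ a l x‖ ≤ 1 / 2 + 1 / 2 * (A ^ 2 * D ^ 2 * C + D) := by
  have hD0 : 0 ≤ D := (norm_nonneg _).trans hD
  refine ContinuousLinearMap.opNorm_le_bound _ (by positivity) fun h => ?_
  have hcov := norm_fderiv_famMean_apply_le b (natParam_snd_pos b ha hl x) hC (a • diagOp b l h)
  have hQ : ∀ u, ‖diagOp b l u‖ ≤ D * ‖u‖ := fun u => (diagOp b l).le_of_opNorm_le hD u
  have h1 : ‖a • diagOp b l h‖ ≤ A * (D * ‖h‖) := by
    rw [norm_smul, Real.norm_of_nonneg ha.le]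
    exact mul_le_mul hA (hQ h) (norm_nonneg _) (ha.le.trans hA)
  have h2 : ‖a • diagOp b l (fderiv ℝ (famMean b μ) (natParam b a l x) (a • diagOp b l h, 0))‖
      ≤ A * (D * (C * (A * (D * ‖h‖)))) := by
    rw [norm_smul, Real.norm_of_nonneg ha.le]
    refine mul_le_mul hA ((hQ _).trans ?_) (norm_nonneg _) (ha.le.trans hA)
    exact mul_le_mul_of_nonneg_left (hcov.trans (mul_le_mul_of_nonneg_left h1 hC0)) hD0
  have e : famVelocityDeriv b μ a l x h = -((1 / 2 : ℝ) • h) - (1 / 2 : ℝ) •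
      (a • diagOp b l (fderiv ℝ (famMean b μ) (natParam b a l x) (a • diagOp b l h, 0))
        - diagOp b l h) := rfl
  rw [e]
  refine (norm_sub_le _ _).trans ?_
  rw [norm_neg, norm_smul, norm_smul, Real.norm_of_nonneg (by norm_num : (0 : ℝ) ≤ 1 / 2)]
  have h3 := (norm_sub_le (a • diagOp b l (fderiv ℝ (famMean b μ) (natParam b a l x)
    (a • diagOp b l h, 0))) (diagOp b l h)).trans (add_le_add h2 (hQ h))
  nlinarith [h3]

end Score

/-- On `[s, T]` the marginals of the process started from `pH` are Gaussian mixtures with mixing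
measure `μ` and precisions `l t`, and the posterior covariances are uniformly bounded. -/
structure MixtureRep (pH : E n → ℝ) (b : OrthonormalBasis (Fin n) ℝ (E n)) (μ : Measure (E n))
    (l : ℝ → Fin n → ℝ) (c : ℝ → ℝ) (s T : ℝ) : Prop where
  pos : ∀ t ∈ Icc s T, ∀ i, 0 < l t i
  continuousOn_precision : ContinuousOn l (Icc s T)
  const_pos : ∀ t ∈ Icc s T, 0 < c t
  continuousOn_const : ContinuousOn c (Icc s T)
  density_eq : ∀ t ∈ Icc s T, ∀ x,
    vpDensity pH t x = c t * ∫ y, gaussKernel b (l t) (x - aCoef t • y) ∂μ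
  variance_le : ∃ C, 0 ≤ C ∧ ∀ t ∈ Icc s T, ∀ x, ∃ z,
    famSq b μ z (natParam b (aCoef t) (l t) x)
      ≤ C * partitionFn b μ (natParam b (aCoef t) (l t) x)

theorem aCoef_pos (t : ℝ) : 0 < aCoef t := Real.exp_pos _

theorem continuous_aCoef : Continuous aCoef := by unfold aCoef; fun_prop

/-! ### Consequences of a mixture representation for density and velocity. -/

namespace MixtureRep

variable {b} {pH : E n → ℝ} {μ : Measure (E n)}
  {l : ℝ → Fin n → ℝ} {c : ℝ → ℝ} {s T : ℝ}

theorem continuousOn_natParam (h : MixtureRep pH b μ l c s T) :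
    ContinuousOn (fun p : ℝ × E n => natParam b (aCoef p.1) (l p.1) p.2) (Icc s T ×ˢ univ) := by
  have ha : ContinuousOn (fun p : ℝ × E n => aCoef p.1) (Icc s T ×ˢ univ) :=
    (continuous_aCoef.comp continuous_fst).continuousOn
  have hl : ContinuousOn (fun p : ℝ × E n => l p.1) (Icc s T ×ˢ univ) :=
    h.continuousOn_precision.comp continuousOn_fst fun p hp => hp.1
  have hQ : ContinuousOn (fun p : ℝ × E n => diagOp b (l p.1)) (Icc s T ×ˢ univ) :=
    (continuous_diagOp b).comp_continuousOn hl
  refine ContinuousOn.prodMk (ha.smul (hQ.clm_apply continuousOn_snd)) ?_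
  exact continuousOn_pi.2 fun i => ((ha.pow 2).mul ((continuousOn_pi.1 hl) i)).div_const 2

variable [IsFiniteMeasure μ]

theorem continuousOn_density (h : MixtureRep pH b μ l c s T) :
    ContinuousOn (fun p : ℝ × E n => vpDensity pH p.1 p.2) (Icc s T ×ˢ univ) := by
  have hc : ContinuousOn (fun p : ℝ × E n => c p.1) (Icc s T ×ˢ univ) :=
    h.continuousOn_const.comp continuousOn_fst fun p hp => hp.1
  have hl : ContinuousOn (fun p : ℝ × E n => l p.1) (Icc s T ×ˢ univ) :=
    h.continuousOn_precision.comp continuousOn_fst fun p hp => hp.1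
  have hg : ContinuousOn (fun p : ℝ × E n => gaussKernel b (l p.1) p.2) (Icc s T ×ˢ univ) := by
    refine Real.continuous_exp.comp_continuousOn (ContinuousOn.div_const (ContinuousOn.neg ?_) 2)
    refine continuousOn_finsetSum _ fun i _ => ((continuousOn_pi.1 hl) i).mul ?_
    fun_prop
  have hM := (continuousOn_partitionFn b (μ := μ)).comp h.continuousOn_natParam
    fun p hp => natParam_snd_pos b (aCoef_pos p.1) (h.pos p.1 hp.1) p.2
  refine (hc.mul (hg.mul hM)).congr fun p hp => ?_
  rw [h.density_eq p.1 hp.1, integral_gaussKernel_sub_smul]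
  rfl

variable [NeZero μ]

theorem hasGradientAt_log (h : MixtureRep pH b μ l c s T) {t : ℝ} (ht : t ∈ Icc s T) (x : E n) :
    HasGradientAt (fun y => Real.log (vpDensity pH t y))
      (aCoef t • diagOp b (l t) (famMean b μ (natParam b (aCoef t) (l t) x)) - diagOp b (l t) x)
      x := by
  have := hasGradientAt_log_mixture b (μ := μ) (aCoef_pos t) (h.pos t ht) (h.const_pos t ht) x
  simpa only [← h.density_eq t ht] using this

theorem vpVelocity_eq (h : MixtureRep pH b μ l c s T) {t : ℝ} (ht : t ∈ Icc s T) :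
    vpVelocity pH t = famVelocity b μ (aCoef t) (l t) := by
  funext x
  rw [vpVelocity, vpScore, (h.hasGradientAt_log ht x).gradient, famVelocity]

theorem density_pos (h : MixtureRep pH b μ l c s T) {t : ℝ} (ht : t ∈ Icc s T) (x : E n) :
    0 < vpDensity pH t x := by
  rw [h.density_eq t ht, integral_gaussKernel_sub_smul]
  exact mul_pos (h.const_pos t ht) (mul_pos (gaussKernel_pos _ _ _)
    (partitionFn_pos b (natParam_snd_pos b (aCoef_pos t) (h.pos t ht) x)))

/-- Time and space enter only through the continuous map `natParam` and the coefficients `a`, `l`,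
while `famMean` is `C¹` in its parameter; this gives joint continuity. Compactness of `[s, T]`
bounds the coefficients, and `variance_le` bounds the covariance uniformly in `x`. -/
theorem exists_isC1Field (h : MixtureRep pH b μ l c s T) :
    ∃ K : ℝ≥0, IsC1Field (vpVelocity pH) (fun t x => fderiv ℝ (vpVelocity pH t) x) s T K := by
  have hfd : ∀ t ∈ Icc s T, ∀ x, HasFDerivAt (vpVelocity pH t)
      (famVelocityDeriv b μ (aCoef t) (l t) x) x := fun t ht x => by
    rw [h.vpVelocity_eq ht]
    exact hasFDerivAt_famVelocity b (aCoef_pos t) (h.pos t ht) x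
  have hmaps : ∀ p ∈ Icc s T ×ˢ (univ : Set (E n)),
      natParam b (aCoef p.1) (l p.1) p.2 ∈ {θ : Param n | ∀ i, 0 < θ.2 i} :=
    fun p hp => natParam_snd_pos b (aCoef_pos p.1) (h.pos p.1 hp.1) p.2
  have ha : ContinuousOn (fun p : ℝ × E n => aCoef p.1) (Icc s T ×ˢ univ) :=
    (continuous_aCoef.comp continuous_fst).continuousOn
  have hQ' : ContinuousOn (fun t => diagOp b (l t)) (Icc s T) :=
    (continuous_diagOp b).comp_continuousOn h.continuousOn_precision
  have hQ : ContinuousOn (fun p : ℝ × E n => diagOp b (l p.1)) (Icc s T ×ˢ univ) :=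
    hQ'.comp continuousOn_fst fun p hp => hp.1
  obtain ⟨D, hD⟩ := (isCompact_Icc.image_of_continuousOn hQ').isBounded.exists_norm_le
  obtain ⟨A, hA⟩ := (isCompact_Icc.image_of_continuousOn
    (continuous_aCoef.continuousOn (s := Icc s T))).isBounded.exists_norm_le
  obtain ⟨C, hC0, hC⟩ := h.variance_le
  have hbound : ∀ t ∈ Icc s T, ∀ x, ‖famVelocityDeriv b μ (aCoef t) (l t) x‖
      ≤ 1 / 2 + 1 / 2 * (A ^ 2 * D ^ 2 * C + D) := fun t ht x => by
    obtain ⟨z, hz⟩ := hC t ht x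
    exact norm_famVelocityDeriv_le b (aCoef_pos t) (h.pos t ht) hC0
      (hD _ (mem_image_of_mem _ ht)) ((le_abs_self _).trans (hA _ (mem_image_of_mem _ ht))) hz
  refine ⟨(1 / 2 + 1 / 2 * (A ^ 2 * D ^ 2 * C + D)).toNNReal, fun x => ?_, fun t ht x => ?_, ?_,
    fun t ht x => ?_⟩
  · have hm := (contDiffOn_famMean b (μ := μ)).continuousOn.comp h.continuousOn_natParam hmaps
    have hv : ContinuousOn (fun p : ℝ × E n => famVelocity b μ (aCoef p.1) (l p.1) p.2)
        (Icc s T ×ˢ univ) :=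
      (continuousOn_snd.const_smul (1 / 2 : ℝ)).neg.sub
        (((ha.smul (hQ.clm_apply hm)).sub (hQ.clm_apply continuousOn_snd)).const_smul (1 / 2 : ℝ))
    refine (hv.comp (f := fun t => (t, x)) (by fun_prop) fun t ht => ⟨ht, trivial⟩).congr ?_
    intro t ht
    simp only [h.vpVelocity_eq ht, Function.comp_apply]
  · exact (hfd t ht x).differentiableAt.hasFDerivAt
  · have hm := ((contDiffOn_famMean b (μ := μ)).continuousOn_fderiv_of_isOpen isOpen_paramPos
      le_rfl).comp h.continuousOn_natParam hmaps
    have hprod : ContinuousOn (fun p : ℝ × E n => (aCoef p.1 • diagOp b (l p.1)).prod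
        (0 : E n →L[ℝ] (Fin n → ℝ))) (Icc s T ×ˢ univ) := by
      have : ∀ p : ℝ × E n, (aCoef p.1 • diagOp b (l p.1)).prod (0 : E n →L[ℝ] (Fin n → ℝ))
          = (ContinuousLinearMap.inl ℝ (E n) (Fin n → ℝ)).comp (aCoef p.1 • diagOp b (l p.1)) :=
        fun p => by ext <;> simp
      simp only [this]
      exact _root_.continuousOn_const.clm_comp (ha.smul hQ)
    have hv : ContinuousOn (fun p : ℝ × E n => famVelocityDeriv b μ (aCoef p.1) (l p.1) p.2)
        (Icc s T ×ˢ univ) :=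
      _root_.continuousOn_const.sub
        (((ha.smul (hQ.clm_comp (hm.clm_comp hprod))).sub hQ).const_smul (1 / 2 : ℝ))
    exact hv.congr fun p hp => (hfd p.1 hp.1 p.2).fderiv
  · rw [(hfd t ht x).fderiv]
    exact (hbound t ht x).trans (Real.le_coe_toNNReal _)

end MixtureRep

end VPFlow

/-! ### The isotropic representation and the continuity equation -/

namespace VPFlow

open Metric Function Filter Topology ExpFamily InnerProductSpace ODEFlow

variable {n : ℕ}

local notation "⟪" x ", " y "⟫" => inner ℝ x y

theorem IsPdf.aemeasurable_ofReal {p : E n → ℝ} (h : IsPdf p) :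
    AEMeasurable (fun x => ENNReal.ofReal (p x)) volume :=
  h.integrable.aestronglyMeasurable.aemeasurable.ennreal_ofReal

theorem IsPdf.integral_densityMeasure {G : Type*} [NormedAddCommGroup G] [NormedSpace ℝ G]
    {p : E n → ℝ} (h : IsPdf p) (f : E n → G) :
    ∫ x, f x ∂densityMeasure p = ∫ x, p x • f x := by
  rw [densityMeasure, integral_withDensity_eq_integral_toReal_smul₀ h.aemeasurable_ofReal
    (Eventually.of_forall fun x => ENNReal.ofReal_lt_top)]
  exact integral_congr_ae (Eventually.of_forall fun x => by
    simp only [ENNReal.toReal_ofReal (h.nonneg x)])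

theorem IsPdf.isProbabilityMeasure {p : E n → ℝ} (h : IsPdf p) :
    IsProbabilityMeasure (densityMeasure p) := by
  refine ⟨?_⟩
  rw [densityMeasure, withDensity_apply _ MeasurableSet.univ, Measure.restrict_univ,
    ← ofReal_integral_eq_lintegral_ofReal h.integrable (Eventually.of_forall h.nonneg),
    h.integral_eq_one, ENNReal.ofReal_one]

theorem sigmaSq_pos {t : ℝ} (ht : 0 < t) : 0 < sigmaSq t := by
  have : Real.exp (-t) < 1 := by simpa using ht
  unfold sigmaSq; linarith

theorem aCoef_sq (t : ℝ) : aCoef t ^ 2 = Real.exp (-t) := by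
  rw [aCoef, ← Real.exp_nat_mul]; congr 1; push_cast; ring

theorem sigmaSq_eq (t : ℝ) : sigmaSq t = 1 - aCoef t ^ 2 := by rw [aCoef_sq, sigmaSq]

theorem hasDerivAt_aCoef (t : ℝ) : HasDerivAt aCoef (-(1 / 2) * aCoef t) t := by
  have h := (((hasDerivAt_id t).neg).div_const 2).exp
  convert! h using 1
  simp [aCoef]; ring

theorem hasDerivAt_sigmaSq (t : ℝ) : HasDerivAt sigmaSq (aCoef t ^ 2) t := by
  have h := ((hasDerivAt_id t).neg).exp.const_sub 1
  convert! h using 1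
  simp [aCoef_sq]

theorem continuous_sigmaSq : Continuous sigmaSq := by unfold sigmaSq; fun_prop

theorem gaussKernel_const (b : OrthonormalBasis (Fin n) ℝ (E n)) (l : ℝ) (z : E n) :
    gaussKernel b (fun _ => l) z = Real.exp (-(l * ‖z‖ ^ 2) / 2) := by
  rw [gaussKernel, ← Finset.mul_sum, sum_inner_sq_eq]

theorem gaussIso_eq_gaussKernel (b : OrthonormalBasis (Fin n) ℝ (E n)) (v : ℝ) (z : E n) :
    gaussIso v 0 z = (2 * Real.pi * v) ^ (-(n : ℝ) / 2) * gaussKernel b (fun _ => v⁻¹) z := by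
  rw [gaussKernel_const, gaussIso, sub_zero]
  congr 2
  rw [neg_div, neg_div, inv_mul_eq_div, div_div, mul_comm v 2]

/-- The isotropic representation of the marginals at positive times. -/
theorem vpDensity_eq_iso (b : OrthonormalBasis (Fin n) ℝ (E n)) {pH : E n → ℝ} (hpdf : IsPdf pH)
    {t : ℝ} (ht : 0 < t) (x : E n) :
    vpDensity pH t x = (2 * Real.pi * sigmaSq t) ^ (-(n : ℝ) / 2) *
      ∫ y, gaussKernel b (fun _ => (sigmaSq t)⁻¹) (x - aCoef t • y) ∂densityMeasure pH := by
  rw [vpDensity, if_neg ht.ne', hpdf.integral_densityMeasure, ← integral_const_mul]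
  refine integral_congr_ae (Eventually.of_forall fun y => ?_)
  simp only [gaussIso_eq_gaussKernel b, smul_eq_mul]
  ring

theorem mixtureRep_iso (b : OrthonormalBasis (Fin n) ℝ (E n)) {pH : E n → ℝ} (hpdf : IsPdf pH)
    {s T : ℝ} (hs : 0 < s)
    (hvar : ∃ C, 0 ≤ C ∧ ∀ t ∈ Icc s T, ∀ x, ∃ z, famSq b (densityMeasure pH) z
        (natParam b (aCoef t) (fun _ => (sigmaSq t)⁻¹) x)
      ≤ C * partitionFn b (densityMeasure pH)
        (natParam b (aCoef t) (fun _ => (sigmaSq t)⁻¹) x)) :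
    MixtureRep pH b (densityMeasure pH) (fun t _ => (sigmaSq t)⁻¹)
      (fun t => (2 * Real.pi * sigmaSq t) ^ (-(n : ℝ) / 2)) s T where
  pos t ht _ := inv_pos.2 (sigmaSq_pos (hs.trans_le ht.1))
  continuousOn_precision := continuousOn_pi.2 fun _ => continuous_sigmaSq.continuousOn.inv₀
    fun _ ht => (sigmaSq_pos (hs.trans_le ht.1)).ne'
  const_pos t ht := by
    have := sigmaSq_pos (hs.trans_le ht.1)
    positivity
  continuousOn_const := (continuous_const.mul continuous_sigmaSq).continuousOn.rpow_const
    fun t ht => Or.inl (mul_pos (by positivity) (sigmaSq_pos (hs.trans_le ht.1))).ne'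
  density_eq t ht x := vpDensity_eq_iso b hpdf (hs.trans_le ht.1) x
  variance_le := hvar

/-- The score and the velocity at positive times. -/
theorem vpVelocity_eq_iso (b : OrthonormalBasis (Fin n) ℝ (E n)) {pH : E n → ℝ}
    (hpdf : IsPdf pH) {t : ℝ} (ht : 0 < t) :
    vpVelocity pH t
      = famVelocity b (densityMeasure pH) (aCoef t) (fun _ => (sigmaSq t)⁻¹) := by
  have := hpdf.isProbabilityMeasure
  have hσ := sigmaSq_pos ht
  funext x
  have h := hasGradientAt_log_mixture b (μ := densityMeasure pH) (aCoef_pos t)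
    (l := fun _ => (sigmaSq t)⁻¹) (fun _ => inv_pos.2 hσ)
    (c := (2 * Real.pi * sigmaSq t) ^ (-(n : ℝ) / 2)) (by positivity) x
  simp only [← vpDensity_eq_iso b hpdf ht] at h
  rw [vpVelocity, vpScore, h.gradient, famVelocity]

theorem trace_famVelocityDeriv_iso (b : OrthonormalBasis (Fin n) ℝ (E n)) {μ : Measure (E n)}
    [IsFiniteMeasure μ] [NeZero μ] {a : ℝ} (ha : 0 < a) {l : ℝ} (hl : 0 < l) (x : E n) :
    LinearMap.trace ℝ (E n) (famVelocityDeriv b μ a (fun _ => l) x)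
      = -(n : ℝ) / 2 + n * l / 2 - a ^ 2 * l ^ 2 / 2 *
        ((partitionFn b μ (natParam b a (fun _ => l) x))⁻¹
            * famSq b μ 0 (natParam b a (fun _ => l) x)
          - ‖famMean b μ (natParam b a (fun _ => l) x)‖ ^ 2) := by
  rw [LinearMap.trace_eq_sum_inner _ b,
    ← sum_inner_fderiv_famMean b (natParam_snd_pos b ha (fun _ => hl) x)]
  have e : ∀ i, ⟪b i, ((famVelocityDeriv b μ a (fun _ => l) x : E n →L[ℝ] E n) :
      E n →ₗ[ℝ] E n) (b i)⟫ = -1 / 2 + l / 2 - a ^ 2 * l ^ 2 / 2 *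
        ⟪b i, fderiv ℝ (famMean b μ) (natParam b a (fun _ => l) x) (b i, 0)⟫ := by
    intro i
    have h1 : ((famVelocityDeriv b μ a (fun _ => l) x : E n →L[ℝ] E n) : E n →ₗ[ℝ] E n) (b i)
        = -((1 / 2 : ℝ) • b i) - (1 / 2 : ℝ) • (a • diagOp b (fun _ => l)
          (fderiv ℝ (famMean b μ) (natParam b a (fun _ => l) x)
            (a • diagOp b (fun _ => l) (b i), 0)) - diagOp b (fun _ => l) (b i)) := rfl
    have h2 : ((a • l • b i, 0) : E n × (Fin n → ℝ)) = (a * l) • (b i, 0) := by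
      simp [smul_smul]
    rw [h1]
    simp only [diagOp_const, h2, map_smul, inner_sub_right, inner_neg_right,
      real_inner_smul_right, real_inner_self_eq_norm_sq, b.norm_eq_one]
    ring
  simp only [e, Finset.sum_sub_distrib, Finset.sum_const, Finset.card_univ, Fintype.card_fin,
    ← Finset.mul_sum, nsmul_eq_mul]
  ring

/-- **Continuity equation** along the characteristics of the probability flow. -/
theorem hasDerivAt_vpDensity_along {pH : E n → ℝ} (hpdf : IsPdf pH) {t : ℝ} (ht : 0 < t)
    {γ : ℝ → E n} (hγ : HasDerivAt γ (vpVelocity pH t (γ t)) t) :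
    HasDerivAt (fun r => vpDensity pH r (γ r)) (-(vpDensity pH t (γ t) *
      LinearMap.trace ℝ (E n) (fderiv ℝ (vpVelocity pH t) (γ t) : E n →L[ℝ] E n))) t := by
  have := hpdf.isProbabilityMeasure
  set b := EuclideanSpace.basisFun (Fin n) ℝ
  -- At positive times the isotropic representation with mixing law `p_H` is valid for every
  -- density. It needs no variance bound, so this computation serves all four classes.
  set μ := densityMeasure pH
  have hσ := sigmaSq_pos ht
  have hv := vpVelocity_eq_iso b hpdf ht
  have hB : 0 < (sigmaSq t)⁻¹ := inv_pos.2 hσ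
  -- The relation `σ² = 1 - a²`, in the form in which it closes the computation.
  have hrel : (sigmaSq t)⁻¹ * (1 - aCoef t ^ 2) = 1 := by
    rw [← sigmaSq_eq, inv_mul_cancel₀ hσ.ne']
  rw [hv] at hγ ⊢
  rw [(hasFDerivAt_famVelocity b (μ := μ) (aCoef_pos t) (l := fun _ => (sigmaSq t)⁻¹)
    (fun _ => hB) (γ t)).fderiv, trace_famVelocityDeriv_iso b (aCoef_pos t) hB]
  have hθ := natParam_snd_pos b (aCoef_pos t) (l := fun _ => (sigmaSq t)⁻¹) (fun _ => hB) (γ t)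
  have hθt : natParam b (aCoef t) (fun _ => (sigmaSq t)⁻¹) (γ t)
      = ((aCoef t * (sigmaSq t)⁻¹) • γ t, fun _ => aCoef t ^ 2 * (sigmaSq t)⁻¹ / 2) := by
    rw [natParam, diagOp_const, smul_smul]
  have hveq : famVelocity b μ (aCoef t) (fun _ => (sigmaSq t)⁻¹) (γ t)
      = -((1 / 2 : ℝ) • γ t) - (1 / 2 : ℝ) • ((aCoef t * (sigmaSq t)⁻¹) •
        famMean b μ (natParam b (aCoef t) (fun _ => (sigmaSq t)⁻¹) (γ t))
          - (sigmaSq t)⁻¹ • γ t) := by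
    rw [famVelocity, diagOp_const, diagOp_const, smul_smul]
  set V := famVelocity b μ (aCoef t) (fun _ => (sigmaSq t)⁻¹) (γ t) with hV
  -- The density along the curve as normalising constant times Gaussian in position times partition
  -- function; each factor is differentiated separately.
  have hdens : (fun r => vpDensity pH r (γ r)) =ᶠ[𝓝 t] fun r =>
      (2 * Real.pi * sigmaSq r) ^ (-(n : ℝ) / 2) * (Real.exp (-((sigmaSq r)⁻¹ * ‖γ r‖ ^ 2) / 2) *
        partitionFn b μ ((aCoef r * (sigmaSq r)⁻¹) • γ r,
          fun _ => aCoef r ^ 2 * (sigmaSq r)⁻¹ / 2)) := by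
    filter_upwards [lt_mem_nhds ht] with r hr
    rw [vpDensity_eq_iso b hpdf hr, integral_gaussKernel_sub_smul, gaussKernel_const, natParam,
      diagOp_const, smul_smul]
  set A := aCoef t with hA
  set B := (sigmaSq t)⁻¹ with hBdef
  set θ := natParam b A (fun _ => B) (γ t) with hθdef
  set w := famMean b μ θ with hw
  set M := partitionFn b μ θ with hMdef
  set S := famSq b μ 0 θ with hSdef
  have hMpos : 0 < M := partitionFn_pos b (μ := μ) hθ
  have hσB : sigmaSq t = B⁻¹ := (inv_inv _).symm
  have hS : ∀ k : ℝ, ∫ y, Real.exp (quadStat b y θ) * ∑ i, k * ⟪b i, y⟫ ^ 2 ∂μ = k * S := by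
    intro k
    simp only [hSdef, famSq, laplace, sub_zero, smul_eq_mul, ← Finset.mul_sum, sum_inner_sq_eq]
    rw [← integral_const_mul]
    exact integral_congr_ae (Eventually.of_forall fun y => by ring)
  have ha : HasDerivAt aCoef (-(1 / 2) * A) t := hasDerivAt_aCoef t
  have hs : HasDerivAt sigmaSq (A ^ 2) t := hasDerivAt_sigmaSq t
  have hBd : HasDerivAt (fun r => (sigmaSq r)⁻¹) (-(A ^ 2 * B ^ 2)) t :=
    (hs.fun_inv hσ.ne').congr_deriv (by rw [hσB]; field_simp)
  have hc : HasDerivAt (fun r => (2 * Real.pi * sigmaSq r) ^ (-(n : ℝ) / 2))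
      ((2 * Real.pi * sigmaSq t) ^ (-(n : ℝ) / 2) * (-(n : ℝ) / 2 * (A ^ 2 * B))) t := by
    refine ((hs.const_mul (2 * Real.pi)).rpow_const (p := -(n : ℝ) / 2)
      (Or.inl (by positivity : 2 * Real.pi * sigmaSq t ≠ 0))).congr_deriv ?_
    rw [Real.rpow_sub_one (by positivity), hσB]
    field_simp
  have hg : HasDerivAt (fun r => Real.exp (-((sigmaSq r)⁻¹ * ‖γ r‖ ^ 2) / 2))
      (Real.exp (-(B * ‖γ t‖ ^ 2) / 2) *
        (-(-(A ^ 2 * B ^ 2) * ‖γ t‖ ^ 2 + B * (2 * ⟪γ t, V⟫)) / 2)) t :=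
    (((hBd.mul hγ.norm_sq).neg).div_const 2).exp
  have hξ : HasDerivAt (fun r => (aCoef r * (sigmaSq r)⁻¹) • γ r)
      ((A * B) • V + (-(1 / 2) * A * B + A * (-(A ^ 2 * B ^ 2))) • γ t) t :=
    (ha.mul hBd).smul hγ
  have hs2 : HasDerivAt (fun r => (fun _ : Fin n => aCoef r ^ 2 * (sigmaSq r)⁻¹ / 2))
      (fun _ => (-A ^ 2 * B + A ^ 2 * (-(A ^ 2 * B ^ 2))) / 2) t :=
    hasDerivAt_pi.2 fun _ => (((ha.pow 2).mul hBd).div_const 2).congr_deriv (by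
      simp only [Pi.pow_apply, ← hA, ← hBdef]; push_cast; ring)
  have hpart := hasFDerivAt_partitionFn b (μ := μ) hθ
  have hM : HasDerivAt (fun r => partitionFn b μ ((aCoef r * (sigmaSq r)⁻¹) • γ r,
      fun _ => aCoef r ^ 2 * (sigmaSq r)⁻¹ / 2))
      (M * ⟪w, (A * B) • V + (-(1 / 2) * A * B + A * (-(A ^ 2 * B ^ 2))) • γ t⟫
        - (-A ^ 2 * B + A ^ 2 * (-(A ^ 2 * B ^ 2))) / 2 * S) t := by
    rw [← hS, ← fderiv_partitionFn_apply b hθ]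
    exact HasFDerivAt.comp_hasDerivAt t (by rw [← hθt]; exact hpart) (hξ.prodMk hs2)
  refine ((hc.mul (hg.mul hM)).congr_of_eventuallyEq hdens).congr_deriv ?_
  have hp := hdens.self_of_nhds
  simp only [← hA, ← hBdef, ← hθt, ← hMdef] at hp ⊢
  simp only [Pi.mul_apply, ← hA, ← hBdef, ← hθt, ← hMdef]
  rw [hp]
  have hSM : S = M * (M⁻¹ * S) := by field_simp
  have hgV : ⟪γ t, V⟫ = -(1 / 2) * ‖γ t‖ ^ 2 - 1 / 2 * (A * B * ⟪w, γ t⟫ - B * ‖γ t‖ ^ 2) := by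
    rw [hveq]
    simp only [inner_sub_right, inner_neg_right, real_inner_smul_right,
      real_inner_self_eq_norm_sq, real_inner_comm w]
    ring
  have hwV : ⟪w, V⟫ = -(1 / 2) * ⟪w, γ t⟫ - 1 / 2 * (A * B * ‖w‖ ^ 2 - B * ⟪w, γ t⟫) := by
    rw [hveq]
    simp only [inner_sub_right, inner_neg_right, real_inner_smul_right,
      real_inner_self_eq_norm_sq]
    ring
  rw [inner_add_right, real_inner_smul_right, real_inner_smul_right, hwV, hgV]
  set S' := M⁻¹ * S
  rw [hSM]
  set C := (2 * Real.pi * sigmaSq t) ^ (-(n : ℝ) / 2)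
  set G := Real.exp (-(B * ‖γ t‖ ^ 2) / 2)
  -- With all inner products against `V` expanded, both sides are polynomial in the remaining
  -- quantities and differ by a multiple of `B (1 - A²) = 1`.
  linear_combination (C * G * M * (-(1 / 2) * B * ‖γ t‖ ^ 2 + A * B * ⟪w, γ t⟫ + n / 2
    - 1 / 2 * A ^ 2 * B * S')) * hrel

end VPFlow

/-! ### The flow map of the probability flow and transport of the marginals -/

namespace VPFlow

open Metric Function Filter Topology ExpFamily InnerProductSpace ODEFlow

variable {n : ℕ}

theorem MixtureRep.exists_flow_map {pH : E n → ℝ} {b : OrthonormalBasis (Fin n) ℝ (E n)}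
    {μ : Measure (E n)} [IsFiniteMeasure μ] [NeZero μ] {l : ℝ → Fin n → ℝ} {c : ℝ → ℝ} {s T : ℝ}
    (h : MixtureRep pH b μ l c s T) (hpdf : IsPdf pH) (hs : 0 ≤ s) (hsT : s < T) :
    ∃ φ : E n ≃ E n, IsSolutionMap (vpVelocity pH) s T φ ∧ IsBiLipschitzDiffeo φ ∧
      ∃ φ' : E n → E n →L[ℝ] E n, (∀ x, HasFDerivAt φ (φ' x) x) ∧
        ∀ x, |(φ' x).det| * vpDensity pH T (φ x) = vpDensity pH s x := by
  obtain ⟨K, hK⟩ := h.exists_isC1Field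
  obtain ⟨φ, hsol, hφ, hφs, hL, hLs, hJac⟩ := hK.exists_flow hsT.le
  choose γ J hγ0 hγT hγ hJ0 hJ hJT using hJac
  refine ⟨φ, hsol, ⟨hφ, hφs, hL, hLs⟩, fun x => J x T, hJT, fun x => ?_⟩
  have hcont : ContinuousOn (fun t => vpDensity pH t (γ x t)) (Icc s T) :=
    h.continuousOn_density.comp (f := fun t => (t, γ x t))
      (continuousOn_id.prodMk (hγ x).continuousOn) fun t ht => ⟨ht, trivial⟩
  have key := mul_det_eq_of_hasDerivAt_along hsT (hJ0 x) (hJ x) (q := vpDensity pH) hcont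
    fun t ht => hasDerivAt_vpDensity_along hpdf (hs.trans_lt ht.1)
      ((hγ x t (Ioo_subset_Icc_self ht)).hasDerivAt (Icc_mem_nhds ht.1 ht.2))
  rw [hγ0, hγT] at key
  have hpos := h.density_pos ⟨le_rfl, hsT.le⟩ x
  have hposT := h.density_pos ⟨hsT.le, le_rfl⟩ (φ x)
  -- The densities at both ends are positive and `p_T(φ x)` times the determinant equals `p_s(x)`;
  -- this fixes the sign and removes the absolute value.
  have hdet : 0 < (J x T).det := by
    rw [← key] at hpos
    exact (pos_iff_pos_of_mul_pos hpos).1 hposT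
  rw [abs_of_pos hdet, mul_comm, key]

/-! ### Bounds for the posterior variance -/

theorem famSq_zero_le_of_norm_le (b : OrthonormalBasis (Fin n) ℝ (E n)) {μ : Measure (E n)}
    [IsFiniteMeasure μ] {R : ℝ} (hR : ∀ᵐ y ∂μ, ‖y‖ ≤ R) {θ : Param n} (hθ : ∀ i, 0 < θ.2 i) :
    famSq b μ 0 θ ≤ R ^ 2 * partitionFn b μ θ := by
  simp only [famSq, partitionFn, laplace, smul_eq_mul, mul_one]
  rw [← integral_const_mul]
  refine integral_mono_ae (integrable_exp_mul_norm_sub_sq b hθ 0)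
    ((integrable_exp_quadStat b hθ).const_mul _) ?_
  filter_upwards [hR] with y hy
  rw [sub_zero, mul_comm]
  exact mul_le_mul_of_nonneg_right (pow_le_pow_left₀ (norm_nonneg _) hy 2) (Real.exp_pos _).le

/-- Integrate the hypothesis: dilating by `1 / 2` about `z` multiplies the mass by `2 ^ n`, and the
excess over the original mass controls the second moment about `z`. -/
theorem integral_norm_sub_sq_mul_le {f : E n → ℝ} {z : E n} {κ : ℝ} (hf : Integrable f)
    (hf2 : Integrable fun y => ‖y - z‖ ^ 2 * f y)
    (h : ∀ u, (1 + κ * ‖u‖ ^ 2) * f (z + u) ≤ f (z + (1 / 2 : ℝ) • u)) :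
    κ * ∫ y, ‖y - z‖ ^ 2 * f y ≤ (2 ^ n - 1) * ∫ y, f y := by
  have h1 : Integrable (fun u => f (z + u)) := hf.comp_add_left z
  have h2 : Integrable (fun u => ‖u‖ ^ 2 * f (z + u)) := by
    simpa using hf2.comp_add_left z
  have h3 : Integrable (fun u => f (z + (1 / 2 : ℝ) • u)) := by
    have := h1.comp_smul (R := (1 / 2 : ℝ)) (by norm_num)
    exact this
  have hmono := integral_mono (h1.add (h2.const_mul κ)) h3 fun u => by
    have := h u
    simp only [Pi.add_apply]
    linarith
  have e1 : ∫ u, f (z + u) = ∫ y, f y := integral_add_left_eq_self f z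
  have e2 : ∫ u, ‖u‖ ^ 2 * f (z + u) = ∫ y, ‖y - z‖ ^ 2 * f y := by
    have := integral_add_left_eq_self (μ := (volume : Measure (E n)))
      (fun y => ‖y - z‖ ^ 2 * f y) z
    simpa using this
  have e3 : ∫ u, f (z + (1 / 2 : ℝ) • u) = 2 ^ n * ∫ y, f y := by
    have := Measure.integral_comp_smul (volume : Measure (E n)) (fun u => f (z + u)) (1 / 2 : ℝ)
    rw [this, e1]
    simp
  have e4 : ∫ u, ((fun u => f (z + u)) + fun u => κ * (‖u‖ ^ 2 * f (z + u))) u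
      = (∫ y, f y) + κ * ∫ y, ‖y - z‖ ^ 2 * f y := by
    simp only [Pi.add_apply]
    rw [integral_add h1 (h2.const_mul κ), integral_const_mul, e1, e2]
  rw [e4, e3] at hmono
  linarith

theorem convexOn_line_of_fderiv_fderiv_nonneg {V : E n → ℝ} (hV : ContDiff ℝ 2 V)
    (hess : ∀ x v, 0 ≤ fderiv ℝ (fderiv ℝ V) x v v) (x u : E n) :
    ConvexOn ℝ univ (fun τ : ℝ => V (x + τ • u)) ∧
      ∀ τ, HasDerivAt (fun τ : ℝ => V (x + τ • u)) (fderiv ℝ V (x + τ • u) u) τ := by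
  have hline : ∀ τ : ℝ, HasDerivAt (fun τ : ℝ => x + τ • u) u τ := fun τ => by
    simpa using ((hasDerivAt_id τ).smul_const u).const_add x
  have hd1 : ∀ τ : ℝ, HasDerivAt (fun τ : ℝ => V (x + τ • u)) (fderiv ℝ V (x + τ • u) u) τ :=
    fun τ => ((hV.differentiable (by norm_num)) _).hasFDerivAt.comp_hasDerivAt τ (hline τ)
  have hV1 : ContDiff ℝ 1 (fderiv ℝ V) := hV.fderiv_right (by norm_num)
  have hd2 : ∀ τ : ℝ, HasDerivAt (fun τ : ℝ => fderiv ℝ V (x + τ • u) u)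
      (fderiv ℝ (fderiv ℝ V) (x + τ • u) u u) τ := fun τ => by
    have := (((hV1.differentiable (by norm_num)) _).hasFDerivAt.comp_hasDerivAt τ
      (hline τ)).clm_apply (hasDerivAt_const τ u)
    simpa using this
  have hderiv : deriv (fun τ : ℝ => V (x + τ • u)) = fun τ => fderiv ℝ V (x + τ • u) u :=
    funext fun τ => (hd1 τ).deriv
  refine ⟨?_, hd1⟩
  refine convexOn_univ_of_deriv2_nonneg (fun τ => (hd1 τ).differentiableAt) ?_ fun τ => ?_
  · rw [hderiv]; exact fun τ => (hd2 τ).differentiableAt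
  · rw [Function.iterate_succ, Function.iterate_one, Function.comp_apply, hderiv, (hd2 τ).deriv]
    exact hess _ _

/-- Along each ray the tangent at `0` bounds `V` below linearly; the quadratic term then forces
growth at infinity. -/
theorem exists_min_convex_add_quadratic {V : E n → ℝ} (hV : ContDiff ℝ 2 V)
    (hess : ∀ x v, 0 ≤ fderiv ℝ (fderiv ℝ V) x v v) {s : ℝ} (hs : 0 < s) (ξ : E n) :
    ∃ z, ∀ y, V z + s * ‖z‖ ^ 2 - inner ℝ z ξ ≤ V y + s * ‖y‖ ^ 2 - inner ℝ y ξ := by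
  have hVc := hV.continuous
  refine Continuous.exists_forall_le
    (f := fun y : E n => V y + s * ‖y‖ ^ 2 - inner ℝ y ξ) (by fun_prop) ?_
  have hlow : ∀ y, V 0 - (‖fderiv ℝ V 0‖ + ‖ξ‖) * ‖y‖ + s * ‖y‖ ^ 2
      ≤ V y + s * ‖y‖ ^ 2 - inner ℝ y ξ := fun y => by
    obtain ⟨hc, hd⟩ := convexOn_line_of_fderiv_fderiv_nonneg hV hess 0 y
    have h1 := hc.deriv_le_slope (mem_univ (0 : ℝ)) (mem_univ (1 : ℝ)) one_pos
      (hd 0).differentiableAt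
    rw [(hd 0).deriv] at h1
    simp [slope_def_field] at h1
    have h2 := (abs_le.1 ((fderiv ℝ V 0).le_opNorm y)).1
    have h3 := real_inner_le_norm y ξ
    nlinarith
  refine tendsto_atTop_mono hlow ?_
  set k := ‖fderiv ℝ V 0‖ + ‖ξ‖
  have hnorm := tendsto_norm_cocompact_atTop (E := E n)
  have hfac : ∀ y : E n, V 0 - k * ‖y‖ + s * ‖y‖ ^ 2 = V 0 + ‖y‖ * (s * ‖y‖ + -k) :=
    fun y => by ring
  simp only [hfac]
  exact tendsto_atTop_add_const_left _ _ (hnorm.atTop_mul_atTop₀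
    (tendsto_atTop_add_const_right _ _ (hnorm.const_mul_atTop hs)))

theorem IsPdf.integrable_densityMeasure_iff {p : E n → ℝ} (h : IsPdf p) (f : E n → ℝ) :
    Integrable f (densityMeasure p) ↔ Integrable fun x => p x * f x := by
  rw [densityMeasure, integrable_withDensity_iff_integrable_smul₀' h.aemeasurable_ofReal
    (Eventually.of_forall fun x => ENNReal.ofReal_lt_top)]
  simp only [ENNReal.toReal_ofReal (h.nonneg _), smul_eq_mul]

/-- Posterior variance bound for log-concave densities. -/
theorem IsLogConcaveDensity.exists_famSq_le (b : OrthonormalBasis (Fin n) ℝ (E n)) {p : E n → ℝ}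
    (hpdf : IsPdf p) (hp : IsLogConcaveDensity p) {s : ℝ} (hs : 0 < s) (ξ : E n) :
    ∃ z, famSq b (densityMeasure p) z (ξ, fun _ => s)
      ≤ 4 / s * (2 ^ n - 1) * partitionFn b (densityMeasure p) (ξ, fun _ => s) := by
  obtain ⟨Z, V, hZ, hV, hess, hpV⟩ := hp
  have := hpdf.isProbabilityMeasure
  obtain ⟨z, hz⟩ := exists_min_convex_add_quadratic hV hess hs ξ
  have hθ : ∀ i, 0 < ((ξ, fun _ => s) : Param n).2 i := fun _ => hs
  have hq : ∀ y, quadStat b y (ξ, fun _ => s) = inner ℝ y ξ - s * ‖y‖ ^ 2 := fun y => by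
    rw [quadStat_apply, ← Finset.mul_sum, sum_inner_sq_eq]
  set f : E n → ℝ := fun y => p y * Real.exp (quadStat b y (ξ, fun _ => s)) with hfdef
  have hfU : ∀ y, f y = 1 / Z * Real.exp (-(V y + s * ‖y‖ ^ 2 - inner ℝ y ξ)) := fun y => by
    rw [hfdef]
    simp only [hpV, hq, mul_assoc, ← Real.exp_add]
    congr 2; ring
  have hf : Integrable f :=
    (hpdf.integrable_densityMeasure_iff _).1 (integrable_exp_quadStat b hθ)
  have e2 : ∀ y, p y * (Real.exp (quadStat b y (ξ, fun _ => s)) * ‖y - z‖ ^ 2)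
      = ‖y - z‖ ^ 2 * f y := fun y => by rw [hfdef]; ring
  have hf2 : Integrable fun y => ‖y - z‖ ^ 2 * f y := by
    have := (hpdf.integrable_densityMeasure_iff _).1 (integrable_exp_mul_norm_sub_sq b hθ z)
    simpa only [e2] using this
  -- Put `U y = V y + s ‖y‖² - ⟪y, ξ⟫`, minimal at `z`. Midpoint strong convexity gives `U(z + u /
  -- 2) ≤ U(z + u) - (s / 4) ‖u‖²`, and `1 + r ≤ exp r` yields the required comparison with `κ = s /
  -- 4`.
  have key := integral_norm_sub_sq_mul_le (κ := s / 4) hf hf2 fun u => by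
    rw [hfU, hfU, mul_left_comm]
    refine mul_le_mul_of_nonneg_left ?_ (by positivity)
    have hconv := (convexOn_line_of_fderiv_fderiv_nonneg hV hess z u).1.2 (mem_univ (0 : ℝ))
      (mem_univ (1 : ℝ)) (by norm_num : (0 : ℝ) ≤ 1 / 2) (by norm_num : (0 : ℝ) ≤ 1 / 2)
      (by norm_num)
    simp only [smul_eq_mul, mul_zero, mul_one, zero_add, zero_smul, add_zero, one_smul] at hconv
    have hmin := hz (z + u)
    have e3 : ‖z + (1 / 2 : ℝ) • u‖ ^ 2 = 1 / 2 * ‖z‖ ^ 2 + 1 / 2 * ‖z + u‖ ^ 2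
        - 1 / 4 * ‖u‖ ^ 2 := by
      rw [norm_add_sq_real, norm_add_sq_real, norm_smul, real_inner_smul_right,
        Real.norm_of_nonneg (by norm_num)]
      ring
    have e4 : inner ℝ (z + (1 / 2 : ℝ) • u) ξ
        = 1 / 2 * inner ℝ z ξ + 1 / 2 * inner ℝ (z + u) ξ := by
      rw [inner_add_left, inner_add_left, real_inner_smul_left]; ring
    calc (1 + s / 4 * ‖u‖ ^ 2) * Real.exp (-(V (z + u) + s * ‖z + u‖ ^ 2 - inner ℝ (z + u) ξ))
        ≤ Real.exp (s / 4 * ‖u‖ ^ 2)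
          * Real.exp (-(V (z + u) + s * ‖z + u‖ ^ 2 - inner ℝ (z + u) ξ)) := by
          refine mul_le_mul_of_nonneg_right ?_ (Real.exp_pos _).le
          linarith [Real.add_one_le_exp (s / 4 * ‖u‖ ^ 2)]
      _ ≤ _ := by
          rw [← Real.exp_add, Real.exp_le_exp, e3, e4]
          linarith
  refine ⟨z, ?_⟩
  simp only [famSq, partitionFn, laplace, smul_eq_mul, mul_one, hpdf.integral_densityMeasure, e2]
  change _ ≤ 4 / s * (2 ^ n - 1) * ∫ y, f y
  rw [div_mul_eq_mul_div, div_mul_eq_mul_div, le_div_iff₀ hs]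
  linarith

end VPFlow

/-! ### Gaussian integrals and mixture representations of the four classes -/

namespace VPFlow

open Metric Function Filter Topology ExpFamily InnerProductSpace ODEFlow

variable {n : ℕ}

local notation "⟪" x ", " y "⟫" => inner ℝ x y

section GaussIntegrals

variable (b : OrthonormalBasis (Fin n) ℝ (E n))

theorem gaussKernel_eq_prod (l : Fin n → ℝ) (z : E n) :
    gaussKernel b l z = ∏ i, Real.exp (-(l i / 2) * (b.repr z).ofLp i ^ 2) := by
  rw [gaussKernel, ← Real.exp_sum]
  congr 1
  rw [← Finset.sum_neg_distrib, Finset.sum_div]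
  refine Finset.sum_congr rfl fun i _ => ?_
  rw [b.repr_apply_apply]
  ring

theorem measurePreserving_ofLp_repr :
    MeasurePreserving (fun z : E n => (b.repr z).ofLp) volume volume :=
  (PiLp.volume_preserving_ofLp (Fin n)).comp b.measurePreserving_repr

theorem integrable_gaussKernel {l : Fin n → ℝ} (hl : ∀ i, 0 < l i) :
    Integrable (gaussKernel b l) := by
  have h := Integrable.fintype_prod (μ := fun _ : Fin n => (volume : Measure ℝ))
    (f := fun i (v : ℝ) => Real.exp (-(l i / 2) * v ^ 2))
    fun i => integrable_exp_neg_mul_sq (half_pos (hl i))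
  have := (measurePreserving_ofLp_repr b).integrable_comp_of_integrable h
  exact this.congr (Eventually.of_forall fun z => (gaussKernel_eq_prod b l z).symm)

theorem integral_gaussKernel (l : Fin n → ℝ) :
    ∫ z, gaussKernel b l z = ∏ i, Real.sqrt (2 * Real.pi / l i) := by
  have h := integral_fintype_prod_volume_eq_prod
    (fun i (v : ℝ) => Real.exp (-(l i / 2) * v ^ 2)) (ι := Fin n)
  have hmp := measurePreserving_ofLp_repr b
  rw [← hmp.map_eq, integral_map hmp.measurable.aemeasurable] at h
  · simp only [gaussKernel_eq_prod]
    rw [h]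
    refine Finset.prod_congr rfl fun i _ => ?_
    rw [integral_gaussian]
    congr 1
    rw [div_div_eq_mul_div, mul_comm]
  · exact Continuous.aestronglyMeasurable (by fun_prop)

theorem integral_gaussKernel_pos {l : Fin n → ℝ} (hl : ∀ i, 0 < l i) :
    0 < ∫ z, gaussKernel b l z := by
  rw [integral_gaussKernel]
  exact Finset.prod_pos fun i _ => Real.sqrt_pos.2 (div_pos (by positivity) (hl i))

theorem continuous_gaussKernel (l : Fin n → ℝ) : Continuous (gaussKernel b l) := by
  unfold gaussKernel
  fun_prop

theorem gaussKernel_le_one {l : Fin n → ℝ} (hl : ∀ i, 0 < l i) (z : E n) :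
    gaussKernel b l z ≤ 1 := by
  rw [gaussKernel, Real.exp_le_one_iff, neg_div, neg_nonpos]
  exact div_nonneg (Finset.sum_nonneg fun i _ => mul_nonneg (hl i).le (sq_nonneg _)) (by norm_num)

end GaussIntegrals

theorem continuous_gaussIso (v : ℝ) (m : E n) : Continuous (gaussIso v m) := by
  unfold gaussIso
  fun_prop

theorem gaussIso_pos {v : ℝ} (hv : 0 < v) (m x : E n) : 0 < gaussIso v m x := by
  unfold gaussIso
  positivity

theorem integrable_gaussIso {v : ℝ} (hv : 0 < v) : Integrable (gaussIso v (0 : E n)) := by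
  have h := (integrable_gaussKernel (EuclideanSpace.basisFun (Fin n) ℝ) (l := fun _ => v⁻¹)
    fun _ => inv_pos.2 hv).const_mul ((2 * Real.pi * v) ^ (-(n : ℝ) / 2))
  exact h.congr (Eventually.of_forall fun z => (gaussIso_eq_gaussKernel _ v z).symm)

theorem integral_gaussIso {v : ℝ} (hv : 0 < v) : ∫ x, gaussIso v (0 : E n) x = 1 := by
  simp only [gaussIso_eq_gaussKernel (EuclideanSpace.basisFun (Fin n) ℝ)]
  rw [integral_const_mul, integral_gaussKernel, Finset.prod_const, Finset.card_univ,
    Fintype.card_fin, div_inv_eq_mul, Real.sqrt_eq_rpow, ← Real.rpow_natCast, ← Real.rpow_mul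
    (by positivity), ← Real.rpow_add (by positivity)]
  convert Real.rpow_zero _ using 2
  ring

/-! ### Total mass of Gaussian mixtures by Fubini. -/

section Mixture

variable {μ : Measure (E n)} [IsProbabilityMeasure μ] {k : E n → ℝ}

theorem integrable_mul_mixture_prod {μ : Measure (E n)} [SFinite μ] {u : E n → ℝ}
    (hu : Integrable u μ) (hk : Integrable k) (hkc : Continuous k) (a : ℝ) :
    Integrable (fun p : E n × E n => u p.2 * k (p.1 - a • p.2)) (volume.prod μ) := by
  have hc : Continuous fun p : E n × E n => k (p.1 - a • p.2) :=
    hkc.comp (continuous_fst.sub (continuous_snd.const_smul a))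
  refine (integrable_prod_iff' (hu.aestronglyMeasurable.comp_snd.mul
    hc.aestronglyMeasurable)).2 ⟨Eventually.of_forall fun y => ?_, ?_⟩
  · exact (hk.comp_sub_right (a • y)).const_mul (u y)
  · have : ∀ y, ∫ x, ‖u y * k (x - a • y)‖ = ‖u y‖ * ∫ x, ‖k x‖ := fun y => by
      simp only [norm_mul]
      rw [integral_const_mul, integral_sub_right_eq_self (fun x => ‖k x‖) (a • y)]
    exact (hu.norm.mul_const _).congr (Eventually.of_forall fun y => (this y).symm)

theorem integrable_mixture_prod (hk : Integrable k) (hkc : Continuous k) (a : ℝ) :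
    Integrable (fun p : E n × E n => k (p.1 - a • p.2)) (volume.prod μ) := by
  simpa only [one_mul] using
    integrable_mul_mixture_prod (integrable_const (1 : ℝ)) (μ := μ) hk hkc a

theorem integral_integral_mixture (hk : Integrable k) (hkc : Continuous k) (a : ℝ) :
    ∫ x, ∫ y, k (x - a • y) ∂μ = ∫ x, k x := by
  rw [integral_integral_swap (integrable_mixture_prod hk hkc a)]
  have : ∀ y, ∫ x, k (x - a • y) = ∫ x, k x := fun y => integral_sub_right_eq_self k (a • y)
  simp only [this]
  simp

theorem isPdf_mixture (hk : Integrable k) (hkc : Continuous k) (hk0 : ∀ x, 0 ≤ k x)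
    (hk1 : ∫ x, k x = 1) (a : ℝ) : IsPdf fun x => ∫ y, k (x - a • y) ∂μ :=
  ⟨fun _ => integral_nonneg fun _ => hk0 _, (integrable_mixture_prod hk hkc a).integral_prod_left,
    (integral_integral_mixture hk hkc a).trans hk1⟩

end Mixture

theorem vpDensity_eq_mixture {pH : E n → ℝ} (hpdf : IsPdf pH) {t : ℝ} (ht : 0 < t) :
    vpDensity pH t
      = fun x => ∫ y, gaussIso (sigmaSq t) 0 (x - aCoef t • y) ∂densityMeasure pH := by
  funext x
  rw [vpDensity, if_neg ht.ne', hpdf.integral_densityMeasure]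
  rfl

theorem IsPdf.vpDensity {pH : E n → ℝ} (hpdf : IsPdf pH) {t : ℝ} (ht : 0 ≤ t) :
    IsPdf (vpDensity pH t) := by
  rcases ht.eq_or_lt with rfl | ht
  · have : VPFlow.vpDensity pH 0 = pH := by funext x; simp [VPFlow.vpDensity]
    rwa [this]
  · have := hpdf.isProbabilityMeasure
    have hσ := sigmaSq_pos ht
    rw [vpDensity_eq_mixture hpdf ht]
    exact isPdf_mixture (integrable_gaussIso hσ) (continuous_gaussIso _ _)
      (fun x => (gaussIso_pos hσ _ _).le) (integral_gaussIso hσ) _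

theorem MixtureRep.mono {pH : E n → ℝ} {b : OrthonormalBasis (Fin n) ℝ (E n)}
    {μ : Measure (E n)} {l : ℝ → Fin n → ℝ} {c : ℝ → ℝ} {s T s' T' : ℝ}
    (h : MixtureRep pH b μ l c s T) (hsub : Icc s' T' ⊆ Icc s T) :
    MixtureRep pH b μ l c s' T' where
  pos t ht := h.pos t (hsub ht)
  continuousOn_precision := h.continuousOn_precision.mono hsub
  const_pos t ht := h.const_pos t (hsub ht)
  continuousOn_const := h.continuousOn_const.mono hsub
  density_eq t ht := h.density_eq t (hsub ht)
  variance_le := by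
    obtain ⟨C, hC, hle⟩ := h.variance_le
    exact ⟨C, hC, fun t ht => hle t (hsub ht)⟩

theorem HasCompactSupport.exists_mixtureRep {pH : E n → ℝ} (hpdf : IsPdf pH)
    (hc : HasCompactSupport pH) (b : OrthonormalBasis (Fin n) ℝ (E n)) {s T : ℝ} (hs : 0 < s) :
    MixtureRep pH b (densityMeasure pH) (fun t _ => (sigmaSq t)⁻¹)
      (fun t => (2 * Real.pi * sigmaSq t) ^ (-(n : ℝ) / 2)) s T := by
  have := hpdf.isProbabilityMeasure
  obtain ⟨R, hR⟩ := hc.isCompact.isBounded.exists_norm_le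
  have hae : ∀ᵐ y ∂densityMeasure pH, ‖y‖ ≤ R := by
    rw [densityMeasure, ae_withDensity_iff' hpdf.aemeasurable_ofReal]
    refine Eventually.of_forall fun y hy => hR y (subset_tsupport _ fun h0 => hy ?_)
    rw [h0, ENNReal.ofReal_zero]
  exact mixtureRep_iso b hpdf hs ⟨R ^ 2, sq_nonneg R, fun t ht x => ⟨0,
    famSq_zero_le_of_norm_le b hae (natParam_snd_pos b (aCoef_pos t)
      (fun _ => inv_pos.2 (sigmaSq_pos (hs.trans_le ht.1))) x)⟩⟩

theorem IsLogConcaveDensity.mixtureRep {pH : E n → ℝ} (hpdf : IsPdf pH)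
    (hp : IsLogConcaveDensity pH) (b : OrthonormalBasis (Fin n) ℝ (E n)) {s T : ℝ} (hs : 0 < s) :
    MixtureRep pH b (densityMeasure pH) (fun t _ => (sigmaSq t)⁻¹)
      (fun t => (2 * Real.pi * sigmaSq t) ^ (-(n : ℝ) / 2)) s T := by
  have := hpdf.isProbabilityMeasure
  have h2n : (0 : ℝ) ≤ 2 ^ n - 1 := sub_nonneg.2 (one_le_pow₀ (by norm_num))
  -- The posterior weight is `s = a² / (2σ²)`, so `4 / s = 8 σ² / a²`. This is at most `8 / a(T)²`,
  -- because `σ² ≤ 1` and `a` decreases.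
  refine mixtureRep_iso b hpdf hs ⟨8 / aCoef T ^ 2 * (2 ^ n - 1), by positivity, fun t ht x => ?_⟩
  have hσ := sigmaSq_pos (hs.trans_le ht.1)
  have ha := aCoef_pos t
  have haT := aCoef_pos T
  obtain ⟨z, hz⟩ := hp.exists_famSq_le b hpdf (s := aCoef t ^ 2 * (sigmaSq t)⁻¹ / 2)
    (by positivity) (aCoef t • diagOp b (fun _ => (sigmaSq t)⁻¹) x)
  refine ⟨z, hz.trans ?_⟩
  have hM := partitionFn_pos b (μ := densityMeasure pH) (natParam_snd_pos b (aCoef_pos t)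
    (l := fun _ => (sigmaSq t)⁻¹) (fun _ => inv_pos.2 hσ) x)
  refine mul_le_mul_of_nonneg_right (mul_le_mul_of_nonneg_right ?_ h2n) hM.le
  have h1 : aCoef T ^ 2 ≤ aCoef t ^ 2 := by
    rw [aCoef_sq, aCoef_sq]; exact Real.exp_le_exp.2 (neg_le_neg ht.2)
  have h2 : sigmaSq t ≤ 1 := by rw [sigmaSq_eq]; nlinarith
  have h3 : 1 ≤ (sigmaSq t)⁻¹ := (one_le_inv₀ hσ).2 h2
  rw [div_le_div_iff₀ (by positivity) (by positivity)]
  nlinarith [mul_le_mul h1 h3 zero_le_one (by positivity)]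

/-! ### Convolutions with an anisotropic Gaussian, down to time zero. -/

section GaussianConvolution

/-- Bayes' rule for Gaussians, by completing the square in each coordinate: prior precision `k i`
and observation precision `B` give posterior precision `k i + a² B` and marginal precision `B k i /
(k i + a² B)`. -/
theorem gaussKernel_mul_gaussKernel (b : OrthonormalBasis (Fin n) ℝ (E n)) {k : Fin n → ℝ}
    (hk : ∀ i, 0 < k i) {B : ℝ} (hB : 0 < B) (a : ℝ) (z w : E n) :
    gaussKernel b k w * gaussKernel b (fun _ => B) (z - a • w)
      = gaussKernel b (fun i => B * k i / (k i + a ^ 2 * B)) z *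
        gaussKernel b (fun i => k i + a ^ 2 * B)
          (w - diagOp b (fun i => a * B / (k i + a ^ 2 * B)) z) := by
  have hcoord : ∀ i, ⟪b i, diagOp b (fun i => a * B / (k i + a ^ 2 * B)) z⟫
      = a * B / (k i + a ^ 2 * B) * ⟪b i, z⟫ := fun i => by
    rw [inner_diagOp, Finset.sum_eq_single i]
    · rw [real_inner_self_eq_norm_sq, b.norm_eq_one]; ring
    · intro j _ hj
      rw [b.orthonormal.2 hj, mul_zero]
    · simp
  simp only [gaussKernel, ← Real.exp_add, ← add_div, ← neg_add, inner_sub_right,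
    real_inner_smul_right, hcoord, ← Finset.sum_add_distrib]
  congr 3
  refine Finset.sum_congr rfl fun i _ => ?_
  have hP : (k i + a ^ 2 * B) * (k i + a ^ 2 * B)⁻¹ = 1 :=
    mul_inv_cancel₀ (by have := hk i; positivity)
  simp only [div_eq_mul_inv]
  linear_combination (-B * ⟪b i, z⟫ ^ 2 - B ^ 2 * a ^ 2 * (k i + a ^ 2 * B)⁻¹ * ⟪b i, z⟫ ^ 2
    + 2 * a * B * ⟪b i, z⟫ * ⟪b i, w⟫) * hP

/-- The inverse of `S` is diagonal in the eigenbasis of `S`, with inverse eigenvalues. -/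
theorem dotProduct_inv_mulVec_eq {S : Matrix (Fin n) (Fin n) ℝ} (hS : S.PosDef) (z : E n) :
    z.ofLp ⬝ᵥ (S⁻¹.mulVec z.ofLp)
      = ∑ i, (hS.1.eigenvalues i)⁻¹ * ⟪hS.1.eigenvectorBasis i, z⟫ ^ 2 := by
  set b := hS.1.eigenvectorBasis with hb
  have hdet : IsUnit S.det := hS.det_pos.ne'.isUnit
  have hL : Matrix.toEuclideanCLM (𝕜 := ℝ) S⁻¹ z
      = diagOp b (fun i => (hS.1.eigenvalues i)⁻¹) z := by
    conv_lhs => rw [← b.sum_repr' z]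
    rw [map_sum, diagOp_apply]
    refine Finset.sum_congr rfl fun i _ => ?_
    rw [map_smul, mul_comm, mul_smul]
    congr 1
    apply (WithLp.ofLp_injective 2)
    have h1 := hS.1.mulVec_eigenvectorBasis i
    have h2 : (Matrix.toEuclideanCLM (𝕜 := ℝ) S⁻¹ (b i)).ofLp = S⁻¹.mulVec (b i).ofLp := rfl
    have h3 : (b i).ofLp = (hS.1.eigenvalues i)⁻¹ • S.mulVec (b i).ofLp := by
      rw [hb, h1, inv_smul_smul₀ (hS.eigenvalues_pos i).ne']
    rw [h2]
    conv_lhs => rw [h3]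
    rw [Matrix.mulVec_smul, Matrix.mulVec_mulVec, Matrix.nonsing_inv_mul _ hdet,
      Matrix.one_mulVec]
    rfl
  rw [← Matrix.inner_toEuclideanCLM, hL, inner_diagOp]
  exact Finset.sum_congr rfl fun i _ => by ring

theorem gaussMat_eq_gaussKernel {S : Matrix (Fin n) (Fin n) ℝ} (hS : S.PosDef) (z : E n) :
    gaussMat S 0 z = (Real.sqrt ((2 * Real.pi) ^ n * S.det))⁻¹ *
      gaussKernel hS.1.eigenvectorBasis (fun i => (hS.1.eigenvalues i)⁻¹) z := by
  rw [gaussMat, sub_zero, dotProduct_inv_mulVec_eq hS, gaussKernel]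

/-- Gaussian smoothing of a Gaussian mixture. -/
theorem exists_vpDensity_eq_of_convolution (b : OrthonormalBasis (Fin n) ℝ (E n))
    {μ : Measure (E n)} [IsProbabilityMeasure μ] {d : Fin n → ℝ} (hd : ∀ i, 0 < d i) {K : ℝ}
    {pH : E n → ℝ} (hp : ∀ x, pH x = K * ∫ y, gaussKernel b (fun i => (d i)⁻¹) (x - y) ∂μ)
    {t : ℝ} (ht : 0 ≤ t) :
    ∃ c, ∀ x, vpDensity pH t x = c * ∫ y, gaussKernel b
      (fun i => (aCoef t ^ 2 * d i + sigmaSq t)⁻¹) (x - aCoef t • y) ∂μ := by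
  rcases ht.eq_or_lt with rfl | ht
  · refine ⟨K, fun x => ?_⟩
    simp [vpDensity, hp, aCoef, sigmaSq]
  have hσ := sigmaSq_pos ht
  set a := aCoef t with ha
  set B := (sigmaSq t)⁻¹ with hBdef
  have hB : 0 < B := inv_pos.2 hσ
  set k : Fin n → ℝ := fun i => (d i)⁻¹ with hkdef
  have hk : ∀ i, 0 < k i := fun i => inv_pos.2 (hd i)
  -- The marginal precision rewritten through variances: scaling by `a` and adding noise turns `d i`
  -- into `a² d i + σ²`.
  have hl : (fun i => (a ^ 2 * d i + sigmaSq t)⁻¹) = fun i => B * k i / (k i + a ^ 2 * B) := by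
    funext i
    have := hd i
    simp only [hBdef, hkdef]
    field_simp
    ring
  set C := (2 * Real.pi * sigmaSq t) ^ (-(n : ℝ) / 2)
  refine ⟨C * K * ∫ w, gaussKernel b (fun i => k i + a ^ 2 * B) w, fun x => ?_⟩
  have hint : Integrable (fun p : E n × E n => gaussKernel b k (p.1 - p.2) *
      gaussKernel b (fun _ => B) (x - a • p.1)) (volume.prod μ) := by
    have h := integrable_mixture_prod (μ := μ) (integrable_gaussKernel b hk)
      (continuous_gaussKernel b k) 1
    simp only [one_smul] at h
    have hc := continuous_gaussKernel b (fun _ => B)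
    refine h.mul_bdd (c := 1) (by fun_prop) (Eventually.of_forall fun p => ?_)
    rw [Real.norm_of_nonneg (gaussKernel_pos _ _ _).le]
    exact gaussKernel_le_one b (fun _ => hB) _
  have hinner : ∀ y, ∫ u, gaussKernel b k (u - y) * gaussKernel b (fun _ => B) (x - a • u)
      = gaussKernel b (fun i => B * k i / (k i + a ^ 2 * B)) (x - a • y)
        * ∫ w, gaussKernel b (fun i => k i + a ^ 2 * B) w := fun y => by
    rw [← integral_add_right_eq_self _ y]
    have e : ∀ w, gaussKernel b k (w + y - y) * gaussKernel b (fun _ => B) (x - a • (w + y))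
        = gaussKernel b (fun i => B * k i / (k i + a ^ 2 * B)) (x - a • y) *
          gaussKernel b (fun i => k i + a ^ 2 * B)
            (w - diagOp b (fun i => a * B / (k i + a ^ 2 * B)) (x - a • y)) := fun w => by
      rw [← gaussKernel_mul_gaussKernel b hk hB, add_sub_cancel_right]
      congr 2
      rw [smul_add]; abel
    simp only [e]
    rw [integral_const_mul, integral_sub_right_eq_self (gaussKernel b fun i => k i + a ^ 2 * B)]
  rw [vpDensity, if_neg ht.ne', hl]
  have e1 : ∀ u, pH u * gaussIso (sigmaSq t) 0 (x - a • u) = C * K *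
      ∫ y, gaussKernel b k (u - y) * gaussKernel b (fun _ => B) (x - a • u) ∂μ := fun u => by
    rw [hp, gaussIso_eq_gaussKernel b, integral_mul_const]
    ring
  rw [← ha, integral_congr_ae (Eventually.of_forall e1), integral_const_mul,
    integral_integral_swap hint]
  simp only [hinner]
  rw [integral_mul_const]
  ring

/-- The mixing measure is `μ`, not `p_H`: the precisions then remain finite at `t = 0`, and every
posterior lives on the compact support of `μ`, so its variance is at most `R ^ 2`. -/
theorem IsGaussianConvolution.exists_mixtureRep {pH : E n → ℝ} (hpdf : IsPdf pH)
    (hp : IsGaussianConvolution pH) (T : ℝ) :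
    ∃ (b : OrthonormalBasis (Fin n) ℝ (E n)) (μ : Measure (E n)) (l : ℝ → Fin n → ℝ)
      (c : ℝ → ℝ), IsProbabilityMeasure μ ∧ MixtureRep pH b μ l c 0 T := by
  obtain ⟨S, μ, hS, hμ, hcomp, hpS⟩ := hp
  set b := hS.1.eigenvectorBasis
  set d := hS.1.eigenvalues
  have hd : ∀ i, 0 < d i := hS.eigenvalues_pos
  set l : ℝ → Fin n → ℝ := fun t i => (aCoef t ^ 2 * d i + sigmaSq t)⁻¹ with hl
  have hden : ∀ t, 0 ≤ t → ∀ i, 0 < aCoef t ^ 2 * d i + sigmaSq t := fun t ht i => by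
    have h1 := mul_pos (pow_pos (aCoef_pos t) 2) (hd i)
    rcases ht.eq_or_lt with rfl | ht
    · simpa [sigmaSq] using h1
    · exact add_pos h1 (sigmaSq_pos ht)
  have hlpos : ∀ t, 0 ≤ t → ∀ i, 0 < l t i := fun t ht i => inv_pos.2 (hden t ht i)
  have hlc : ContinuousOn l (Icc 0 T) := continuousOn_pi.2 fun i => by
    refine ContinuousOn.inv₀ ?_ fun t ht => (hden t ht.1 i).ne'
    exact (((continuous_aCoef.pow 2).mul continuous_const).add continuous_sigmaSq).continuousOn
  have hpK : ∀ x, pH x = (Real.sqrt ((2 * Real.pi) ^ n * S.det))⁻¹ *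
      ∫ y, gaussKernel b (fun i => (d i)⁻¹) (x - y) ∂μ := fun x => by
    rw [hpS, ← integral_const_mul]
    exact integral_congr_ae (Eventually.of_forall fun y => gaussMat_eq_gaussKernel hS _)
  obtain ⟨R, hR⟩ := hcomp.isBounded.exists_norm_le
  have hae : ∀ᵐ y ∂μ, ‖y‖ ≤ R := by
    filter_upwards [Measure.support_mem_ae (μ := μ)] with y hy using hR y hy
  refine ⟨b, μ, l, fun t => (∫ z, gaussKernel b (l t) z)⁻¹, hμ, ⟨fun t ht => hlpos t ht.1, hlc,
    fun t ht => inv_pos.2 (integral_gaussKernel_pos b (hlpos t ht.1)), ?_, fun t ht x => ?_,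
    R ^ 2, sq_nonneg R, fun t ht x => ⟨0, famSq_zero_le_of_norm_le b hae
      (natParam_snd_pos b (aCoef_pos t) (hlpos t ht.1) x)⟩⟩⟩
  · refine ContinuousOn.inv₀ ?_ fun t ht => (integral_gaussKernel_pos b (hlpos t ht.1)).ne'
    simp only [integral_gaussKernel]
    refine continuousOn_finsetProd _ fun i _ => Real.continuous_sqrt.comp_continuousOn ?_
    exact _root_.continuousOn_const.div ((continuousOn_pi.1 hlc) i)
      fun t ht => (hlpos t ht.1 i).ne'
  · obtain ⟨c, hc⟩ := exists_vpDensity_eq_of_convolution b hd hpK ht.1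
    -- The prefactor `c` need not be computed: `p_t` has mass one, which forces it to be the inverse
    -- of the kernel integral.
    have h1 := (hpdf.vpDensity ht.1).integral_eq_one
    simp only [hc] at h1
    rw [integral_const_mul, integral_integral_mixture (integrable_gaussKernel b (hlpos t ht.1))
      (continuous_gaussKernel b _)] at h1
    rw [hc, eq_inv_of_mul_eq_one_left h1]

theorem IsGaussianMixture.isGaussianConvolution {p : E n → ℝ} (hp : IsGaussianMixture p) :
    IsGaussianConvolution p := by
  obtain ⟨S, K, α, m, hS, hα, hsum, hpS⟩ := hp
  set μ : Measure (E n) := ∑ k, ENNReal.ofReal (α k) • Measure.dirac (m k) with hμ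
  have hfin : (range m).Finite := finite_range m
  have hprob : IsProbabilityMeasure μ := by
    refine ⟨?_⟩
    rw [hμ, Measure.finsetSum_apply]
    simp only [Measure.smul_apply, measure_univ, smul_eq_mul, mul_one]
    rw [← ENNReal.ofReal_sum_of_nonneg fun k _ => (hα k).le, hsum, ENNReal.ofReal_one]
  refine ⟨S, μ, hS, hprob, ?_, fun x => ?_⟩
  · refine hfin.isCompact.of_isClosed_subset Measure.isClosed_support
      (Measure.support_subset_of_isClosed hfin.isClosed ?_)
    rw [mem_ae_iff, hμ, Measure.finsetSum_apply]
    refine Finset.sum_eq_zero fun k _ => ?_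
    rw [Measure.smul_apply, Measure.dirac_apply' _ hfin.measurableSet.compl]
    simp
  · rw [hpS, hμ, integral_finsetSum_measure fun k _ =>
      (integrable_dirac (by simp)).smul_measure ENNReal.ofReal_ne_top]
    refine Finset.sum_congr rfl fun k _ => ?_
    rw [integral_smul_measure, integral_dirac, ENNReal.toReal_ofReal (hα k).le, smul_eq_mul,
      gaussMat, gaussMat, sub_zero]

end GaussianConvolution

end VPFlow

/-! ### The process as a map of independent initial value and noise -/

namespace VPFlow

open Metric Function Filter Topology ODEFlow

variable {n : ℕ}

theorem isPdf_stdGaussDensity : IsPdf (stdGaussDensity (n := n)) :=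
  ⟨fun _ => (gaussIso_pos one_pos _ _).le, integrable_gaussIso one_pos,
    integral_gaussIso one_pos⟩

instance : IsProbabilityMeasure (stdGaussMeasure n) := isPdf_stdGaussDensity.isProbabilityMeasure

theorem continuous_stdGaussDensity : Continuous (stdGaussDensity (n := n)) :=
  continuous_gaussIso 1 0

theorem gaussIso_sq_smul {σ : ℝ} (hσ : 0 < σ) (v : ℝ) (hv : 0 < v) (z : E n) :
    σ ^ n * gaussIso (v * σ ^ 2) 0 (σ • z) = gaussIso v 0 z := by
  have h1 : (2 * Real.pi * (v * σ ^ 2)) ^ (-(n : ℝ) / 2)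
      = (2 * Real.pi * v) ^ (-(n : ℝ) / 2) * (σ ^ n)⁻¹ := by
    rw [← mul_assoc, Real.mul_rpow (by positivity) (by positivity)]
    congr 1
    rw [← Real.rpow_natCast σ 2, ← Real.rpow_mul hσ.le, ← Real.rpow_natCast,
      ← Real.rpow_neg hσ.le]
    congr 1
    push_cast
    ring
  have h2 : -(‖σ • z‖ ^ 2) / (2 * (v * σ ^ 2)) = -(‖z‖ ^ 2) / (2 * v) := by
    rw [norm_smul, Real.norm_of_nonneg hσ.le]
    field_simp
  rw [gaussIso, gaussIso, sub_zero, sub_zero, h1, h2]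
  field_simp

/-- An affine image of the standard Gaussian law. -/
theorem map_stdGaussMeasure_affine {σ : ℝ} (hσ : 0 < σ) (c : E n) :
    (stdGaussMeasure n).map (fun z => c + σ • z)
      = densityMeasure fun x => gaussIso (σ ^ 2) 0 (x - c) := by
  have hder : ∀ x : E n, HasFDerivAt (((Homeomorph.smulOfNeZero σ hσ.ne').toEquiv.trans
      (Equiv.addLeft c) : E n ≃ E n)) (σ • ContinuousLinearMap.id ℝ (E n)) x := fun x =>
    ((hasFDerivAt_id x).const_smul σ).const_add c
  refine map_withDensity_eq_of_mul_det volume hder fun x => ?_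
  have hdet : (σ • ContinuousLinearMap.id ℝ (E n)).det = σ ^ n := by
    have := LinearMap.det_smul σ (LinearMap.id : E n →ₗ[ℝ] E n)
    rw [LinearMap.det_id, mul_one, finrank_euclideanSpace_fin] at this
    exact this
  rw [hdet, abs_of_pos (pow_pos hσ n), ← ENNReal.ofReal_mul (pow_pos hσ n).le]
  congr 1
  have h := gaussIso_sq_smul hσ 1 one_pos x
  rw [one_mul] at h
  simpa [stdGaussDensity] using h

theorem integrable_norm_sq_stdGaussMeasure :
    Integrable (fun z : E n => ‖z‖ ^ 2) (stdGaussMeasure n) := by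
  rw [stdGaussMeasure, isPdf_stdGaussDensity.integrable_densityMeasure_iff]
  -- By `r² ≤ 4 exp (r² / 4)`, the second moment density is dominated by a multiple of the Gaussian
  -- of variance `2`.
  have h := (integrable_gaussIso (n := n) (v := 2) two_pos).const_mul
    (4 * (2 * Real.pi * 1) ^ (-(n : ℝ) / 2) / (2 * Real.pi * 2) ^ (-(n : ℝ) / 2))
  refine h.mono' ?_ (Eventually.of_forall fun z => ?_)
  · exact (continuous_stdGaussDensity.smul (continuous_norm.pow 2)).aestronglyMeasurable
  · have h1 : ‖z‖ ^ 2 ≤ 4 * Real.exp (‖z‖ ^ 2 / 4) := by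
      have := Real.add_one_le_exp (‖z‖ ^ 2 / 4)
      linarith
    have h2 : Real.exp (-(‖z‖ ^ 2) / (2 * 2)) = Real.exp (‖z‖ ^ 2 / 4) *
        Real.exp (-(‖z‖ ^ 2) / (2 * 1)) := by
      rw [← Real.exp_add]; congr 1; ring
    have hC : (0 : ℝ) < (2 * Real.pi * 2) ^ (-(n : ℝ) / 2) := by positivity
    have h3 := mul_le_mul_of_nonneg_right h1 (gaussIso_pos one_pos (0 : E n) z).le
    rw [stdGaussDensity, Real.norm_of_nonneg
      (mul_nonneg (gaussIso_pos one_pos _ _).le (sq_nonneg _)), mul_comm]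
    refine h3.trans (le_of_eq ?_)
    rw [gaussIso, gaussIso, sub_zero, h2]
    field_simp

/-- The joint law of initial value and noise. -/
noncomputable def sourceMeasure (pH : E n → ℝ) : Measure (E n × E n) :=
  (densityMeasure pH).prod (stdGaussMeasure n)

/-- The value `a(t) y + σ(t) z` of the process at time `t`. -/
noncomputable def vpValue (t : ℝ) (p : E n × E n) : E n :=
  aCoef t • p.1 + Real.sqrt (sigmaSq t) • p.2

theorem continuous_vpValue (t : ℝ) : Continuous (vpValue (n := n) t) := by
  unfold vpValue
  fun_prop

/-! ### Joint law of the initial value and the value at time `t`. -/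

section Joint

variable {pH : E n → ℝ}

/-- Conditionally on the initial value the process is Gaussian. -/
theorem lintegral_sourceMeasure {t : ℝ} (ht : 0 < t)
    {f : E n × E n → ℝ≥0∞} (hf : Measurable f) :
    ∫⁻ p, f (p.1, vpValue t p) ∂sourceMeasure pH
      = ∫⁻ y, (∫⁻ x, ENNReal.ofReal (gaussIso (sigmaSq t) 0 (x - aCoef t • y)) * f (y, x))
          ∂densityMeasure pH := by
  have hσ := sigmaSq_pos ht
  have hm : Measurable fun p : E n × E n => f (p.1, vpValue t p) :=
    hf.comp (measurable_fst.prodMk (continuous_vpValue t).measurable)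
  rw [sourceMeasure, lintegral_prod _ hm.aemeasurable]
  refine lintegral_congr fun y => ?_
  have h := map_stdGaussMeasure_affine (Real.sqrt_pos.2 hσ) (aCoef t • y)
  rw [Real.sq_sqrt hσ.le] at h
  have hfy : Measurable fun x => f (y, x) := hf.comp measurable_prodMk_left
  have hg : Measurable fun x : E n => ENNReal.ofReal (gaussIso (sigmaSq t) 0 (x - aCoef t • y)) :=
    ((continuous_gaussIso _ _).comp
      (continuous_id.sub continuous_const)).measurable.ennreal_ofReal
  refine Eq.trans ?_ (lintegral_withDensity_eq_lintegral_mul volume hg hfy)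
  change _ = ∫⁻ x, f (y, x) ∂(densityMeasure fun x => gaussIso (sigmaSq t) 0 (x - aCoef t • y))
  rw [← h, lintegral_map hfy (by fun_prop)]
  rfl

theorem gaussIso_le {v : ℝ} (hv : 0 < v) (m x : E n) :
    gaussIso v m x ≤ (2 * Real.pi * v) ^ (-(n : ℝ) / 2) := by
  rw [gaussIso]
  refine mul_le_of_le_one_right (by positivity) (Real.exp_le_one_iff.2 ?_)
  rw [neg_div, neg_nonpos]
  positivity

theorem continuous_gaussIso_transition (v a : ℝ) :
    Continuous fun p : E n × E n => gaussIso v 0 (p.2 - a • p.1) :=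
  (continuous_gaussIso v 0).comp (continuous_snd.sub (continuous_fst.const_smul a))

theorem ofReal_vpDensity (hpdf : IsPdf pH) {t : ℝ} (ht : 0 < t) (x : E n) :
    ENNReal.ofReal (vpDensity pH t x)
      = ∫⁻ y, ENNReal.ofReal (gaussIso (sigmaSq t) 0 (x - aCoef t • y)) ∂densityMeasure pH := by
  have := hpdf.isProbabilityMeasure
  have hσ := sigmaSq_pos ht
  have hc : Continuous fun y => gaussIso (sigmaSq t) 0 (x - aCoef t • y) :=
    (continuous_gaussIso (sigmaSq t) 0).comp
      (continuous_const.sub (continuous_id.const_smul (aCoef t)))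
  have hi : Integrable (fun y => gaussIso (sigmaSq t) 0 (x - aCoef t • y)) (densityMeasure pH) :=
    Integrable.of_bound hc.aestronglyMeasurable ((2 * Real.pi * sigmaSq t) ^ (-(n : ℝ) / 2))
      (Eventually.of_forall fun y => by
        rw [Real.norm_of_nonneg (gaussIso_pos hσ _ _).le]
        exact gaussIso_le hσ _ _)
  have h0 : ∀ y, 0 ≤ gaussIso (sigmaSq t) 0 (x - aCoef t • y) := fun y => (gaussIso_pos hσ _ _).le
  rw [vpDensity_eq_mixture hpdf ht]
  exact ofReal_integral_eq_lintegral_ofReal hi (Eventually.of_forall h0)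

/-- The marginal density is the density of the law of the process. -/
theorem map_vpValue (hpdf : IsPdf pH) {t : ℝ} (ht : 0 < t) :
    (sourceMeasure pH).map (vpValue t) = densityMeasure (vpDensity pH t) := by
  have := hpdf.isProbabilityMeasure
  ext A hA
  set I : E n → ℝ≥0∞ := A.indicator 1 with hIdef
  have hI : Measurable I := measurable_one.indicator hA
  have hg : Measurable fun p : E n × E n =>
      ENNReal.ofReal (gaussIso (sigmaSq t) 0 (p.2 - aCoef t • p.1)) :=
    (continuous_gaussIso_transition (sigmaSq t) (aCoef t)).measurable.ennreal_ofReal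
  have hI2 : Measurable fun p : E n × E n => I p.2 := hI.comp measurable_snd
  calc (sourceMeasure pH).map (vpValue t) A
      = ∫⁻ p, I (vpValue t p) ∂sourceMeasure pH := by
        rw [← lintegral_indicator_one hA, lintegral_map hI (continuous_vpValue t).measurable]
    _ = ∫⁻ y, (∫⁻ x, ENNReal.ofReal (gaussIso (sigmaSq t) 0 (x - aCoef t • y)) * I x)
          ∂densityMeasure pH :=
        lintegral_sourceMeasure (pH := pH) ht (f := fun p => I p.2) hI2
    _ = ∫⁻ x, (∫⁻ y, ENNReal.ofReal (gaussIso (sigmaSq t) 0 (x - aCoef t • y)) * I x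
          ∂densityMeasure pH) :=
        lintegral_lintegral_swap (hg.mul hI2).aemeasurable
    _ = ∫⁻ x, ENNReal.ofReal (vpDensity pH t x) * I x := by
        refine lintegral_congr fun x => ?_
        have hgx : Measurable fun y => ENNReal.ofReal (gaussIso (sigmaSq t) 0 (x - aCoef t • y)) :=
          ((continuous_gaussIso (sigmaSq t) 0).comp (continuous_const.sub
            (continuous_id.const_smul (aCoef t)))).measurable.ennreal_ofReal
        rw [ofReal_vpDensity hpdf ht, lintegral_mul_const _ hgx]
    _ = densityMeasure (vpDensity pH t) A := by
        rw [densityMeasure, withDensity_apply _ hA, ← lintegral_indicator hA]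
        refine lintegral_congr fun x => ?_
        by_cases hx : x ∈ A <;> simp [hIdef, hx]

theorem map_snd_sourceMeasure (hpdf : IsPdf pH) :
    (sourceMeasure pH).map Prod.snd = stdGaussMeasure n := by
  have := hpdf.isProbabilityMeasure
  rw [sourceMeasure, Measure.map_snd_prod, measure_univ, one_smul]

/-- The logarithm of the ratio of the transition density and the standard Gaussian density. -/
noncomputable def logRatio (t : ℝ) (p : E n × E n) : ℝ :=
  -(n : ℝ) / 2 * Real.log (sigmaSq t) - ‖p.2 - aCoef t • p.1‖ ^ 2 / (2 * sigmaSq t) + ‖p.2‖ ^ 2 / 2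

theorem continuous_logRatio (t : ℝ) : Continuous (logRatio (n := n) t) := by
  unfold logRatio
  fun_prop

theorem gaussIso_eq_exp_logRatio {t : ℝ} (ht : 0 < t) (y x : E n) :
    gaussIso (sigmaSq t) 0 (x - aCoef t • y)
      = Real.exp (logRatio t (y, x)) * stdGaussDensity x := by
  have hσ := sigmaSq_pos ht
  have e1 : Real.exp (logRatio t (y, x)) = Real.exp (Real.log (sigmaSq t) * (-(n : ℝ) / 2)) *
      Real.exp (-(‖x - aCoef t • y‖ ^ 2) / (2 * sigmaSq t)) * Real.exp (‖x‖ ^ 2 / 2) := by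
    rw [← Real.exp_add, ← Real.exp_add, logRatio]
    congr 1
    ring
  have e2 : Real.exp (‖x‖ ^ 2 / 2) * Real.exp (-(‖x‖ ^ 2) / (2 * 1)) = 1 := by
    rw [← Real.exp_add, Real.exp_eq_one_iff]
    ring
  rw [gaussIso, stdGaussDensity, gaussIso, Real.mul_rpow (by positivity) hσ.le, mul_one,
    Real.rpow_def_of_pos hσ, e1, sub_zero, sub_zero]
  linear_combination -(2 * Real.pi) ^ (-(n : ℝ) / 2) *
    Real.exp (Real.log (sigmaSq t) * (-(n : ℝ) / 2)) *
    Real.exp (-(‖x - aCoef t • y‖ ^ 2) / (2 * sigmaSq t)) * e2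

/-- For each initial value the transition density is `exp logRatio` times the standard Gaussian
density. Passing to the pair makes the Radon–Nikodym derivative explicit, which it is not for the
marginal alone. -/
theorem map_prodMk_vpValue (hpdf : IsPdf pH) {t : ℝ} (ht : 0 < t) :
    (sourceMeasure pH).map (fun p => (p.1, vpValue t p))
      = (sourceMeasure pH).withDensity fun p => ENNReal.ofReal (Real.exp (logRatio t p)) := by
  have := hpdf.isProbabilityMeasure
  ext A hA
  have hI : Measurable (A.indicator (1 : E n × E n → ℝ≥0∞)) := measurable_one.indicator hA
  have hΦ : Measurable fun p : E n × E n => (p.1, vpValue t p) :=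
    measurable_fst.prodMk (continuous_vpValue t).measurable
  have hL : Measurable fun p : E n × E n => ENNReal.ofReal (Real.exp (logRatio t p)) :=
    (Real.continuous_exp.comp (continuous_logRatio t)).measurable.ennreal_ofReal
  rw [← lintegral_indicator_one hA, lintegral_map hI hΦ, ← lintegral_indicator_one hA,
    lintegral_withDensity_eq_lintegral_mul _ hL hI]
  refine (lintegral_sourceMeasure ht hI).trans ?_
  rw [sourceMeasure, lintegral_prod _ (hL.mul hI).aemeasurable]
  refine lintegral_congr fun y => ?_
  refine Eq.trans ?_ (lintegral_withDensity_eq_lintegral_mul volume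
    continuous_stdGaussDensity.measurable.ennreal_ofReal
    ((hL.mul hI).comp (measurable_prodMk_left (x := y)))).symm
  refine lintegral_congr fun x => ?_
  simp only [Pi.mul_apply, comp_apply]
  rw [gaussIso_eq_exp_logRatio ht, ENNReal.ofReal_mul (Real.exp_pos _).le]
  ring

end Joint

end VPFlow

/-! ### Relative entropy and Wasserstein distance to the standard Gaussian law -/

namespace VPFlow

open Metric Function Filter Topology ODEFlow InformationTheory

variable {n : ℕ}

local notation "⟪" x ", " y "⟫" => inner ℝ x y

/-- The sum of the second moments of the initial law and of the standard Gaussian law. -/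
noncomputable def momentSum (pH : E n → ℝ) : ℝ :=
  ∫ p, (‖p.1‖ ^ 2 + ‖p.2‖ ^ 2) ∂sourceMeasure pH

theorem aCoef_le_one {t : ℝ} (ht : 0 ≤ t) : aCoef t ≤ 1 :=
  Real.exp_le_one_iff.2 (by linarith)

theorem sqrt_sigmaSq_le_one (t : ℝ) : Real.sqrt (sigmaSq t) ≤ 1 := by
  refine Real.sqrt_le_iff.2 ⟨zero_le_one, ?_⟩
  rw [sigmaSq_eq]
  nlinarith [sq_nonneg (aCoef t)]

/-- Since `0 ≤ σ ≤ 1`, one has `1 - σ ≤ 1 - σ² = a² ≤ a`. -/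
theorem one_sub_sqrt_sigmaSq_le {t : ℝ} (ht : 0 ≤ t) : 1 - Real.sqrt (sigmaSq t) ≤ aCoef t := by
  have ha := aCoef_pos t
  have h1 := aCoef_le_one ht
  have hs : 0 ≤ sigmaSq t := by rw [sigmaSq_eq]; nlinarith
  have h2 := Real.sq_sqrt hs
  have h3 := sqrt_sigmaSq_le_one t
  have h4 := Real.sqrt_nonneg (sigmaSq t)
  rw [sigmaSq_eq] at *
  nlinarith

theorem tendsto_aCoef : Tendsto aCoef atTop (𝓝 0) := by
  refine Real.tendsto_exp_atBot.comp ?_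
  exact (tendsto_neg_atTop_atBot).atBot_div_const two_pos

theorem tendsto_sigmaSq : Tendsto sigmaSq atTop (𝓝 1) := by
  have := (tendsto_aCoef.pow 2).const_sub 1
  simp only [← sigmaSq_eq] at this
  simpa using this

/-! ### Wasserstein convergence by sharing the noise. -/

section Coupling

variable {pH : E n → ℝ}

theorem isProbabilityMeasure_sourceMeasure (hpdf : IsPdf pH) :
    IsProbabilityMeasure (sourceMeasure pH) := by
  have := hpdf.isProbabilityMeasure
  unfold sourceMeasure
  infer_instance

theorem integrable_norm_sq_sourceMeasure (hpdf : IsPdf pH)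
    (hmom : Integrable (fun x => ‖x‖ ^ 2 * pH x) volume) :
    Integrable (fun p : E n × E n => ‖p.1‖ ^ 2 + ‖p.2‖ ^ 2) (sourceMeasure pH) := by
  have := hpdf.isProbabilityMeasure
  have h1 : Integrable (fun y : E n => ‖y‖ ^ 2) (densityMeasure pH) :=
    (hpdf.integrable_densityMeasure_iff _).2 (hmom.congr (Eventually.of_forall fun x => by
      simp only [mul_comm]))
  exact (h1.comp_fst _).add (integrable_norm_sq_stdGaussMeasure.comp_snd _)

theorem norm_vpValue_sub_le {t : ℝ} (ht : 0 ≤ t) (p : E n × E n) :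
    ‖vpValue t p - p.2‖ ≤ aCoef t * (‖p.1‖ + ‖p.2‖) := by
  have e : vpValue t p - p.2 = aCoef t • p.1 - (1 - Real.sqrt (sigmaSq t)) • p.2 := by
    rw [vpValue, sub_smul, one_smul]; abel
  rw [e]
  refine (norm_sub_le _ _).trans ?_
  rw [norm_smul, norm_smul, Real.norm_of_nonneg (aCoef_pos t).le,
    Real.norm_of_nonneg (sub_nonneg.2 (sqrt_sigmaSq_le_one t)), mul_add]
  have := mul_le_mul_of_nonneg_right (one_sub_sqrt_sigmaSq_le ht) (norm_nonneg p.2)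
  linarith

theorem wasserstein_le_of_coupling {q : ℝ} (hq : 0 < q) {μ ν : Measure (E n)}
    {Ω : Type*} [MeasurableSpace Ω] {P : Measure Ω} {X Y : Ω → E n} (hX : Measurable X)
    (hY : Measurable Y) (hμ : P.map X = μ) (hν : P.map Y = ν) :
    wasserstein q μ ν ≤ (∫⁻ ω, edist (X ω) (Y ω) ^ q ∂P) ^ (1 / q) := by
  refine ENNReal.rpow_le_rpow ?_ (by positivity)
  refine (iInf₂_le (P.map fun ω => (X ω, Y ω)) ⟨?_, ?_⟩).trans ?_
  · rw [lintegral_map ((measurable_fst.edist measurable_snd).pow_const q) (hX.prodMk hY)]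
  · rw [Measure.map_map measurable_fst (hX.prodMk hY)]; exact hμ
  · rw [Measure.map_map measurable_snd (hX.prodMk hY)]; exact hν

/-- The coupling pairs `a Y + σ Z` with its own noise `Z`; only the pointwise bound depends on the
exponent. -/
theorem wasserstein_vpDensity_le (hpdf : IsPdf pH) {q : ℝ} (hq : 0 < q) {C : ℝ} {t : ℝ}
    (ht : 0 < t) (hmom : Integrable (fun x => ‖x‖ ^ 2 * pH x) volume)
    (hle : ∀ p : E n × E n, ‖vpValue t p - p.2‖ ^ q ≤ C * (1 + (‖p.1‖ ^ 2 + ‖p.2‖ ^ 2))) :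
    wasserstein q (densityMeasure (vpDensity pH t)) (stdGaussMeasure n)
      ≤ ENNReal.ofReal (C * (1 + momentSum pH)) ^ (1 / q) := by
  have := isProbabilityMeasure_sourceMeasure hpdf
  have hi := integrable_norm_sq_sourceMeasure hpdf hmom
  refine (wasserstein_le_of_coupling hq (continuous_vpValue t).measurable measurable_snd
    (map_vpValue hpdf ht) (map_snd_sourceMeasure hpdf)).trans
    (ENNReal.rpow_le_rpow ?_ (by positivity))
  have hI : Integrable (fun p : E n × E n => C * (1 + (‖p.1‖ ^ 2 + ‖p.2‖ ^ 2)))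
      (sourceMeasure pH) := ((integrable_const 1).add hi).const_mul C
  have e : C * (1 + momentSum pH)
      = ∫ p, C * (1 + (‖p.1‖ ^ 2 + ‖p.2‖ ^ 2)) ∂sourceMeasure pH := by
    rw [integral_const_mul, integral_add (integrable_const 1) hi, momentSum]
    simp
  rw [e, ofReal_integral_eq_lintegral_ofReal hI (Eventually.of_forall fun p =>
    (Real.rpow_nonneg (norm_nonneg _) q).trans (hle p))]
  refine lintegral_mono fun p => ?_
  rw [edist_eq_enorm_sub, ← ofReal_norm, ENNReal.ofReal_rpow_of_nonneg (norm_nonneg _)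
    hq.le]
  exact ENNReal.ofReal_le_ofReal (hle p)

theorem tendsto_wasserstein_one (hpdf : IsPdf pH)
    (hmom : Integrable (fun x => ‖x‖ ^ 2 * pH x) volume) :
    Tendsto (fun t => wasserstein 1 (densityMeasure (vpDensity pH t)) (stdGaussMeasure n))
      atTop (𝓝 0) := by
  have h : Tendsto (fun t => ENNReal.ofReal (aCoef t * (1 + momentSum pH)) ^ (1 / (1 : ℝ)))
      atTop (𝓝 0) := by
    have := ENNReal.tendsto_ofReal (tendsto_aCoef.mul_const (1 + momentSum pH))
    simpa using this
  refine tendsto_of_tendsto_of_tendsto_of_le_of_le' tendsto_const_nhds h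
    (Eventually.of_forall fun _ => zero_le) ?_
  filter_upwards [eventually_gt_atTop 0] with t ht
  refine wasserstein_vpDensity_le hpdf one_pos ht hmom fun p => ?_
  rw [Real.rpow_one]
  refine (norm_vpValue_sub_le ht.le p).trans (mul_le_mul_of_nonneg_left ?_ (aCoef_pos t).le)
  nlinarith [sq_nonneg (‖p.1‖ - 1), sq_nonneg (‖p.2‖ - 1), sq_nonneg ‖p.1‖, sq_nonneg ‖p.2‖]

theorem tendsto_wasserstein_two (hpdf : IsPdf pH)
    (hmom : Integrable (fun x => ‖x‖ ^ 2 * pH x) volume) :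
    Tendsto (fun t => wasserstein 2 (densityMeasure (vpDensity pH t)) (stdGaussMeasure n))
      atTop (𝓝 0) := by
  have h : Tendsto (fun t => ENNReal.ofReal (2 * aCoef t ^ 2 * (1 + momentSum pH)) ^ (1 / (2 : ℝ)))
      atTop (𝓝 0) := by
    have h1 := ENNReal.tendsto_ofReal
      (((tendsto_aCoef.pow 2).const_mul 2).mul_const (1 + momentSum pH))
    have h2 := (ENNReal.continuous_rpow_const (y := 1 / 2)).continuousAt.tendsto.comp h1
    simpa [Function.comp_def] using h2
  refine tendsto_of_tendsto_of_tendsto_of_le_of_le' tendsto_const_nhds h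
    (Eventually.of_forall fun _ => zero_le) ?_
  filter_upwards [eventually_gt_atTop 0] with t ht
  refine wasserstein_vpDensity_le hpdf two_pos ht hmom fun p => ?_
  rw [Real.rpow_two]
  have h1 := pow_le_pow_left₀ (norm_nonneg _) (norm_vpValue_sub_le ht.le p) 2
  refine h1.trans ?_
  rw [mul_pow, mul_assoc, mul_left_comm]
  refine mul_le_mul_of_nonneg_left ?_ (sq_nonneg _)
  nlinarith [sq_nonneg (‖p.1‖ - ‖p.2‖)]

end Coupling

/-! ### Convergence in relative entropy. -/

section Entropy

variable {pH : E n → ℝ}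

/-- The deviation of `X_t` from `a X_0` is exactly `σ Z`, so the `σ²` in the denominator cancels. -/
theorem logRatio_vpValue {t : ℝ} (ht : 0 < t) (p : E n × E n) :
    logRatio t (p.1, vpValue t p) = -(n : ℝ) / 2 * Real.log (sigmaSq t) +
      (‖vpValue t p‖ ^ 2 - ‖p.2‖ ^ 2) / 2 := by
  have hσ := sigmaSq_pos ht
  have h1 : ‖vpValue t p - aCoef t • p.1‖ ^ 2 = sigmaSq t * ‖p.2‖ ^ 2 := by
    rw [vpValue, add_sub_cancel_left, norm_smul, mul_pow, Real.norm_eq_abs, sq_abs,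
      Real.sq_sqrt hσ.le]
  rw [logRatio, h1]
  field_simp
  ring

theorem norm_vpValue_sq_sub_le {t : ℝ} (ht : 0 < t) (p : E n × E n) :
    |‖vpValue t p‖ ^ 2 - ‖p.2‖ ^ 2| ≤ 2 * aCoef t * (‖p.1‖ ^ 2 + ‖p.2‖ ^ 2) := by
  have hσ := sigmaSq_pos ht
  have ha := aCoef_pos t
  have ha1 := aCoef_le_one ht.le
  have h0 := Real.sqrt_nonneg (sigmaSq t)
  have h1 := sqrt_sigmaSq_le_one t
  have h2 := Real.sq_sqrt hσ.le
  have e : ‖vpValue t p‖ ^ 2 = aCoef t ^ 2 * ‖p.1‖ ^ 2 +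
      2 * (aCoef t * (Real.sqrt (sigmaSq t) * ⟪p.1, p.2⟫)) + sigmaSq t * ‖p.2‖ ^ 2 := by
    rw [vpValue, norm_add_sq_real, norm_smul, norm_smul, real_inner_smul_left,
      real_inner_smul_right, mul_pow, mul_pow, Real.norm_eq_abs, Real.norm_eq_abs, sq_abs, sq_abs,
      h2]
  have h3 : |2 * (aCoef t * (Real.sqrt (sigmaSq t) * ⟪p.1, p.2⟫))|
      ≤ aCoef t * (‖p.1‖ ^ 2 + ‖p.2‖ ^ 2) := by
    have h4 := abs_real_inner_le_norm p.1 p.2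
    have h5 : Real.sqrt (sigmaSq t) * |⟪p.1, p.2⟫| ≤ ‖p.1‖ * ‖p.2‖ :=
      (mul_le_of_le_one_left (abs_nonneg _) h1).trans h4
    rw [abs_mul, abs_mul, abs_mul, abs_of_pos ha, abs_of_nonneg h0, abs_two]
    nlinarith [sq_nonneg (‖p.1‖ - ‖p.2‖), mul_le_mul_of_nonneg_left h5 ha.le]
  have e2 : ‖vpValue t p‖ ^ 2 - ‖p.2‖ ^ 2 = 2 * (aCoef t * (Real.sqrt (sigmaSq t) * ⟪p.1, p.2⟫)) +
      aCoef t ^ 2 * (‖p.1‖ ^ 2 - ‖p.2‖ ^ 2) := by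
    rw [e, sigmaSq_eq]; ring
  have h6 : |aCoef t ^ 2 * (‖p.1‖ ^ 2 - ‖p.2‖ ^ 2)| ≤ aCoef t * (‖p.1‖ ^ 2 + ‖p.2‖ ^ 2) := by
    rw [abs_mul, abs_of_nonneg (sq_nonneg _)]
    refine mul_le_mul (by nlinarith) ?_ (abs_nonneg _) ha.le
    rw [abs_le]
    constructor <;> nlinarith [sq_nonneg ‖p.1‖, sq_nonneg ‖p.2‖]
  rw [e2]
  refine (abs_add_le _ _).trans ?_
  linarith

/-- Projection to the second coordinate sends the joint law to the law of `X_t` and the reference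
product to the standard Gaussian, and cannot increase relative entropy. For the pair, the entropy is
the expectation of `logRatio`; the second moments then control it. -/
theorem klDiv_vpDensity_le (hpdf : IsPdf pH)
    (hmom : Integrable (fun x => ‖x‖ ^ 2 * pH x) volume) {t : ℝ} (ht : 0 < t) :
    klDiv (densityMeasure (vpDensity pH t)) (stdGaussMeasure n)
      ≤ ENNReal.ofReal (-(n : ℝ) / 2 * Real.log (sigmaSq t) + aCoef t * momentSum pH) := by
  have := isProbabilityMeasure_sourceMeasure hpdf
  have hi := integrable_norm_sq_sourceMeasure hpdf hmom
  set π := sourceMeasure pH with hπ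
  set Φ : E n × E n → E n × E n := fun p => (p.1, vpValue t p) with hΦdef
  have hΦ : Measurable Φ := measurable_fst.prodMk (continuous_vpValue t).measurable
  have hmap := map_prodMk_vpValue hpdf ht
  have hprob : IsProbabilityMeasure (π.map Φ) := Measure.isProbabilityMeasure_map hΦ.aemeasurable
  have hL := continuous_logRatio (n := n) t
  have hLm : Measurable fun p : E n × E n => ENNReal.ofReal (Real.exp (logRatio t p)) :=
    (Real.continuous_exp.comp hL).measurable.ennreal_ofReal
  have h1 : klDiv (densityMeasure (vpDensity pH t)) (stdGaussMeasure n) ≤ klDiv (π.map Φ) π := by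
    have h := klDiv_map_le (π.map Φ) π (measurable_snd (α := E n) (β := E n))
    rwa [Measure.map_map measurable_snd hΦ, map_snd_sourceMeasure hpdf,
      show Prod.snd ∘ Φ = vpValue t from rfl, map_vpValue hpdf ht] at h
  refine h1.trans ?_
  have hac : π.map Φ ≪ π := by
    rw [hmap]; exact withDensity_absolutelyContinuous _ _
  have hllr : llr (π.map Φ) π =ᵐ[π.map Φ] logRatio t := by
    refine hac.ae_le ?_
    rw [hmap]
    filter_upwards [Measure.rnDeriv_withDensity π hLm] with p hp
    rw [llr, hp, ENNReal.toReal_ofReal (Real.exp_pos _).le, Real.log_exp]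
  have hcomp : Integrable (fun p => logRatio t (Φ p)) π := by
    have h2 : Integrable (fun p : E n × E n => ‖vpValue t p‖ ^ 2 - ‖p.2‖ ^ 2) π := by
      refine (hi.const_mul (2 * aCoef t)).mono' ?_
        (Eventually.of_forall fun p => norm_vpValue_sq_sub_le ht p)
      exact (((continuous_vpValue t).norm.pow 2).sub
        (continuous_snd.norm.pow 2)).aestronglyMeasurable
    exact ((integrable_const (-(n : ℝ) / 2 * Real.log (sigmaSq t))).add (h2.div_const 2)).congr
      (Eventually.of_forall fun p => (logRatio_vpValue ht p).symm)
  have hint : Integrable (logRatio t) (π.map Φ) :=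
    (integrable_map_measure hL.aestronglyMeasurable hΦ.aemeasurable).2 hcomp
  rw [klDiv_of_ac_of_integrable hac (hint.congr hllr.symm), integral_congr_ae hllr,
    integral_map hΦ.aemeasurable hL.aestronglyMeasurable, probReal_univ, probReal_univ,
    add_sub_cancel_right]
  refine ENNReal.ofReal_le_ofReal ?_
  have e : -(n : ℝ) / 2 * Real.log (sigmaSq t) + aCoef t * momentSum pH
      = ∫ p, (-(n : ℝ) / 2 * Real.log (sigmaSq t) + aCoef t * (‖p.1‖ ^ 2 + ‖p.2‖ ^ 2)) ∂π := by
    rw [integral_add (integrable_const _) (hi.const_mul _), momentSum, ← hπ,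
      integral_const_mul (aCoef t)]
    simp
  rw [e]
  refine integral_mono hcomp ((integrable_const _).add (hi.const_mul _)) fun p => ?_
  have h3 := (le_abs_self _).trans (norm_vpValue_sq_sub_le ht p)
  simp only [hΦdef, logRatio_vpValue ht]
  linarith

theorem tendsto_klDiv (hpdf : IsPdf pH) (hmom : Integrable (fun x => ‖x‖ ^ 2 * pH x) volume) :
    Tendsto (fun t => klDiv (densityMeasure (vpDensity pH t)) (stdGaussMeasure n))
      atTop (𝓝 0) := by
  have h : Tendsto (fun t => ENNReal.ofReal
      (-(n : ℝ) / 2 * Real.log (sigmaSq t) + aCoef t * momentSum pH)) atTop (𝓝 0) := by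
    have := ENNReal.tendsto_ofReal (((tendsto_sigmaSq.log one_ne_zero).const_mul
      (-(n : ℝ) / 2)).add (tendsto_aCoef.mul_const (momentSum pH)))
    simpa using this
  refine tendsto_of_tendsto_of_tendsto_of_le_of_le' tendsto_const_nhds h
    (Eventually.of_forall fun _ => zero_le) ?_
  filter_upwards [eventually_gt_atTop 0] with t ht using klDiv_vpDensity_le hpdf hmom ht

end Entropy

end VPFlow

/-! ### Convergence of the marginal densities in `L¹` and `L²` -/

namespace VPFlow

open Metric Function Filter Topology ODEFlow

variable {n : ℕ}

/-- **Scheffé's lemma**. -/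
theorem tendsto_integral_abs_sub_of_tendsto {α ι : Type*} [MeasurableSpace α] {μ : Measure α}
    {l : Filter ι} [l.IsCountablyGenerated] {F : ι → α → ℝ} {f : α → ℝ}
    (hF : ∀ᶠ i in l, Integrable (F i) μ) (hF0 : ∀ᶠ i in l, ∀ x, 0 ≤ F i x)
    (hFf : ∀ᶠ i in l, ∫ x, F i x ∂μ = ∫ x, f x ∂μ) (hf : Integrable f μ) (hf0 : ∀ x, 0 ≤ f x)
    (hlim : ∀ x, Tendsto (fun i => F i x) l (𝓝 (f x))) :
    Tendsto (fun i => ∫ x, |F i x - f x| ∂μ) l (𝓝 0) := by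
  have h : Tendsto (fun i => ∫ x, max (f x - F i x) 0 ∂μ) l (𝓝 (∫ _, (0 : ℝ) ∂μ)) := by
    refine tendsto_integral_filter_of_dominated_convergence f ?_ ?_ hf
      (Eventually.of_forall fun x => ?_)
    · filter_upwards [hF] with i hi using ((hf.sub hi).pos_part).aestronglyMeasurable
    · filter_upwards [hF0] with i hi
      refine Eventually.of_forall fun x => ?_
      rw [Real.norm_of_nonneg (le_max_right _ _)]
      exact max_le (by linarith [hi x]) (hf0 x)
    · have := ((hlim x).const_sub (f x)).max (tendsto_const_nhds (x := (0 : ℝ)))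
      simpa using this
  rw [integral_zero] at h
  have h2 := h.const_mul 2
  rw [mul_zero] at h2
  refine h2.congr' ?_
  filter_upwards [hF, hFf] with i hi hif
  -- The signed difference integrates to zero because the masses agree, so only the part `(f - F
  -- i)⁺`, dominated by `f`, matters.
  have e : ∀ x, |F i x - f x| = (F i x - f x) + 2 * max (f x - F i x) 0 := fun x => by
    rcases le_total (f x) (F i x) with hx | hx
    · rw [abs_of_nonneg (by linarith), max_eq_right (by linarith)]; ring
    · rw [abs_of_nonpos (by linarith), max_eq_left (by linarith)]; ring
  have i1 : Integrable (fun x => F i x - f x) μ := hi.sub hf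
  have i2 : Integrable (fun x => 2 * max (f x - F i x) 0) μ :=
    (hf.sub hi).pos_part.const_mul 2
  simp only [e]
  rw [integral_add i1 i2, integral_sub hi hf, hif, sub_self, zero_add, integral_const_mul]

/-! ### Distances of laws in terms of their densities. -/

section DensityDistance

variable {p q : E n → ℝ}

theorem IsPdf.rnDeriv_densityMeasure (hp : IsPdf p) :
    (fun x => ((densityMeasure p).rnDeriv volume x).toReal) =ᵐ[volume] p := by
  filter_upwards [Measure.rnDeriv_withDensity₀ volume hp.aemeasurable_ofReal] with x hx
  rw [densityMeasure, hx, ENNReal.toReal_ofReal (hp.nonneg x)]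

theorem densityLpDist_densityMeasure (hp : IsPdf p) (hq : IsPdf q) (r : ℝ≥0∞) :
    densityLpDist r (densityMeasure p) (densityMeasure q)
      = eLpNorm (fun x => p x - q x) r volume := by
  rw [densityLpDist, if_pos ⟨withDensity_absolutelyContinuous _ _,
    withDensity_absolutelyContinuous _ _⟩]
  exact eLpNorm_congr_ae (hp.rnDeriv_densityMeasure.sub hq.rnDeriv_densityMeasure)

theorem densityLpDist_one (hp : IsPdf p) (hq : IsPdf q) :
    densityLpDist 1 (densityMeasure p) (densityMeasure q)
      = ENNReal.ofReal (∫ x, |p x - q x|) := by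
  rw [densityLpDist_densityMeasure hp hq, eLpNorm_one_eq_lintegral_enorm]
  exact (ofReal_integral_norm_eq_lintegral_enorm (hp.integrable.sub hq.integrable)).symm

/-- Interpolation between `L¹` and `L^∞`: `|p - q|² ≤ M |p - q|`. -/
theorem densityLpDist_two_le (hp : IsPdf p) (hq : IsPdf q) {M : ℝ}
    (hM : ∀ x, |p x - q x| ≤ M) :
    densityLpDist 2 (densityMeasure p) (densityMeasure q)
      ≤ ENNReal.ofReal (M * ∫ x, |p x - q x|) ^ (1 / (2 : ℝ)) := by
  have hi : Integrable (fun x => M * |p x - q x|) volume :=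
    (hp.integrable.sub hq.integrable).abs.const_mul M
  rw [densityLpDist_densityMeasure hp hq, eLpNorm_eq_lintegral_rpow_enorm_toReal two_ne_zero
    ENNReal.ofNat_ne_top, ENNReal.toReal_ofNat, ← integral_const_mul,
    ofReal_integral_eq_lintegral_ofReal hi (Eventually.of_forall fun x =>
      mul_nonneg ((abs_nonneg _).trans (hM x)) (abs_nonneg _))]
  refine ENNReal.rpow_le_rpow (lintegral_mono fun x => ?_) (by norm_num)
  rw [← ofReal_norm, Real.norm_eq_abs, ENNReal.ofReal_rpow_of_nonneg (abs_nonneg _) zero_le_two,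
    Real.rpow_two, sq]
  exact ENNReal.ofReal_le_ofReal (mul_le_mul_of_nonneg_right (hM x) (abs_nonneg _))

end DensityDistance

/-! ### Pointwise and norm convergence for large times. -/

section LargeTime

variable {pH : E n → ℝ}

theorem vpDensity_le (hpdf : IsPdf pH) {t : ℝ} (ht : 0 < t) (x : E n) :
    vpDensity pH t x ≤ (2 * Real.pi * sigmaSq t) ^ (-(n : ℝ) / 2) := by
  have := hpdf.isProbabilityMeasure
  have hσ := sigmaSq_pos ht
  rw [vpDensity_eq_mixture hpdf ht]
  have h := norm_integral_le_of_norm_le_const (μ := densityMeasure pH)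
    (f := fun y => gaussIso (sigmaSq t) 0 (x - aCoef t • y))
    (C := (2 * Real.pi * sigmaSq t) ^ (-(n : ℝ) / 2)) (Eventually.of_forall fun y => by
      rw [Real.norm_of_nonneg (gaussIso_pos hσ _ _).le]
      exact gaussIso_le hσ _ _)
  rw [probReal_univ, mul_one] at h
  exact (le_abs_self _).trans h

theorem tendsto_gaussIso_const :
    Tendsto (fun t => (2 * Real.pi * sigmaSq t) ^ (-(n : ℝ) / 2)) atTop
      (𝓝 ((2 * Real.pi) ^ (-(n : ℝ) / 2))) := by
  have h := (tendsto_sigmaSq.const_mul (2 * Real.pi)).rpow_const (p := -(n : ℝ) / 2)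
    (Or.inl (by positivity))
  rwa [mul_one] at h

theorem tendsto_vpDensity_atTop (hpdf : IsPdf pH) (x : E n) :
    Tendsto (fun t => vpDensity pH t x) atTop (𝓝 (stdGaussDensity x)) := by
  have := hpdf.isProbabilityMeasure
  have h : Tendsto (fun t => ∫ y, gaussIso (sigmaSq t) 0 (x - aCoef t • y) ∂densityMeasure pH)
      atTop (𝓝 (∫ _, stdGaussDensity x ∂densityMeasure pH)) := by
    -- The kernel never exceeds `(2πσ²)^(-n/2)`, which for large times lies below its limit plus
    -- `1`; this constant dominates since the mixing law is finite.
    refine tendsto_integral_filter_of_dominated_convergence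
      (fun _ => (2 * Real.pi) ^ (-(n : ℝ) / 2) + 1) (Eventually.of_forall fun t => ?_) ?_
      (integrable_const _) (Eventually.of_forall fun y => ?_)
    · exact ((continuous_gaussIso (sigmaSq t) 0).comp (continuous_const.sub
        (continuous_id.const_smul (aCoef t)))).aestronglyMeasurable
    · filter_upwards [eventually_gt_atTop 0,
        tendsto_gaussIso_const.eventually_le_const (lt_add_one _)] with t ht hle
      refine Eventually.of_forall fun y => ?_
      have hσ := sigmaSq_pos ht
      rw [Real.norm_of_nonneg (gaussIso_pos hσ _ _).le]
      exact (gaussIso_le hσ _ _).trans hle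
    · have h1 : Tendsto (fun t => x - aCoef t • y - 0) atTop (𝓝 (x - 0)) := by
        have := ((tendsto_aCoef.smul_const y).const_sub x).sub_const 0
        simpa using this
      have h2 := (h1.norm.pow 2).neg.div (tendsto_sigmaSq.const_mul 2) (by norm_num)
      have h3 := (tendsto_gaussIso_const (n := n)).mul
        (Real.continuous_exp.continuousAt.tendsto.comp h2)
      have e : stdGaussDensity x = (2 * Real.pi) ^ (-(n : ℝ) / 2) *
          Real.exp (-‖x - 0‖ ^ 2 / (2 * 1)) := by
        rw [stdGaussDensity, gaussIso, mul_one]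
      rw [e]
      exact h3
  rw [integral_const, probReal_univ, one_smul] at h
  refine h.congr' ?_
  filter_upwards [eventually_gt_atTop 0] with t ht
  rw [vpDensity_eq_mixture hpdf ht]

theorem tendsto_integral_abs_vpDensity_sub (hpdf : IsPdf pH) :
    Tendsto (fun t => ∫ x, |vpDensity pH t x - stdGaussDensity x|) atTop (𝓝 0) := by
  have h0 : ∀ᶠ t : ℝ in atTop, 0 ≤ t := eventually_ge_atTop 0
  refine tendsto_integral_abs_sub_of_tendsto ?_ ?_ ?_ isPdf_stdGaussDensity.integrable
    isPdf_stdGaussDensity.nonneg (tendsto_vpDensity_atTop hpdf)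
  · filter_upwards [h0] with t ht using (hpdf.vpDensity ht).integrable
  · filter_upwards [h0] with t ht using (hpdf.vpDensity ht).nonneg
  · filter_upwards [h0] with t ht
    rw [(hpdf.vpDensity ht).integral_eq_one, isPdf_stdGaussDensity.integral_eq_one]

theorem tendsto_densityLpDist_one (hpdf : IsPdf pH) :
    Tendsto (fun t => densityLpDist 1 (densityMeasure (vpDensity pH t)) (stdGaussMeasure n))
      atTop (𝓝 0) := by
  have h := ENNReal.tendsto_ofReal (tendsto_integral_abs_vpDensity_sub hpdf)
  rw [ENNReal.ofReal_zero] at h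
  refine h.congr' ?_
  filter_upwards [eventually_ge_atTop 0] with t ht
  rw [stdGaussMeasure, densityLpDist_one (hpdf.vpDensity ht) isPdf_stdGaussDensity]

theorem tendsto_densityLpDist_two (hpdf : IsPdf pH) :
    Tendsto (fun t => densityLpDist 2 (densityMeasure (vpDensity pH t)) (stdGaussMeasure n))
      atTop (𝓝 0) := by
  set M : ℝ → ℝ := fun t => (2 * Real.pi * sigmaSq t) ^ (-(n : ℝ) / 2) +
    (2 * Real.pi * 1) ^ (-(n : ℝ) / 2)
  have h : Tendsto (fun t => ENNReal.ofReal (M t * ∫ x, |vpDensity pH t x - stdGaussDensity x|) ^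
      (1 / (2 : ℝ))) atTop (𝓝 0) := by
    have h1 := ENNReal.tendsto_ofReal (((tendsto_gaussIso_const (n := n)).add_const
      ((2 * Real.pi * 1) ^ (-(n : ℝ) / 2))).mul (tendsto_integral_abs_vpDensity_sub hpdf))
    have h2 := (ENNReal.continuous_rpow_const (y := 1 / 2)).continuousAt.tendsto.comp h1
    simpa [M, Function.comp_def] using h2
  refine tendsto_of_tendsto_of_tendsto_of_le_of_le' tendsto_const_nhds h
    (Eventually.of_forall fun _ => zero_le) ?_
  filter_upwards [eventually_gt_atTop 0] with t ht
  refine densityLpDist_two_le (hpdf.vpDensity ht.le) isPdf_stdGaussDensity fun x => ?_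
  have h1 := vpDensity_le hpdf ht x
  have h2 : stdGaussDensity x ≤ (2 * Real.pi * 1) ^ (-(n : ℝ) / 2) := gaussIso_le one_pos 0 x
  have h3 := (hpdf.vpDensity ht.le).nonneg x
  have h4 := isPdf_stdGaussDensity.nonneg x
  rw [abs_le]
  constructor <;> linarith

end LargeTime

end VPFlow

/-! ### Convergence of the marginal densities to the initial density -/

namespace VPFlow

open Metric Function Filter Topology ODEFlow

variable {n : ℕ}

theorem integrable_smoothing {u : E n → ℝ} (hu : Integrable u) {v : ℝ} (hv : 0 < v) (a : ℝ) :
    Integrable (fun p : E n × E n => u p.2 * gaussIso v 0 (p.1 - a • p.2))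
      (volume.prod volume) :=
  integrable_mul_mixture_prod hu (integrable_gaussIso hv) (continuous_gaussIso v 0) a

theorem integral_mul_gaussIso_sub (w : E n) (a r : ℝ) {v : ℝ} (hv : 0 < v) :
    ∫ x, r * gaussIso v (0 : E n) (x - a • w) = r := by
  rw [integral_const_mul, integral_sub_right_eq_self (gaussIso v (0 : E n)),
    integral_gaussIso hv, mul_one]

theorem integrable_mul_gaussIso {u : E n → ℝ} (hu : Integrable u) {v : ℝ} (hv : 0 < v) (a : ℝ)
    (x : E n) : Integrable fun y => u y * gaussIso v 0 (x - a • y) := by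
  have hc : Continuous fun y => gaussIso v 0 (x - a • y) :=
    (continuous_gaussIso v 0).comp (continuous_const.sub (continuous_id.const_smul a))
  refine hu.mul_bdd (c := (2 * Real.pi * v) ^ (-(n : ℝ) / 2)) hc.aestronglyMeasurable
    (Eventually.of_forall fun y => ?_)
  rw [Real.norm_of_nonneg (gaussIso_pos hv _ _).le]
  exact gaussIso_le hv _ _

/-! ### The smoothing operator on integrable functions. -/

section Smoothing

variable {u w : E n → ℝ} {t : ℝ}

theorem vpDensity_of_pos (u : E n → ℝ) (ht : 0 < t) :
    vpDensity u t = fun x => ∫ y, u y * gaussIso (sigmaSq t) 0 (x - aCoef t • y) := by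
  funext x
  rw [vpDensity, if_neg ht.ne']

theorem integrable_vpDensity (hu : Integrable u) (ht : 0 < t) : Integrable (vpDensity u t) := by
  rw [vpDensity_of_pos u ht]
  exact (integrable_smoothing hu (sigmaSq_pos ht) _).integral_prod_left

theorem integral_vpDensity (hu : Integrable u) (ht : 0 < t) :
    ∫ x, vpDensity u t x = ∫ x, u x := by
  rw [vpDensity_of_pos u ht, integral_integral_swap (integrable_smoothing hu (sigmaSq_pos ht) _)]
  exact integral_congr_ae (Eventually.of_forall fun y =>
    integral_mul_gaussIso_sub y _ _ (sigmaSq_pos ht))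

theorem abs_vpDensity_le (ht : 0 < t) (x : E n) :
    |vpDensity u t x| ≤ vpDensity (fun y => |u y|) t x := by
  have hσ := sigmaSq_pos ht
  rw [vpDensity_of_pos u ht, vpDensity_of_pos _ ht]
  refine (abs_integral_le_integral_abs).trans (le_of_eq ?_)
  refine integral_congr_ae (Eventually.of_forall fun y => ?_)
  simp only [abs_mul, abs_of_pos (gaussIso_pos hσ _ _)]

theorem vpDensity_sub (hu : Integrable u) (hw : Integrable w) (ht : 0 < t) (x : E n) :
    vpDensity (fun y => u y - w y) t x = vpDensity u t x - vpDensity w t x := by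
  have hσ := sigmaSq_pos ht
  simp only [vpDensity_of_pos _ ht, sub_mul]
  exact integral_sub (integrable_mul_gaussIso hu hσ _ x) (integrable_mul_gaussIso hw hσ _ x)

/-- Smoothing is a contraction in `L¹`. -/
theorem integral_abs_vpDensity_sub_le (hu : Integrable u) (hw : Integrable w) (ht : 0 < t) :
    ∫ x, |vpDensity u t x - vpDensity w t x| ≤ ∫ x, |u x - w x| := by
  have hi : Integrable fun y => |u y - w y| := (hu.sub hw).abs
  rw [← integral_vpDensity hi ht]
  refine integral_mono ((integrable_vpDensity hu ht).sub (integrable_vpDensity hw ht)).abs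
    (integrable_vpDensity hi ht) fun x => ?_
  simp only [← vpDensity_sub hu hw ht]
  exact abs_vpDensity_le ht x

/-- The substitution `y = x / a + (σ / a) z` moves the time dependence from the kernel into the
argument of `u`, leaving the Jacobian factor `a^(-n)`. Over a fixed Gaussian law, dominated
convergence applies as `t → 0`. -/
theorem vpDensity_eq_integral_stdGaussMeasure (hu : Continuous u) (ht : 0 < t) (x : E n) :
    vpDensity u t x = (aCoef t ^ n)⁻¹ * ∫ z, u ((aCoef t)⁻¹ • x +
      (Real.sqrt (sigmaSq t) / aCoef t) • z) ∂stdGaussMeasure n := by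
  have hσ := sigmaSq_pos ht
  have ha := aCoef_pos t
  have hc : 0 < Real.sqrt (sigmaSq t) / aCoef t := div_pos (Real.sqrt_pos.2 hσ) ha
  have hv : (Real.sqrt (sigmaSq t) / aCoef t) ^ 2 * aCoef t ^ 2 = sigmaSq t := by
    rw [← mul_pow, div_mul_cancel₀ _ ha.ne', Real.sq_sqrt hσ.le]
  have hpdf : IsPdf fun y => gaussIso ((Real.sqrt (sigmaSq t) / aCoef t) ^ 2) 0
      (y - (aCoef t)⁻¹ • x) :=
    ⟨fun _ => (gaussIso_pos (pow_pos hc 2) _ _).le,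
      (integrable_gaussIso (pow_pos hc 2)).comp_sub_right _,
      (integral_sub_right_eq_self _ _).trans (integral_gaussIso (pow_pos hc 2))⟩
  have hmap := map_stdGaussMeasure_affine hc ((aCoef t)⁻¹ • x)
  have haff : Measurable fun z : E n => (aCoef t)⁻¹ • x +
      (Real.sqrt (sigmaSq t) / aCoef t) • z := by fun_prop
  have h1 := integral_map haff.aemeasurable (μ := stdGaussMeasure n)
    (f := u) hu.aestronglyMeasurable
  rw [← h1, hmap, hpdf.integral_densityMeasure, ← integral_const_mul, vpDensity_of_pos u ht]
  refine integral_congr_ae (Eventually.of_forall fun y => ?_)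
  have h2 := gaussIso_sq_smul ha _ (pow_pos hc 2) (y - (aCoef t)⁻¹ • x)
  have h3 : gaussIso (sigmaSq t) 0 (aCoef t • (y - (aCoef t)⁻¹ • x))
      = gaussIso (sigmaSq t) 0 (x - aCoef t • y) := by
    rw [smul_sub, smul_inv_smul₀ ha.ne', gaussIso, gaussIso, sub_zero, sub_zero, norm_sub_rev]
  rw [hv, h3] at h2
  simp only [← h2, smul_eq_mul]
  field_simp

theorem tendsto_vpDensity_zero (hu : Continuous u) (hc : HasCompactSupport u) (x : E n) :
    Tendsto (fun t => vpDensity u t x) (𝓝[>] 0) (𝓝 (u x)) := by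
  obtain ⟨C, hC⟩ := hc.exists_bound_of_continuous hu
  have ha : Tendsto aCoef (𝓝[>] 0) (𝓝 1) := by
    have := (continuous_aCoef.tendsto 0).mono_left (nhdsWithin_le_nhds (s := Ioi 0))
    simpa [aCoef] using this
  have hσ : Tendsto sigmaSq (𝓝[>] 0) (𝓝 0) := by
    have := (continuous_sigmaSq.tendsto 0).mono_left (nhdsWithin_le_nhds (s := Ioi 0))
    simpa [sigmaSq] using this
  have h1 : Tendsto (fun t => ∫ z, u ((aCoef t)⁻¹ • x +
      (Real.sqrt (sigmaSq t) / aCoef t) • z) ∂stdGaussMeasure n) (𝓝[>] 0)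
      (𝓝 (∫ _, u x ∂stdGaussMeasure n)) := by
    refine tendsto_integral_filter_of_dominated_convergence (fun _ => C)
      (Eventually.of_forall fun t => ?_)
      (Eventually.of_forall fun t => Eventually.of_forall fun z => hC _) (integrable_const C)
      (Eventually.of_forall fun z => (hu.tendsto x).comp ?_)
    · exact (hu.comp (by fun_prop)).aestronglyMeasurable
    · have h2 := ((ha.inv₀ one_ne_zero).smul_const x).add
        (((hσ.sqrt).div ha one_ne_zero).smul_const z)
      simpa using h2
  rw [integral_const, probReal_univ, one_smul] at h1
  have h3 := ((ha.pow n).inv₀ (by simp)).mul h1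
  rw [one_pow, inv_one, one_mul] at h3
  refine h3.congr' ?_
  filter_upwards [self_mem_nhdsWithin] with t ht
  rw [vpDensity_eq_integral_stdGaussMeasure hu ht]

end Smoothing

/-- The marginal densities converge to the initial density in `L¹`. -/
theorem exists_integral_abs_vpDensity_sub_lt {pH : E n → ℝ} (hpdf : IsPdf pH) {ε : ℝ}
    (hε : 0 < ε) : ∃ δ, 0 < δ ∧ ∫ x, |pH x - vpDensity pH δ x| < ε := by
  obtain ⟨g, hgc, hle, hgcont, hgi⟩ :=
    hpdf.integrable.exists_hasCompactSupport_integral_sub_le (ε := ε / 4) (by linarith)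
  -- Scheffé's lemma needs a nonnegative function; as `pH ≥ 0`, taking the positive part does not
  -- increase the distance to `pH`.
  set h : E n → ℝ := fun x => max (g x) 0 with hh
  have hcont : Continuous h := hgcont.max continuous_const
  have hcomp : HasCompactSupport h := hgc.comp_left (g := fun r => max r 0) (max_self 0)
  have hi : Integrable h := hcont.integrable_of_hasCompactSupport hcomp
  have h0 : ∀ x, 0 ≤ h x := fun x => le_max_right _ _
  have hle' : ∫ x, |pH x - h x| ≤ ε / 4 := by
    refine le_trans (integral_mono (hpdf.integrable.sub hi).abs (hpdf.integrable.sub hgi).norm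
      fun x => ?_) hle
    have e : pH x = max (pH x) 0 := (max_eq_left (hpdf.nonneg x)).symm
    change |pH x - max (g x) 0| ≤ |pH x - g x|
    conv_lhs => rw [e]
    exact abs_max_sub_max_le_abs _ _ _
  have hlim : Tendsto (fun t => ∫ x, |vpDensity h t x - h x|) (𝓝[>] 0) (𝓝 0) := by
    refine tendsto_integral_abs_sub_of_tendsto ?_ ?_ ?_ hi h0
      (tendsto_vpDensity_zero hcont hcomp)
    · filter_upwards [self_mem_nhdsWithin] with t ht using integrable_vpDensity hi ht
    · filter_upwards [self_mem_nhdsWithin] with t ht x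
      rw [vpDensity_of_pos h ht]
      exact integral_nonneg fun y => mul_nonneg (h0 y) (gaussIso_pos (sigmaSq_pos ht) _ _).le
    · filter_upwards [self_mem_nhdsWithin] with t ht using integral_vpDensity hi ht
  obtain ⟨δ, hδ, hδ0⟩ := ((hlim.eventually_lt_const (show (0 : ℝ) < ε / 4 by linarith)).and
    self_mem_nhdsWithin).exists
  refine ⟨δ, hδ0, ?_⟩
  have i1 : Integrable fun x => |pH x - h x| := (hpdf.integrable.sub hi).abs
  have i2 : Integrable fun x => |vpDensity h δ x - h x| :=
    ((integrable_vpDensity hi hδ0).sub hi).abs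
  have i3 : Integrable fun x => |vpDensity pH δ x - vpDensity h δ x| :=
    ((integrable_vpDensity hpdf.integrable hδ0).sub (integrable_vpDensity hi hδ0)).abs
  have i12 : Integrable fun x => |pH x - h x| + |vpDensity h δ x - h x| := i1.add i2
  have h3 := integral_abs_vpDensity_sub_le hpdf.integrable hi hδ0
  -- Through `h` and its smoothing; the last term is at most the first by contraction, so the total
  -- is below `3ε / 4`.
  have h4 : ∫ x, |pH x - vpDensity pH δ x| ≤ ∫ x, (|pH x - h x| + |vpDensity h δ x - h x| +
      |vpDensity pH δ x - vpDensity h δ x|) := by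
    refine integral_mono (hpdf.integrable.sub (integrable_vpDensity hpdf.integrable hδ0)).abs
      (i12.add i3) fun x => ?_
    have e : pH x - vpDensity pH δ x = (pH x - h x) - (vpDensity h δ x - h x) -
      (vpDensity pH δ x - vpDensity h δ x) := by ring
    change |pH x - vpDensity pH δ x| ≤ _
    rw [e]
    exact (abs_sub _ _).trans (add_le_add_left (abs_sub _ _) _)
  rw [integral_add i12 i3, integral_add i1 i2] at h4
  linarith

end VPFlow

/-! ### Transport of densities by the flow -/

namespace VPFlow

open Metric Function Filter Topology ODEFlow InformationTheory

variable {n : ℕ}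

/-! ### Pulling densities back along the flow. -/

section Transport

variable {φ : E n ≃ E n} {φ' : E n → E n →L[ℝ] E n}

theorem map_densityMeasure_of_mul_det (hφ : ∀ x, HasFDerivAt φ (φ' x) x) {p q : E n → ℝ}
    (hpq : ∀ x, |(φ' x).det| * q (φ x) = p x) :
    (densityMeasure p).map φ = densityMeasure q :=
  map_withDensity_eq_of_mul_det volume hφ fun x => by
    rw [← ENNReal.ofReal_mul (abs_nonneg _), hpq]

theorem map_symm_densityMeasure (hφ : ∀ x, HasFDerivAt φ (φ' x) x) (hs : Continuous φ.symm)
    (q : E n → ℝ) :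
    (densityMeasure q).map φ.symm = densityMeasure fun x => |(φ' x).det| * q (φ x) := by
  have hm : Measurable φ :=
    (continuous_iff_continuousAt.2 fun x => (hφ x).continuousAt).measurable
  rw [← map_densityMeasure_of_mul_det hφ (q := q) fun x => rfl, Measure.map_map hs.measurable hm]
  simp

theorem integrable_det_mul_comp (hφ : ∀ x, HasFDerivAt φ (φ' x) x) {f : E n → ℝ}
    (hf : Integrable f) : Integrable fun x => |(φ' x).det| * f (φ x) := by
  have h := (integrableOn_image_iff_integrableOn_abs_det_fderiv_smul volume MeasurableSet.univ
    (fun x _ => (hφ x).hasFDerivWithinAt) φ.injective.injOn f).1 hf.integrableOn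
  simpa using h

theorem integral_det_mul_comp (hφ : ∀ x, HasFDerivAt φ (φ' x) x) (f : E n → ℝ) :
    ∫ x, |(φ' x).det| * f (φ x) = ∫ x, f x := by
  have h := integral_image_eq_integral_abs_det_fderiv_smul volume MeasurableSet.univ
    (fun x _ => (hφ x).hasFDerivWithinAt) φ.injective.injOn f
  simpa [image_univ, φ.surjective.range_eq] using h.symm

theorem IsPdf.det_mul_comp (hφ : ∀ x, HasFDerivAt φ (φ' x) x) {q : E n → ℝ} (hq : IsPdf q) :
    IsPdf fun x => |(φ' x).det| * q (φ x) :=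
  ⟨fun _ => mul_nonneg (abs_nonneg _) (hq.nonneg _), integrable_det_mul_comp hφ hq.integrable,
    (integral_det_mul_comp hφ q).trans hq.integral_eq_one⟩

/-- Pulling back by a diffeomorphism preserves the `L¹` distance of densities. -/
theorem integral_abs_det_mul_comp_sub (hφ : ∀ x, HasFDerivAt φ (φ' x) x) (p q : E n → ℝ) :
    ∫ x, |(|(φ' x).det| * p (φ x) - |(φ' x).det| * q (φ x))| = ∫ x, |p x - q x| := by
  rw [← integral_det_mul_comp hφ fun x => |p x - q x|]
  refine integral_congr_ae (Eventually.of_forall fun x => ?_)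
  simp only [← mul_sub, abs_mul, abs_abs]

end Transport

/-- Representations of the marginals on all intervals of positive times. -/
theorem exists_mixtureRep {pH : E n → ℝ} (hpdf : IsPdf pH)
    (hclass : HasCompactSupport pH ∨ IsLogConcaveDensity pH ∨
      IsGaussianConvolution pH ∨ IsGaussianMixture pH) {δ : ℝ} (hδ : 0 < δ) (T : ℝ) :
    ∃ (b : OrthonormalBasis (Fin n) ℝ (E n)) (μ : Measure (E n)) (l : ℝ → Fin n → ℝ)
      (c : ℝ → ℝ), IsProbabilityMeasure μ ∧ MixtureRep pH b μ l c δ T := by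
  have hconv : IsGaussianConvolution pH → ∃ (b : OrthonormalBasis (Fin n) ℝ (E n))
      (μ : Measure (E n)) (l : ℝ → Fin n → ℝ) (c : ℝ → ℝ),
      IsProbabilityMeasure μ ∧ MixtureRep pH b μ l c δ T := fun h => by
    obtain ⟨b, μ, l, c, hμ, hrep⟩ := h.exists_mixtureRep hpdf T
    exact ⟨b, μ, l, c, hμ, hrep.mono (Icc_subset_Icc_left hδ.le)⟩
  rcases hclass with h | h | h | h
  · exact ⟨EuclideanSpace.basisFun (Fin n) ℝ, _, _, _, hpdf.isProbabilityMeasure,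
      HasCompactSupport.exists_mixtureRep hpdf h _ hδ⟩
  · exact ⟨EuclideanSpace.basisFun (Fin n) ℝ, _, _, _, hpdf.isProbabilityMeasure,
      h.mixtureRep hpdf _ hδ⟩
  · exact hconv h
  · exact hconv h.isGaussianConvolution

/-- The target side: the pulled back Gaussian law is close to the initial law. -/
theorem densityLpDist_one_map_symm_le {pH : E n → ℝ} (hpdf : IsPdf pH) {δ T : ℝ} (hδ : 0 < δ)
    {φ : E n ≃ E n} {φ' : E n → E n →L[ℝ] E n} (hs : Continuous φ.symm)
    (hφ : ∀ x, HasFDerivAt φ (φ' x) x)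
    (hdet : ∀ x, |(φ' x).det| * vpDensity pH T (φ x) = vpDensity pH δ x) :
    densityLpDist 1 (densityMeasure pH) ((stdGaussMeasure n).map φ.symm)
      ≤ ENNReal.ofReal ((∫ x, |pH x - vpDensity pH δ x|) +
        ∫ x, |vpDensity pH T x - stdGaussDensity x|) := by
  have hq := isPdf_stdGaussDensity.det_mul_comp (n := n) hφ
  have hpδ := hpdf.vpDensity hδ.le
  -- The distance from `p_T` to `p_Z` is rewritten as the distance between their pullbacks, the
  -- first of which is `p_δ`; the triangle inequality through `p_δ` remains.
  rw [stdGaussMeasure, map_symm_densityMeasure hφ hs, densityLpDist_one hpdf hq,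
    ← integral_abs_det_mul_comp_sub hφ (vpDensity pH T)]
  simp only [hdet]
  have i1 : Integrable fun x => |pH x - vpDensity pH δ x| :=
    (hpdf.integrable.sub hpδ.integrable).abs
  have i2 : Integrable fun x => |vpDensity pH δ x - |(φ' x).det| * stdGaussDensity (φ x)| :=
    (hpδ.integrable.sub hq.integrable).abs
  rw [← integral_add i1 i2]
  exact ENNReal.ofReal_le_ofReal (integral_mono (hpdf.integrable.sub hq.integrable).abs
    (i1.add i2) fun x => abs_sub_le _ _ _)

end VPFlow

/-! ### Assembly: choice of the two times. -/

theorem mainTheorem4 (n : ℕ) (pH : EuclideanSpace ℝ (Fin n) → ℝ) (hpdf : IsPdf pH)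
    (hmom : Integrable (fun x => ‖x‖ ^ 2 * pH x) volume)
    (hclass : HasCompactSupport pH ∨ IsLogConcaveDensity pH ∨
      IsGaussianConvolution pH ∨ IsGaussianMixture pH) :
    (∀ ε : ℝ, 0 < ε → ∃ δ T : ℝ, 0 < δ ∧ δ < T ∧
      ∃ φ : EuclideanSpace ℝ (Fin n) ≃ EuclideanSpace ℝ (Fin n),
        IsSolutionMap (vpVelocity pH) δ T φ ∧
        IsBiLipschitzDiffeo φ ∧
        InformationTheory.klDiv ((densityMeasure (vpDensity pH δ)).map φ) (stdGaussMeasure n)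
          < ENNReal.ofReal ε ∧
        densityLpDist 1 ((densityMeasure (vpDensity pH δ)).map φ) (stdGaussMeasure n)
          < ENNReal.ofReal ε ∧
        densityLpDist 2 ((densityMeasure (vpDensity pH δ)).map φ) (stdGaussMeasure n)
          < ENNReal.ofReal ε ∧
        wasserstein 1 ((densityMeasure (vpDensity pH δ)).map φ) (stdGaussMeasure n)
          < ENNReal.ofReal ε ∧
        wasserstein 2 ((densityMeasure (vpDensity pH δ)).map φ) (stdGaussMeasure n)
          < ENNReal.ofReal ε ∧
        densityLpDist 1 (densityMeasure pH) ((stdGaussMeasure n).map φ.symm)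
          < ENNReal.ofReal ε) ∧
    ((IsGaussianConvolution pH ∨ IsGaussianMixture pH) →
      ∀ ε : ℝ, 0 < ε → ∃ T : ℝ, 0 < T ∧
        ∃ φ : EuclideanSpace ℝ (Fin n) ≃ EuclideanSpace ℝ (Fin n),
          IsSolutionMap (vpVelocity pH) 0 T φ ∧
          IsBiLipschitzDiffeo φ ∧
          InformationTheory.klDiv (densityMeasure pH) ((stdGaussMeasure n).map φ.symm)
            < ENNReal.ofReal ε) := by
  refine ⟨fun ε hε => ?_, fun hAB ε hε => ?_⟩
  -- The time `δ` is fixed first, spending `ε / 2` on the initial smoothing. The limits as `T → ∞`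
  -- do not involve `δ`, so one large `T > δ` serves every latent estimate and the other `ε / 2`.
  · obtain ⟨δ, hδ, hδε⟩ := exists_integral_abs_vpDensity_sub_lt hpdf (half_pos hε)
    have hε' : (0 : ℝ≥0∞) < ENNReal.ofReal ε := ENNReal.ofReal_pos.2 hε
    obtain ⟨T, hT, hKL, hL1, hL2, hW1, hW2, hI⟩ :=
      ((Filter.eventually_gt_atTop δ).and
      (((tendsto_klDiv hpdf hmom).eventually_lt_const hε').and
      (((tendsto_densityLpDist_one hpdf).eventually_lt_const hε').and
      (((tendsto_densityLpDist_two hpdf).eventually_lt_const hε').and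
      (((tendsto_wasserstein_one hpdf hmom).eventually_lt_const hε').and
      (((tendsto_wasserstein_two hpdf hmom).eventually_lt_const hε').and
      ((tendsto_integral_abs_vpDensity_sub hpdf).eventually_lt_const (half_pos hε)))))))).exists
    obtain ⟨b, μ, l, c, hμ, hrep⟩ := exists_mixtureRep hpdf hclass hδ T
    obtain ⟨φ, hsol, hbi, φ', hφ, hdet⟩ := hrep.exists_flow_map hpdf hδ.le hT
    have hmap := map_densityMeasure_of_mul_det hφ hdet
    refine ⟨δ, T, hδ, hT, φ, hsol, hbi, ?_⟩
    rw [hmap]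
    refine ⟨hKL, hL1, hL2, hW1, hW2, ?_⟩
    refine (densityLpDist_one_map_symm_le hpdf hδ hbi.contDiff_symm.continuous hφ
      hdet).trans_lt ?_
    rw [ENNReal.ofReal_lt_ofReal_iff hε]
    linarith
  · have hconv : IsGaussianConvolution pH := hAB.elim id fun h => h.isGaussianConvolution
    obtain ⟨T, hT, hKL⟩ := ((Filter.eventually_gt_atTop 0).and
      ((tendsto_klDiv hpdf hmom).eventually_lt_const (ENNReal.ofReal_pos.2 hε))).exists
    obtain ⟨b, μ, l, c, hμ, hrep⟩ := hconv.exists_mixtureRep hpdf T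
    obtain ⟨φ, hsol, hbi, φ', hφ, hdet⟩ := hrep.exists_flow_map hpdf le_rfl hT
    refine ⟨T, hT, φ, hsol, hbi, lt_of_le_of_lt ?_ hKL⟩
    -- Starting at time `0` makes the pullback of `p_T` equal to `p_H` itself, so relative entropy
    -- can be compared through `φ.symm` without an intermediate density.
    have hp0 : densityMeasure pH = (densityMeasure (vpDensity pH T)).map φ.symm := by
      rw [map_symm_densityMeasure hφ hbi.contDiff_symm.continuous]
      simp only [hdet]
      congr 1
      funext x
      simp [vpDensity]
    have hpT := (hpdf.vpDensity hT.le).isProbabilityMeasure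
    rw [hp0]
    exact InformationTheory.klDiv_map_le _ _ hbi.contDiff_symm.continuous.measurable
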